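/- Let $n\ge 3$ and let $m>\frac n2+1$ be an integer. Let $\tau,c>0$, $b,k\in\mathbb R$, and let $g:(0,\infty)\to\mathbb R$ be a memory kernel such that: $g\in W^{1,1}(0,\infty)$ and $g'$ is (locally) absolutely continuous on $(0,\infty)$; $g\ge 0$ and $0<\int_0^\infty g(s)\,ds<c^2$; there is $\zeta>0$ with $g'\le-\zeta g$ on $(0,\infty)$; and $g''\ge0$ almost everywhere. Put $c_g^2=c^2-\int_0^\infty g(s)\,ds$ and assume $b>\tau c^2>\tau c_g^2$. Consider on $[0,T]\times\mathbb R^n$ the system $$\psi_t=v,\quad v_t=w,\quad \tau w_t=-w+c_g^2\Delta\psi+b\Delta v+\int_0^\infty g(s)\Delta\eta(s)\,ds+f,\quad \eta_t=v-\eta_s,\qquad f=2(kvw+\nabla\psi\cdot\nabla v),$$ with $\eta|_{s=0}=0$ and $(\psi,v,w,\eta)|_{t=0}=\Psi_0=(\psi_0,\psi_1,\psi_2,\psi_0)$, so that $\eta(t,s)=\psi(t)-\psi(t-s)$ for $0<s\le t$ and $\eta(t,s)=\psi(t)$ for $s>t$. A solution on $[0,T]$ means a weak solution $\Psi=(\psi,v,w,\eta)$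 (the equations tested in space with functions in $C_c^\infty(\mathbb R^n)$) with $\nabla\psi\in C([0,T];H^{m-1}(\mathbb R^n))$, $v\in C([0,T];H^m(\mathbb R^n))$, $w\in C([0,T];H^{m-1}(\mathbb R^n))$. With $\|\eta\|^2_{L^2,-g'}=\int_0^\infty(-g'(s))\|\eta(s)\|_{L^2(\mathbb R^n)}^2\,ds$, define for $\kappa\ge0$ $$\begin{aligned}\mathcal E^{(\kappa)}[\Psi]={}&\|\nabla^{\kappa+1}(\psi+\tau v)\|_{L^2}^2+\|\nabla^\kappa(v+\tau w)\|_{L^2}^2+\|\nabla^{\kappa+1}v\|_{L^2}^2+\|\nabla^{\kappa+1}\eta\|_{L^2,-g'}^2+\|\nabla^\kappa w\|_{L^2}^2\\&+\|\Delta\nabla^\kappa(\psi+\tau v)\|_{L^2}^2+\|\nabla^{\kappa+1}(v+\tau w)\|_{L^2}^2+\|\Delta\nabla^\kappa v\|_{L^2}^2+\|\Delta\nabla^\kappa\eta\|_{L^2,-g'}^2,\\ \mathcal D^{(\kappa)}[\Psi]={}&\|\nabla^{\kappa+1}v\|_{L^2}^2+\|\nabla^{\kappa+1}\eta\|_{L^2,-g'}^2+\|\Delta\nabla^\kappa(\psi+\tau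 v)\|_{L^2}^2+\|\nabla^{\kappa+1}(v+\tau w)\|_{L^2}^2\\&+\|\Delta\nabla^\kappa v\|_{L^2}^2+\|\Delta\nabla^\kappa\eta\|_{L^2,-g'}^2+\|\nabla^\kappa w\|_{L^2}^2,\end{aligned}$$ and, with $F^{(\kappa)}=\nabla^\kappa f$, $$\mathcal F_0^{(\kappa)}(\varphi)=(F^{(\kappa)},\varphi)_{L^2},\qquad \mathcal F_1^{(\kappa)}(\varphi)=(\nabla F^{(\kappa)},\nabla\varphi)_{L^2}.$$ Then for each $\kappa\in\{0,1,\dots,m-2\}$ there is a constant $C>0$, independent of $T$, of the time $t$, of the initial data and of the solution, such that for every $T>0$, every solution $\Psi$ on $[0,T]$ and every $t\in[0,T]$ all the quantities below are well defined and finite (in particular $F^{(\kappa)}\in H^1(\mathbb R^n)$ at each time) and $$\begin{aligned}\sup_{0\le\sigma\le t}\mathcal E^{(\kappa)}[\Psi](\sigma)+\int_0^t\mathcal D^{(\kappa)}[\Psi](\sigma)\,d\sigma\le C\Big(\mathcal E^{(\kappa)}[\Psi_0]+\int_0^t\Big\{&|\mathcal F_0^{(\kappa)}(\nabla^\kappa(v+\tau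 w))|+|\mathcal F_1^{(\kappa)}(\nabla^\kappa(v+\tau w))|+|\mathcal F_0^{(\kappa)}(\nabla^\kappa w)|\\&+|\mathcal F_1^{(\kappa)}(\nabla^\kappa(\psi+\tau v))|+|\mathcal F_1^{(\kappa)}(\tau\nabla^\kappa v)|\Big\}\,d\sigma\Big).\end{aligned}$$ -/

import Mathlib

open MeasureTheory Set Filter Topology
open scoped ContDiff

namespace JMGT

/-- The Euclidean space `ℝⁿ`. -/
abbrev E (n : ℕ) : Type := EuclideanSpace ℝ (Fin n)

section WeakDerivatives

variable {n : ℕ}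

/-- `du` is a weak (distributional) partial derivative `∂_j u` of the locally integrable function
`u` on `ℝⁿ`. -/
def HasWeakPartial (j : Fin n) (u du : E n → ℝ) : Prop :=
  LocallyIntegrable u volume ∧ LocallyIntegrable du volume ∧
    ∀ φ : E n → ℝ, ContDiff ℝ ∞ φ → HasCompactSupport φ →
      ∫ x, u x * fderiv ℝ φ x (EuclideanSpace.single j 1) = -∫ x, du x * φ x

/-- `u` has a weak partial derivative in direction `j`. -/
def WeaklyDiff (j : Fin n) (u : E n → ℝ) : Prop := ∃ du, HasWeakPartial j u du

open Classical in
/-- A representative of the weak partial derivative `∂_j u` (which is unique up to null sets);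
zero if there is none. -/
noncomputable def wpartial (j : Fin n) (u : E n → ℝ) : E n → ℝ :=
  if h : WeaklyDiff j u then Classical.choose h else 0

/-- The tensor `∇^κ u` of all weak derivatives of order `κ`: its entry with index
`I = (i₁, …, i_κ)` is `∂_{i₁} ⋯ ∂_{i_κ} u`. -/
noncomputable def wgrad : (κ : ℕ) → (E n → ℝ) → (Fin κ → Fin n) → E n → ℝ
  | 0, u, _ => u
  | κ + 1, u, I => wpartial (I 0) (wgrad κ u (Fin.tail I))

/-- The weak Laplacian `Δ u = ∑_j ∂_j ∂_j u`. -/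
noncomputable def wlap (u : E n → ℝ) : E n → ℝ :=
  fun x => ∑ j, wpartial j (wpartial j u) x

/-- The Sobolev space `H^m(ℝⁿ)`: all weak derivatives of order at most `m` exist and are in
`L²`. -/
def MemSobolev (m : ℕ) (u : E n → ℝ) : Prop :=
  (∀ κ, κ < m → ∀ (I : Fin κ → Fin n) (j : Fin n), WeaklyDiff j (wgrad κ u I)) ∧
  (∀ κ, κ ≤ m → ∀ I : Fin κ → Fin n, MemLp (wgrad κ u I) 2 volume)

/-- The space `{ψ : ∇ψ, …, ∇^m ψ ∈ L²(ℝⁿ)}`; the function `ψ` itself is only required to be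
locally integrable. -/
def MemHomSobolev (m : ℕ) (u : E n → ℝ) : Prop :=
  LocallyIntegrable u volume ∧
  (∀ κ, κ < m → ∀ (I : Fin κ → Fin n) (j : Fin n), WeaklyDiff j (wgrad κ u I)) ∧
  (∀ κ, 1 ≤ κ → κ ≤ m → ∀ I : Fin κ → Fin n, MemLp (wgrad κ u I) 2 volume)

/-- Continuity on `[0,T]` in the `L²(ℝⁿ)` norm. -/
def ContL2 (T : ℝ) (u : ℝ → E n → ℝ) : Prop :=
  ∀ t ∈ Icc (0 : ℝ) T,
    Tendsto (fun r => eLpNorm (u r - u t) 2 volume) (𝓝[Icc 0 T] t) (𝓝 0)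

/-- `u ∈ C([0,T]; H^m(ℝⁿ))`. -/
def ContSobolev (T : ℝ) (m : ℕ) (u : ℝ → E n → ℝ) : Prop :=
  (∀ t ∈ Icc (0 : ℝ) T, MemSobolev m (u t)) ∧
  ∀ κ, κ ≤ m → ∀ I : Fin κ → Fin n, ContL2 T (fun t => wgrad κ (u t) I)

/-- `u` takes values in `{ψ : ∇ψ, …, ∇^m ψ ∈ L²}` and is continuous on `[0,T]` with respect to
`‖∇ψ‖_{H^{m-1}}`. -/
def ContHomSobolev (T : ℝ) (m : ℕ) (u : ℝ → E n → ℝ) : Prop :=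
  (∀ t ∈ Icc (0 : ℝ) T, MemHomSobolev m (u t)) ∧
  ∀ κ, 1 ≤ κ → κ ≤ m → ∀ I : Fin κ → Fin n, ContL2 T (fun t => wgrad κ (u t) I)

end WeakDerivatives

/-- The assumptions (G1)-(G4) on the memory kernel `g` on `(0,∞)`, relative to the speed of
sound `c`:
`g ∈ W^{1,1}(0,∞)` with `g'` (locally) absolutely continuous on `(0,∞)`;
`g ≥ 0` and `0 < ∫ g < c²`; `g' ≤ -ζ g` for some `ζ > 0`; `g'' ≥ 0` almost everywhere. -/
structure MemoryKernel (c : ℝ) (g : ℝ → ℝ) : Prop where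
  diff : ∀ s, 0 < s → DifferentiableAt ℝ g s
  integrable : IntegrableOn g (Ioi 0) volume
  integrable_deriv : IntegrableOn (deriv g) (Ioi 0) volume
  absCont_deriv : ∀ a b, 0 < a → a < b → AbsolutelyContinuousOnInterval (deriv g) a b
  nonneg : ∀ s, 0 < s → 0 ≤ g s
  integral_pos : 0 < ∫ s in Ioi (0 : ℝ), g s
  integral_lt : ∫ s in Ioi (0 : ℝ), g s < c ^ 2
  decay : ∃ ζ : ℝ, 0 < ζ ∧ ∀ s, 0 < s → deriv g s ≤ -ζ * g s
  deriv2_nonneg : ∀ᵐ s ∂(volume.restrict (Ioi (0 : ℝ))), 0 ≤ deriv (deriv g) s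

/-- The square of the modified speed, `c_g² = c² - ∫_0^∞ g(s) ds`. -/
noncomputable def cgSq (c : ℝ) (g : ℝ → ℝ) : ℝ := c ^ 2 - ∫ s in Ioi (0 : ℝ), g s

section System

variable {n : ℕ}

/-- The past-history variable `η(t,s)`: `ψ(t) - ψ(t-s)` for `0 < s ≤ t` and `ψ(t)` for
`s > t`. -/
noncomputable def history (ψ : ℝ → E n → ℝ) (t s : ℝ) : E n → ℝ :=
  if s ≤ t then ψ t - ψ (t - s) else ψ t

/-- The nonlinearity `2 (k v w + ∇ψ · ∇v)`. -/
noncomputable def nonlin (k : ℝ) (ψ v w : E n → ℝ) : E n → ℝ :=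
  fun x => 2 * (k * v x * w x + ∑ j, wpartial j ψ x * wpartial j v x)

/-- `Ψ = (ψ, v, w, η)`, with `η = history ψ`, is a solution on `[0,T]` of
`ψ_t = v`, `v_t = w`,
`τ w_t = -w + c_g² Δψ + b Δv + ∫_0^∞ g(s) Δη(s) ds + 2 (k v w + ∇ψ · ∇v)`, `η_t = v - η_s`
with `(ψ, v, w, η)(0) = (ψ₀, ψ₁, ψ₂, ψ₀)`, in the class `C([0,T]; 𝓗^{m-1})`.
The first three equations are tested in space with smooth compactly supported functions; the
fourth one, its initial datum and `η(s = 0) = 0` are solved explicitly by `history ψ`, and the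
continuity of `η` in the weighted space follows from that of `ψ`. -/
structure IsSolution (m : ℕ) (τ b c k : ℝ) (g : ℝ → ℝ) (T : ℝ) (ψ₀ ψ₁ ψ₂ : E n → ℝ)
    (ψ v w : ℝ → E n → ℝ) : Prop where
  init_ψ : ψ 0 =ᵐ[volume] ψ₀
  init_v : v 0 =ᵐ[volume] ψ₁
  init_w : w 0 =ᵐ[volume] ψ₂
  cont_ψ : ContHomSobolev T m ψ
  cont_v : ContSobolev T m v
  cont_w : ContSobolev T (m - 1) w
  eq_ψ : ∀ φ : E n → ℝ, ContDiff ℝ ∞ φ → HasCompactSupport φ → ∀ t ∈ Icc (0 : ℝ) T,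
    HasDerivWithinAt (fun r => ∫ x, ψ r x * φ x) (∫ x, v t x * φ x) (Icc 0 T) t
  eq_v : ∀ φ : E n → ℝ, ContDiff ℝ ∞ φ → HasCompactSupport φ → ∀ t ∈ Icc (0 : ℝ) T,
    HasDerivWithinAt (fun r => ∫ x, v r x * φ x) (∫ x, w t x * φ x) (Icc 0 T) t
  eq_w : ∀ φ : E n → ℝ, ContDiff ℝ ∞ φ → HasCompactSupport φ → ∀ t ∈ Icc (0 : ℝ) T,
    HasDerivWithinAt (fun r => τ * ∫ x, w r x * φ x)
      (-(∫ x, w t x * φ x) + cgSq c g * (∫ x, wlap (ψ t) x * φ x)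
        + b * (∫ x, wlap (v t) x * φ x)
        + (∫ s in Ioi (0 : ℝ), g s * ∫ x, wlap (history ψ t s) x * φ x)
        + ∫ x, nonlin k (ψ t) (v t) (w t) x * φ x) (Icc 0 T) t

end System

section Energies

variable {n : ℕ}

/-- `‖∇^κ u‖²_{L²}`. -/
noncomputable def gradSq (κ : ℕ) (u : E n → ℝ) : ℝ :=
  ∑ I : Fin κ → Fin n, ∫ x, (wgrad κ u I x) ^ 2

/-- `‖Δ ∇^κ u‖²_{L²}`. -/
noncomputable def lapGradSq (κ : ℕ) (u : E n → ℝ) : ℝ :=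
  ∑ I : Fin κ → Fin n, ∫ x, (wlap (wgrad κ u I) x) ^ 2

/-- The square of a weighted norm, `∫_0^∞ (-g'(s)) N(s) ds`, where `N(s)` is the square of a norm
of `η(s)`. -/
noncomputable def memSq (g : ℝ → ℝ) (N : ℝ → ℝ) : ℝ :=
  ∫ s in Ioi (0 : ℝ), -deriv g s * N s

/-- The energy `𝓔^{(κ)}[Ψ]` of order `κ`, for `Ψ = (ψ, v, w, η)`. -/
noncomputable def energy (τ : ℝ) (g : ℝ → ℝ) (κ : ℕ) (ψ v w : E n → ℝ) (η : ℝ → E n → ℝ) : ℝ :=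
  gradSq (κ + 1) (ψ + τ • v) + gradSq κ (v + τ • w) + gradSq (κ + 1) v
    + memSq g (fun s => gradSq (κ + 1) (η s)) + gradSq κ w
    + lapGradSq κ (ψ + τ • v) + gradSq (κ + 1) (v + τ • w) + lapGradSq κ v
    + memSq g (fun s => lapGradSq κ (η s))

/-- The dissipation `𝓓^{(κ)}[Ψ]` of order `κ`, for `Ψ = (ψ, v, w, η)`. -/
noncomputable def dissipation (τ : ℝ) (g : ℝ → ℝ) (κ : ℕ) (ψ v w : E n → ℝ)
    (η : ℝ → E n → ℝ) : ℝ :=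
  gradSq (κ + 1) v + memSq g (fun s => gradSq (κ + 1) (η s))
    + lapGradSq κ (ψ + τ • v) + gradSq (κ + 1) (v + τ • w) + lapGradSq κ v
    + memSq g (fun s => lapGradSq κ (η s)) + gradSq κ w

/-- `𝓕₀^{(κ)}(φ) = (F^{(κ)}, φ)_{L²}` with `F^{(κ)} = ∇^κ f`, for a tensor field `φ` of
order `κ`. -/
noncomputable def pair0 (κ : ℕ) (f : E n → ℝ) (φ : (Fin κ → Fin n) → E n → ℝ) : ℝ :=
  ∑ I : Fin κ → Fin n, ∫ x, wgrad κ f I x * φ I x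

/-- `𝓕₁^{(κ)}(φ) = (∇F^{(κ)}, ∇φ)_{L²}` with `F^{(κ)} = ∇^κ f`, for a tensor field `φ` of
order `κ`. -/
noncomputable def pair1 (κ : ℕ) (f : E n → ℝ) (φ : (Fin κ → Fin n) → E n → ℝ) : ℝ :=
  ∑ I : Fin κ → Fin n, ∑ j, ∫ x, wpartial j (wgrad κ f I) x * wpartial j (φ I) x

/-- The sum of the absolute values of the five nonlinear pairings, with
`f = 2 (k v w + ∇ψ · ∇v)`. -/
noncomputable def nonlinearPairings (τ k : ℝ) (κ : ℕ) (ψ v w : E n → ℝ) : ℝ :=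
  |pair0 κ (nonlin k ψ v w) (wgrad κ (v + τ • w))|
    + |pair1 κ (nonlin k ψ v w) (wgrad κ (v + τ • w))|
    + |pair0 κ (nonlin k ψ v w) (wgrad κ w)|
    + |pair1 κ (nonlin k ψ v w) (wgrad κ (ψ + τ • v))|
    + |pair1 κ (nonlin k ψ v w) (τ • wgrad κ v)|

end Energies

end JMGT

/-! The estimate is an energy estimate for the linear system, with `f` treated as a given source.
Let G = |∇|, p = Gψ, y = p + τGv, z = v + τw, C = c_g², and let m = ∫ g η ds be built from the
history η of p. The equation becomes z' = f - C Gy - (b - τC) G²v - Gm, and by Plancherel every norm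
in 𝓔 and 𝓓 is a norm of a power of G applied to ψ, v, w or η.

Two functionals carry the bound. The Lyapunov functional ½‖z‖² + ½C‖y‖² + ½τ(b - τC)‖Gv‖² + τ⟨m, Gv⟩
+ ½∫g‖η‖² + ½τ∫(-g')‖η‖² is designed so that all memory cross terms cancel, leaving the dissipation
(b - τc²)‖Gv‖² + ½∫(-g')‖η‖² (`AbstractSolution.lyapunov_le`). It is used for the solution and for
its image under G. The remaining dissipation, in Gy, Gz and w, comes from ⟨y, Gz⟩ - 2τ⟨Gv, Gz⟩ +
τ‖w‖²/(12C) (`AbstractSolution.crossFunctional_le`), whose errors are absorbed by a large multiple N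
of the two Lyapunov functionals. This gives `abstract_estimate`, with a constant depending only on
τ, b, c and g.

The history need not be differentiated in s. The identity η(t+δ, s+δ) = η(t, s) + p(t+δ) - p(t)
replaces the transport equation, and monotonicity of g and of -g' yields one-sided derivative bounds
for the weighted norms, which are then integrated by `le_add_integral_of_dini`.

A solution is too rough for this argument at the top order, since ∇^{m-1}w_t need not be in L².
Hence G is replaced by its restriction to frequencies at most R, a bounded self-adjoint operator on
L²; the truncated derivatives of a solution solve the abstract system exactly
(`IsSolution.abstractSolution`). As the constant does not depend on R, the estimate survives R → ∞
(`SpecPaths.estimate_of_map`).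

The function ψ itself need not lie in L². Its curl-free gradient determines a symbol q with F(∂_jψ)
= 2πiξ_j q (`MemHomSobolev.exists_hasSymbol`), which serves as its Fourier transform. Finally, `f`
lies in H^{m-1} because m - 1 > n/2 makes H^{m-1} an algebra (`exists_sobNorm_mul_le`), so all
pairings are finite and continuous in time. -/

namespace JMGT

/-! ### Monotonicity and convexity of the memory kernel. -/

section Kernel

/-- A nonnegative, nonincreasing, integrable kernel on `(0,∞)`. -/
structure AntitoneKernel (h : ℝ → ℝ) : Prop where
  integrable : IntegrableOn h (Ioi 0) volume
  nonneg : ∀ s, 0 < s → 0 ≤ h s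
  antitone : AntitoneOn h (Ioi 0)

variable {c : ℝ} {g : ℝ → ℝ}

/-- Absolute continuity is what turns the almost everywhere sign of g'' into monotonicity, through
the fundamental theorem of calculus for g'. -/
theorem MemoryKernel.monotoneOn_deriv (hg : MemoryKernel c g) : MonotoneOn (deriv g) (Ioi 0) := by
  intro a ha b hb hab
  rcases hab.eq_or_lt with rfl | hab
  · exact le_rfl
  have h := (hg.absCont_deriv a b ha hab).integral_deriv_eq_sub
  have : 0 ≤ ∫ x in a..b, deriv (deriv g) x := by
    rw [intervalIntegral.integral_of_le hab.le]
    apply integral_nonneg_of_ae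
    have hsub : Ioc a b ⊆ Ioi (0 : ℝ) := fun x hx => lt_trans ha hx.1
    exact ae_restrict_of_ae_restrict_of_subset hsub hg.deriv2_nonneg
  linarith

theorem MemoryKernel.deriv_nonpos (hg : MemoryKernel c g) {s : ℝ} (hs : 0 < s) :
    deriv g s ≤ 0 := by
  obtain ⟨ζ, hζ, h⟩ := hg.decay
  nlinarith [h s hs, hg.nonneg s hs, mul_nonneg hζ.le (hg.nonneg s hs)]

theorem MemoryKernel.continuousOn (hg : MemoryKernel c g) : ContinuousOn g (Ioi 0) :=
  fun s hs => (hg.diff s hs).continuousAt.continuousWithinAt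

theorem MemoryKernel.differentiableOn (hg : MemoryKernel c g) : DifferentiableOn ℝ g (Ioi 0) :=
  fun s hs => (hg.diff s hs).differentiableWithinAt

theorem MemoryKernel.antitone (hg : MemoryKernel c g) : AntitoneOn g (Ioi 0) := by
  apply antitoneOn_of_deriv_nonpos (convex_Ioi 0) hg.continuousOn
  · rw [interior_Ioi]; exact hg.differentiableOn
  · rw [interior_Ioi]; exact fun s hs => hg.deriv_nonpos hs

theorem MemoryKernel.antitoneKernel (hg : MemoryKernel c g) : AntitoneKernel g :=
  ⟨hg.integrable, hg.nonneg, hg.antitone⟩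

theorem MemoryKernel.antitoneKernel_neg_deriv (hg : MemoryKernel c g) :
    AntitoneKernel (fun s => -deriv g s) :=
  ⟨hg.integrable_deriv.neg, fun s hs => by have := hg.deriv_nonpos hs; linarith,
    fun a ha b hb hab => neg_le_neg (hg.monotoneOn_deriv ha hb hab)⟩

/-- Convexity of g through the mean value theorem. The upper bound produces the dissipation weighted
by -g'; the lower bound dominates the difference quotients of g by the integrable function |g'|. -/
theorem MemoryKernel.shift_bounds (hg : MemoryKernel c g) {s δ : ℝ} (hs : 0 < s) (hδ : 0 < δ) :
    deriv g s * δ ≤ g (s + δ) - g s ∧ g (s + δ) - g s ≤ deriv g (s + δ) * δ := by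
  have hc : ContinuousOn g (Icc s (s + δ)) :=
    hg.continuousOn.mono fun x hx => lt_of_lt_of_le hs hx.1
  have hd : DifferentiableOn ℝ g (Ioo s (s + δ)) :=
    hg.differentiableOn.mono fun x hx => lt_trans hs hx.1
  obtain ⟨x, hx, h⟩ := exists_deriv_eq_slope g (by linarith : s < s + δ) hc hd
  have hxp : 0 < x := hs.trans hx.1
  have hsd : 0 < s + δ := by linarith
  have h1 := hg.monotoneOn_deriv (a := s) hs hxp hx.1.le
  have h2 := hg.monotoneOn_deriv (a := x) hxp hsd hx.2.le
  have : g (s + δ) - g s = deriv g x * δ := by rw [h, add_sub_cancel_left, div_mul_cancel₀ _ hδ.ne']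
  rw [this]
  exact ⟨mul_le_mul_of_nonneg_right h1 hδ.le, mul_le_mul_of_nonneg_right h2 hδ.le⟩

end Kernel

/-- Integration of an upper right Dini derivative bound. -/
theorem le_add_integral_of_dini {M r : ℝ → ℝ} {T : ℝ} (hM : Continuous M) (hr : Continuous r)
    (h : ∀ t ∈ Ico 0 T, ∃ ρ : ℝ → ℝ, Tendsto ρ (𝓝[>] 0) (𝓝 (r t)) ∧
      ∀ᶠ δ in 𝓝[>] (0 : ℝ), M (t + δ) - M t ≤ δ * ρ δ) :
    ∀ t ∈ Icc 0 T, M t ≤ M 0 + ∫ σ in (0 : ℝ)..t, r σ := by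
  intro t ht
  refine image_le_of_liminf_slope_right_le_deriv_boundary (a := 0) (b := T) (f := M)
    (B := fun t => M 0 + ∫ σ in (0 : ℝ)..t, r σ) (B' := r) hM.continuousOn (by simp) ?_ ?_ ?_ ht
  · exact (continuous_const.add
      (intervalIntegral.continuous_primitive (fun a b => hr.intervalIntegrable a b) 0)).continuousOn
  · intro x _
    exact ((intervalIntegral.integral_hasDerivAt_right (hr.intervalIntegrable 0 x)
      hr.aestronglyMeasurable.stronglyMeasurableAtFilter hr.continuousAt).const_add
        (M 0)).hasDerivWithinAt
  · intro x hx y hy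
    obtain ⟨ρ, hρ, hle⟩ := h x hx
    apply Eventually.frequently
    have hmap : Tendsto (fun z => z - x) (𝓝[>] x) (𝓝[>] 0) := by
      apply tendsto_nhdsWithin_of_tendsto_nhds_of_eventually_within
      · have : Tendsto (fun z => z - x) (𝓝 x) (𝓝 (x - x)) := tendsto_id.sub_const x
        rw [sub_self] at this
        exact this.mono_left nhdsWithin_le_nhds
      · filter_upwards [self_mem_nhdsWithin] with z hz
        exact sub_pos.2 (mem_Ioi.1 hz)
    filter_upwards [hmap.eventually hle, hmap.eventually (hρ.eventually (gt_mem_nhds hy)),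
      self_mem_nhdsWithin] with z h1 h2 hz
    have hz' : 0 < z - x := sub_pos.2 (mem_Ioi.1 hz)
    rw [slope_def_field, div_lt_iff₀ hz']
    have e : x + (z - x) = z := by ring
    rw [e] at h1
    nlinarith

/-! ### Bounded paths in a normed space and their past histories. -/

section Paths

set_option linter.unusedSectionVars false

variable {H : Type*} [NormedAddCommGroup H] [NormedSpace ℝ H]

/-- The past history `p t - p (t - s)`, with `p` extended by zero to negative times. -/
noncomputable def hist {H : Type*} [AddCommGroup H] (p : ℝ → H) (t s : ℝ) : H :=
  if s ≤ t then p t - p (t - s) else p t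

theorem hist_map {H K : Type*} [AddCommGroup H] [AddCommGroup K] (L : H →+ K) (p : ℝ → H)
    (t s : ℝ) : hist (fun t => L (p t)) t s = L (hist p t s) := by
  unfold hist; split_ifs <;> simp

/-- The equation η_t + η_s = p' integrated along a characteristic. Every differentiation of a memory
term in time rests on it, so η is never differentiated in s. -/
theorem hist_add_add {H : Type*} [AddCommGroup H] (p : ℝ → H) (t s δ : ℝ) :
    hist p (t + δ) (s + δ) = hist p t s + (p (t + δ) - p t) := by
  unfold hist
  have : t + δ - (s + δ) = t - s := by ring
  simp only [add_le_add_iff_right, this]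
  split_ifs <;> abel

/-- A bounded continuous path. -/
structure BddCont (p : ℝ → H) : Prop where
  cont : Continuous p
  bdd : ∃ B, ∀ t, ‖p t‖ ≤ B

theorem BddCont.exists_nonneg {p : ℝ → H} (hp : BddCont p) : ∃ B, 0 ≤ B ∧ ∀ t, ‖p t‖ ≤ B := by
  obtain ⟨B, hB⟩ := hp.bdd
  exact ⟨B, (norm_nonneg _).trans (hB 0), hB⟩

theorem BddCont.add {p q : ℝ → H} (hp : BddCont p) (hq : BddCont q) :
    BddCont (fun t => p t + q t) := by
  obtain ⟨B, hB⟩ := hp.bdd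
  obtain ⟨B', hB'⟩ := hq.bdd
  exact ⟨hp.cont.add hq.cont, B + B', fun t => (norm_add_le _ _).trans (add_le_add (hB t) (hB' t))⟩

theorem BddCont.const_smul {p : ℝ → H} (hp : BddCont p) (a : ℝ) :
    BddCont (fun t => a • p t) := by
  obtain ⟨B, hB⟩ := hp.bdd
  refine ⟨hp.cont.const_smul a, |a| * B, fun t => ?_⟩
  rw [norm_smul]
  exact mul_le_mul_of_nonneg_left (hB t) (abs_nonneg _)

theorem BddCont.clm {K : Type*} [NormedAddCommGroup K] [NormedSpace ℝ K] {p : ℝ → H}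
    (hp : BddCont p) (L : H →L[ℝ] K) : BddCont (fun t => L (p t)) := by
  obtain ⟨B, hB⟩ := hp.bdd
  exact ⟨L.continuous.comp hp.cont, ‖L‖ * B,
    fun t => (L.le_opNorm _).trans (mul_le_mul_of_nonneg_left (hB t) (norm_nonneg _))⟩

/-- A bounded continuous path with bounded continuous right derivative `p'` on `[0,T)`. -/
structure C1Path (T : ℝ) (p p' : ℝ → H) : Prop where
  left : BddCont p
  right : BddCont p'
  deriv : ∀ t ∈ Ico 0 T, HasDerivWithinAt p (p' t) (Ici t) t

theorem C1Path.add {T : ℝ} {p p' q q' : ℝ → H} (hp : C1Path T p p') (hq : C1Path T q q') :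
    C1Path T (fun t => p t + q t) (fun t => p' t + q' t) :=
  ⟨hp.left.add hq.left, hp.right.add hq.right, fun t ht => (hp.deriv t ht).add (hq.deriv t ht)⟩

theorem C1Path.const_smul {T : ℝ} {p p' : ℝ → H} (hp : C1Path T p p') (a : ℝ) :
    C1Path T (fun t => a • p t) (fun t => a • p' t) :=
  ⟨hp.left.const_smul a, hp.right.const_smul a, fun t ht => (hp.deriv t ht).const_smul a⟩

theorem C1Path.clm {K : Type*} [NormedAddCommGroup K] [NormedSpace ℝ K] {T : ℝ}
    {p p' : ℝ → H} (hp : C1Path T p p') (L : H →L[ℝ] K) :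
    C1Path T (fun t => L (p t)) (fun t => L (p' t)) :=
  ⟨hp.left.clm L, hp.right.clm L,
    fun t ht => L.hasFDerivAt.comp_hasDerivWithinAt t (hp.deriv t ht)⟩

theorem C1Path.lipschitz {T : ℝ} {p p' : ℝ → H} (hp : C1Path T p p') :
    ∃ L, 0 ≤ L ∧ ∀ a b, 0 ≤ a → a ≤ b → b ≤ T → ‖p b - p a‖ ≤ L * (b - a) := by
  obtain ⟨L, hL0, hL⟩ := hp.right.exists_nonneg
  refine ⟨L, hL0, fun a b ha hab hb => ?_⟩
  exact norm_image_sub_le_of_norm_deriv_right_le_segment (f := p) (f' := p')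
    hp.left.cont.continuousOn (fun x hx => hp.deriv x ⟨ha.trans hx.1, hx.2.trans_le hb⟩)
    (fun x _ => hL x) b ⟨hab, le_rfl⟩

theorem C1Path.tendsto_diffQuot {T : ℝ} {p p' : ℝ → H} (hp : C1Path T p p') {t : ℝ}
    (ht : t ∈ Ico 0 T) :
    Tendsto (fun δ : ℝ => δ⁻¹ • (p (t + δ) - p t)) (𝓝[>] 0) (𝓝 (p' t)) := by
  have h := (hp.deriv t ht).Ioi_of_Ici
  rw [hasDerivWithinAt_iff_tendsto_slope' (by simp)] at h
  have hmap : Tendsto (fun δ : ℝ => t + δ) (𝓝[>] 0) (𝓝[>] t) := by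
    apply tendsto_nhdsWithin_of_tendsto_nhds_of_eventually_within
    · have : Tendsto (fun δ : ℝ => t + δ) (𝓝 0) (𝓝 (t + 0)) := tendsto_id.const_add t
      rw [add_zero] at this
      exact this.mono_left nhdsWithin_le_nhds
    · filter_upwards [self_mem_nhdsWithin] with z hz
      simpa using hz
  refine (h.comp hmap).congr fun δ => ?_
  simp [slope_def_module]

theorem hist_norm_le {p : ℝ → H} {B : ℝ} (hB0 : 0 ≤ B) (hB : ∀ t, ‖p t‖ ≤ B) (t s : ℝ) :
    ‖hist p t s‖ ≤ 2 * B := by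
  unfold hist
  split_ifs
  · exact (norm_sub_le _ _).trans (by linarith [hB t, hB (t - s)])
  · linarith [hB t]

theorem hist_aestronglyMeasurable {p : ℝ → H} (hp : Continuous p) (t : ℝ) :
    AEStronglyMeasurable (hist p t) (volume.restrict (Ioi (0 : ℝ))) := by
  unfold hist
  apply AEStronglyMeasurable.mono_measure _ Measure.restrict_le_self
  apply StronglyMeasurable.aestronglyMeasurable
  refine StronglyMeasurable.ite (p := fun s => s ≤ t) measurableSet_Iic ?_ stronglyMeasurable_const
  exact (continuous_const.sub (hp.comp (continuous_const.sub continuous_id))).stronglyMeasurable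

/-- At s = t the two branches differ by p(0), so the history may jump there. A single age is a null
set, hence integrals over s remain continuous in t. -/
theorem hist_continuousAt {p : ℝ → H} (hp : Continuous p) {t s : ℝ} (hts : s ≠ t) :
    ContinuousAt (fun r => hist p r s) t := by
  rcases lt_or_gt_of_ne hts with h | h
  · have : (fun r => hist p r s) =ᶠ[𝓝 t] fun r => p r - p (r - s) := by
      filter_upwards [lt_mem_nhds h] with r hr
      simp [hist, hr.le]
    exact (ContinuousAt.congr (by fun_prop) this.symm)
  · have : (fun r => hist p r s) =ᶠ[𝓝 t] p := by
      filter_upwards [gt_mem_nhds h] with r hr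
      simp [hist, hr]
    exact hp.continuousAt.congr this.symm

variable {F : Type*} [NormedAddCommGroup F] [NormedSpace ℝ F]

/-- The general Φ, bounded on bounded sets, covers η, ‖η‖² and ‖η + d‖² at once. -/
theorem integrable_smul_hist {h : ℝ → ℝ} (hh : IntegrableOn h (Ioi 0) volume) {p : ℝ → H}
    (hp : BddCont p) {Φ : H → F} (hΦ : Continuous Φ)
    (hb : ∀ B, ∃ K, ∀ x, ‖x‖ ≤ B → ‖Φ x‖ ≤ K) (t : ℝ) :
    IntegrableOn (fun s => h s • Φ (hist p t s)) (Ioi 0) volume := by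
  obtain ⟨B, hB0, hB⟩ := hp.exists_nonneg
  obtain ⟨K, hK⟩ := hb (2 * B)
  refine Integrable.mono' (g := fun s => ‖h s‖ * K) (hh.norm.mul_const K)
    (hh.aestronglyMeasurable.smul
      (hΦ.comp_aestronglyMeasurable (hist_aestronglyMeasurable hp.cont t))) (ae_of_all _ fun s => ?_)
  rw [norm_smul]
  exact mul_le_mul_of_nonneg_left (hK _ (hist_norm_le hB0 hB t s)) (norm_nonneg _)

theorem continuous_integral_smul_hist {h : ℝ → ℝ} (hh : IntegrableOn h (Ioi 0) volume) {p : ℝ → H}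
    (hp : BddCont p) {Φ : H → F} (hΦ : Continuous Φ)
    (hb : ∀ B, ∃ K, ∀ x, ‖x‖ ≤ B → ‖Φ x‖ ≤ K) :
    Continuous (fun t => ∫ s in Ioi (0 : ℝ), h s • Φ (hist p t s)) := by
  obtain ⟨B, hB0, hB⟩ := hp.exists_nonneg
  obtain ⟨K, hK⟩ := hb (2 * B)
  rw [continuous_iff_continuousAt]
  intro t
  refine continuousAt_of_dominated (bound := fun s => ‖h s‖ * K)
    (Eventually.of_forall fun r => (integrable_smul_hist hh hp hΦ hb r).aestronglyMeasurable)
    (Eventually.of_forall fun r => ae_of_all _ fun s => ?_) (hh.norm.mul_const K) ?_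
  · rw [norm_smul]
    exact mul_le_mul_of_nonneg_left (hK _ (hist_norm_le hB0 hB r s)) (norm_nonneg _)
  · have : ∀ᵐ s ∂(volume.restrict (Ioi (0 : ℝ))), s ≠ t :=
      ae_restrict_of_ae (by simp [ae_iff, measure_singleton])
    filter_upwards [this] with s hs
    exact continuousAt_const.smul (hΦ.continuousAt.comp (hist_continuousAt hp.cont hs))

/-- `∫_0^∞ h(s) ‖η(t,s)‖² ds`. -/
noncomputable def memNormSq (h : ℝ → ℝ) (p : ℝ → H) (t : ℝ) : ℝ :=
  ∫ s in Ioi (0 : ℝ), h s * ‖hist p t s‖ ^ 2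

/-- `∫_0^∞ h(s) η(t,s) ds`. -/
noncomputable def memInt (h : ℝ → ℝ) (p : ℝ → H) (t : ℝ) : H :=
  ∫ s in Ioi (0 : ℝ), h s • hist p t s

theorem normSq_bdd (B : ℝ) : ∃ K, ∀ x : H, ‖x‖ ≤ B → ‖‖x‖ ^ 2‖ ≤ K :=
  ⟨B ^ 2, fun x hx => by
    rw [Real.norm_of_nonneg (by positivity)]
    exact pow_le_pow_left₀ (norm_nonneg _) hx 2⟩

theorem integrable_memNormSq {h : ℝ → ℝ} (hh : IntegrableOn h (Ioi 0) volume) {p : ℝ → H}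
    (hp : BddCont p) (t : ℝ) :
    IntegrableOn (fun s => h s * ‖hist p t s‖ ^ 2) (Ioi 0) volume :=
  integrable_smul_hist hh hp (Φ := fun x : H => ‖x‖ ^ 2) (by fun_prop) normSq_bdd t

theorem integrable_memInt {h : ℝ → ℝ} (hh : IntegrableOn h (Ioi 0) volume) {p : ℝ → H}
    (hp : BddCont p) (t : ℝ) :
    IntegrableOn (fun s => h s • hist p t s) (Ioi 0) volume :=
  integrable_smul_hist hh hp (Φ := fun x : H => x) (by fun_prop) (fun B => ⟨B, fun _ h => h⟩) t

theorem continuous_memNormSq {h : ℝ → ℝ} (hh : IntegrableOn h (Ioi 0) volume) {p : ℝ → H}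
    (hp : BddCont p) : Continuous (memNormSq h p) :=
  continuous_integral_smul_hist hh hp (Φ := fun x : H => ‖x‖ ^ 2) (by fun_prop) normSq_bdd

theorem continuous_memInt {h : ℝ → ℝ} (hh : IntegrableOn h (Ioi 0) volume) {p : ℝ → H}
    (hp : BddCont p) : Continuous (memInt h p) :=
  continuous_integral_smul_hist hh hp (Φ := fun x : H => x) (by fun_prop)
    (fun B => ⟨B, fun _ h => h⟩)

theorem memNormSq_nonneg {h : ℝ → ℝ} (hh : AntitoneKernel h) (p : ℝ → H) (t : ℝ) :
    0 ≤ memNormSq h p t :=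
  setIntegral_nonneg measurableSet_Ioi fun s hs => mul_nonneg (hh.nonneg s hs) (by positivity)

end Paths


/-! ### Translating integrals over the half line. -/

section Shift

set_option linter.unusedSectionVars false

variable {F : Type*} [NormedAddCommGroup F] [NormedSpace ℝ F]

theorem integrableOn_Ioi_shift {f : ℝ → F} (hf : IntegrableOn f (Ioi 0) volume) {δ : ℝ}
    (hδ : 0 < δ) : IntegrableOn (fun s => f (s + δ)) (Ioi 0) volume := by
  have h := (measurePreserving_add_right (volume : Measure ℝ) δ).integrableOn_comp_preimage
    (measurableEmbedding_addRight δ) (f := f) (s := Ioi δ)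
  have e : (fun x => x + δ) ⁻¹' Ioi δ = Ioi 0 := by ext x; simp
  rw [e] at h
  exact h.2 (hf.mono_set (Ioi_subset_Ioi hδ.le))

theorem setIntegral_Ioi_shift {f : ℝ → F} (hf : IntegrableOn f (Ioi 0) volume) {δ : ℝ}
    (hδ : 0 < δ) :
    ∫ s in Ioi (0 : ℝ), f s = (∫ s in Ioc 0 δ, f s) + ∫ s in Ioi (0 : ℝ), f (s + δ) := by
  have h := (measurePreserving_add_right (volume : Measure ℝ) δ).setIntegral_preimage_emb
    (measurableEmbedding_addRight δ) f (Ioi δ)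
  have e : (fun x => x + δ) ⁻¹' Ioi δ = Ioi 0 := by ext x; simp
  rw [e] at h
  rw [h, ← setIntegral_union (Ioc_disjoint_Ioi le_rfl) measurableSet_Ioi
    (hf.mono_set Ioc_subset_Ioi_self) (hf.mono_set (Ioi_subset_Ioi hδ.le)),
    Ioc_union_Ioi_eq_Ioi hδ.le]

theorem tendsto_setIntegral_Ioc_zero {f : ℝ → F} (hf : IntegrableOn f (Ioi 0) volume) :
    Tendsto (fun δ : ℝ => ∫ s in Ioc 0 δ, f s) (𝓝[>] 0) (𝓝 0) := by
  have hi : Integrable (indicator (Ioi 0) f) volume := hf.integrable_indicator measurableSet_Ioi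
  have hc := intervalIntegral.continuous_primitive (fun a b => hi.intervalIntegrable (a := a)
    (b := b)) 0
  have := (hc.tendsto 0).mono_left (nhdsWithin_le_nhds (s := Ioi 0))
  rw [intervalIntegral.integral_same] at this
  refine this.congr' ?_
  filter_upwards [self_mem_nhdsWithin] with δ hδ
  rw [intervalIntegral.integral_of_le (le_of_lt hδ)]
  exact setIntegral_congr_fun measurableSet_Ioc fun s hs => indicator_of_mem hs.1 f

end Shift

/-! ### Time derivatives of the memory terms. -/

section Memory

set_option linter.unusedSectionVars false

variable {H : Type*} [NormedAddCommGroup H] [InnerProductSpace ℝ H]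

local notation "⟪" x ", " y "⟫" => inner ℝ x y

theorem hist_norm_le_of_lipschitz {T L : ℝ} {p : ℝ → H}
    (hL : ∀ a b, 0 ≤ a → a ≤ b → b ≤ T → ‖p b - p a‖ ≤ L * (b - a)) (hL0 : 0 ≤ L)
    {t δ s : ℝ} (ht : 0 ≤ t) (htT : t + δ ≤ T) (hs : s ∈ Ioc 0 δ) :
    ‖hist p (t + δ) s‖ ≤ L * δ := by
  have h1 : s ≤ t + δ := by linarith [hs.2]
  have := hL (t + δ - s) (t + δ) (by linarith) (by linarith [hs.1]) htT
  simp only [hist, h1, if_true]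
  refine this.trans (mul_le_mul_of_nonneg_left ?_ hL0)
  linarith [hs.2]

/-- Ages above δ at time t + δ are the old ages moved along characteristics; ages up to δ form a new
layer. -/
theorem memNormSq_shift {h : ℝ → ℝ} (hh : IntegrableOn h (Ioi 0) volume) {p : ℝ → H}
    (hp : BddCont p) {t δ : ℝ} (hδ : 0 < δ) :
    memNormSq h p (t + δ) = (∫ s in Ioc 0 δ, h s * ‖hist p (t + δ) s‖ ^ 2)
      + ∫ s in Ioi (0 : ℝ), h (s + δ) * ‖hist p t s + (p (t + δ) - p t)‖ ^ 2 := by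
  unfold memNormSq
  rw [setIntegral_Ioi_shift (integrable_memNormSq hh hp (t + δ)) hδ]
  simp only [hist_add_add]

/-- In the new layer η is at most Lδ by the Lipschitz bound, so the layer is O(δ²) and leaves no
trace in the derivative. This is where η(s = 0) = 0 acts. -/
theorem setIntegral_Ioc_memNormSq_le {h : ℝ → ℝ} (hh : AntitoneKernel h) {T L : ℝ} {p : ℝ → H}
    (hp : BddCont p)
    (hL : ∀ a b, 0 ≤ a → a ≤ b → b ≤ T → ‖p b - p a‖ ≤ L * (b - a)) (hL0 : 0 ≤ L)
    {t δ : ℝ} (ht : 0 ≤ t) (htT : t + δ ≤ T) :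
    ∫ s in Ioc 0 δ, h s * ‖hist p (t + δ) s‖ ^ 2 ≤ (L * δ) ^ 2 * ∫ s in Ioi (0 : ℝ), h s := by
  calc ∫ s in Ioc 0 δ, h s * ‖hist p (t + δ) s‖ ^ 2
      ≤ ∫ s in Ioc 0 δ, (L * δ) ^ 2 * h s := by
        refine setIntegral_mono_on ((integrable_memNormSq hh.integrable hp _).mono_set
          Ioc_subset_Ioi_self) ((hh.integrable.mono_set Ioc_subset_Ioi_self).const_mul _)
          measurableSet_Ioc fun s hs => ?_
        rw [mul_comm]
        exact mul_le_mul_of_nonneg_right (pow_le_pow_left₀ (norm_nonneg _)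
          (hist_norm_le_of_lipschitz hL hL0 ht htT hs) 2) (hh.nonneg s hs.1)
    _ = (L * δ) ^ 2 * ∫ s in Ioc 0 δ, h s := by rw [integral_const_mul]
    _ ≤ _ := by
        refine mul_le_mul_of_nonneg_left ?_ (by positivity)
        refine setIntegral_mono_set hh.integrable ?_ (Eventually.of_forall fun s hs => hs.1)
        exact (ae_restrict_iff' measurableSet_Ioi).2 (ae_of_all _ hh.nonneg)

theorem hist_add_const_bddCont {p : ℝ → H} {h : ℝ → ℝ} (hh : IntegrableOn h (Ioi 0) volume)
    (hp : BddCont p) (t : ℝ) (d : H) :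
    IntegrableOn (fun s => h s * ‖hist p t s + d‖ ^ 2) (Ioi 0) volume := by
  refine integrable_smul_hist hh hp (Φ := fun x : H => ‖x + d‖ ^ 2) (by fun_prop) (fun B => ?_) t
  obtain ⟨K, hK⟩ := normSq_bdd (H := H) (B + ‖d‖)
  exact ⟨K, fun x hx => hK _ ((norm_add_le _ _).trans (by linarith))⟩

variable [CompleteSpace H]

theorem integral_hist_add_const {p : ℝ → H} {h : ℝ → ℝ} (hh : IntegrableOn h (Ioi 0) volume)
    (hp : BddCont p) (t : ℝ) (d : H) :
    ∫ s in Ioi (0 : ℝ), h s * ‖hist p t s + d‖ ^ 2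
      = memNormSq h p t + 2 * ⟪memInt h p t, d⟫ + ‖d‖ ^ 2 * ∫ s in Ioi (0 : ℝ), h s := by
  have e : ∀ s, h s * ‖hist p t s + d‖ ^ 2
      = (h s * ‖hist p t s‖ ^ 2 + 2 * ⟪d, h s • hist p t s⟫) + ‖d‖ ^ 2 * h s := by
    intro s
    rw [norm_add_sq_real, inner_smul_right, real_inner_comm]; ring
  have i1 := integrable_memNormSq hh hp t
  have i2 := (integrable_memInt hh hp t)
  have i3 : IntegrableOn (fun s => 2 * ⟪d, h s • hist p t s⟫) (Ioi 0) volume :=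
    (i2.const_inner d).const_mul 2
  simp_rw [e]
  have i13 : IntegrableOn (fun s => h s * ‖hist p t s‖ ^ 2 + 2 * ⟪d, h s • hist p t s⟫) (Ioi 0)
      volume := i1.add i3
  rw [integral_add i13 (hh.const_mul _), integral_add i1 i3, integral_const_mul,
    integral_const_mul, integral_inner i2, real_inner_comm]
  rfl

/-- Cauchy–Schwarz for the weight h: the quadratic polynomial x ↦ ∫ h‖η + x m‖², with m = ∫ h η, is
nonnegative. -/
theorem norm_memInt_sq_le {h : ℝ → ℝ} (hh : AntitoneKernel h) {p : ℝ → H} (hp : BddCont p)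
    (t : ℝ) : ‖memInt h p t‖ ^ 2 ≤ (∫ s in Ioi (0 : ℝ), h s) * memNormSq h p t := by
  set I := ∫ s in Ioi (0 : ℝ), h s
  have hI : 0 ≤ I := setIntegral_nonneg measurableSet_Ioi hh.nonneg
  have key : ∀ x : ℝ, 0 ≤ memNormSq h p t + 2 * x * ‖memInt h p t‖ ^ 2
      + x ^ 2 * ‖memInt h p t‖ ^ 2 * I := by
    intro x
    have h1 := integral_hist_add_const hh.integrable hp t (x • memInt h p t)
    have h2 : 0 ≤ ∫ s in Ioi (0 : ℝ), h s * ‖hist p t s + x • memInt h p t‖ ^ 2 :=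
      setIntegral_nonneg measurableSet_Ioi fun s hs => mul_nonneg (hh.nonneg s hs) (by positivity)
    rw [h1, inner_smul_right, real_inner_self_eq_norm_sq, norm_smul, mul_pow, Real.norm_eq_abs,
      sq_abs] at h2
    linarith
  -- For a kernel of mass zero the polynomial is affine in x, and its boundedness below forces m =
  -- 0. Otherwise it is evaluated at its minimiser x = -1/I.
  rcases hI.eq_or_lt with h0 | hpos
  · rw [← h0] at key ⊢
    have hM := memNormSq_nonneg hh p t
    by_contra hlt
    push Not at hlt
    rw [zero_mul] at hlt
    have := key (-(memNormSq h p t + 1) / ‖memInt h p t‖ ^ 2)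
    have e : 2 * (-(memNormSq h p t + 1) / ‖memInt h p t‖ ^ 2) * ‖memInt h p t‖ ^ 2
      = -2 * (memNormSq h p t + 1) := by
      rw [mul_assoc, div_mul_cancel₀ _ hlt.ne']; ring
    rw [e] at this
    linarith
  · have := key (-1 / I)
    have e : (-1 / I) ^ 2 * ‖memInt h p t‖ ^ 2 * I = ‖memInt h p t‖ ^ 2 / I := by field_simp
    have e2 : 2 * (-1 / I) * ‖memInt h p t‖ ^ 2 = -2 * (‖memInt h p t‖ ^ 2 / I) := by ring
    rw [e, e2] at this
    have h3 : ‖memInt h p t‖ ^ 2 / I ≤ memNormSq h p t := by linarith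
    rwa [div_le_iff₀ hpos, mul_comm] at h3

/-- Replacing h(s + δ) by the larger h(s) discards a loss of favourable sign, so monotonicity of h
is all that is needed. The intended kernel is -g', which may be unbounded near 0. -/
theorem memNormSq_add_le {h : ℝ → ℝ} (hh : AntitoneKernel h) {T L : ℝ} {p p' : ℝ → H}
    (hp : C1Path T p p')
    (hL : ∀ a b, 0 ≤ a → a ≤ b → b ≤ T → ‖p b - p a‖ ≤ L * (b - a)) (hL0 : 0 ≤ L)
    {t δ : ℝ} (ht : 0 ≤ t) (hδ : 0 < δ) (htT : t + δ ≤ T) :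
    memNormSq h p (t + δ) - memNormSq h p t
      ≤ δ * (2 * ⟪memInt h p t, δ⁻¹ • (p (t + δ) - p t)⟫
        + 2 * L ^ 2 * δ * ∫ s in Ioi (0 : ℝ), h s) := by
  have hI : 0 ≤ ∫ s in Ioi (0 : ℝ), h s := setIntegral_nonneg measurableSet_Ioi hh.nonneg
  have h1 := setIntegral_Ioc_memNormSq_le hh hp.left hL hL0 ht htT
  have h2 : ∫ s in Ioi (0 : ℝ), h (s + δ) * ‖hist p t s + (p (t + δ) - p t)‖ ^ 2
      ≤ ∫ s in Ioi (0 : ℝ), h s * ‖hist p t s + (p (t + δ) - p t)‖ ^ 2 := by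
    refine setIntegral_mono_on ?_ (hist_add_const_bddCont hh.integrable hp.left t _)
      measurableSet_Ioi fun s hs => mul_le_mul_of_nonneg_right
        (hh.antitone hs (by simp only [mem_Ioi] at *; linarith) (by linarith)) (by positivity)
    exact hist_add_const_bddCont (integrableOn_Ioi_shift hh.integrable hδ) hp.left t _
  rw [integral_hist_add_const hh.integrable hp.left] at h2
  have h3 : ‖p (t + δ) - p t‖ ^ 2 ≤ (L * δ) ^ 2 := by
    have := hL t (t + δ) ht (by linarith) htT
    rw [add_sub_cancel_left] at this
    exact pow_le_pow_left₀ (norm_nonneg _) this 2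
  rw [memNormSq_shift hh.integrable hp.left hδ, inner_smul_right]
  have e : δ * (2 * (δ⁻¹ * ⟪memInt h p t, p (t + δ) - p t⟫)
      + 2 * L ^ 2 * δ * ∫ s in Ioi (0 : ℝ), h s)
      = 2 * ⟪memInt h p t, p (t + δ) - p t⟫ + 2 * ((L * δ) ^ 2 * ∫ s in Ioi (0 : ℝ), h s) := by
    field_simp
  rw [e]
  have := mul_le_mul_of_nonneg_right h3 hI
  linarith

theorem eventually_add_le {t T : ℝ} (ht : t ∈ Ico 0 T) :
    ∀ᶠ δ in 𝓝[>] (0 : ℝ), 0 < δ ∧ t + δ ≤ T := by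
  have : Ioc 0 (T - t) ∈ 𝓝[>] (0 : ℝ) := Ioc_mem_nhdsGT (by linarith [ht.2])
  filter_upwards [this] with δ hδ
  exact ⟨hδ.1, by linarith [hδ.2]⟩

theorem memNormSq_le_integral {h : ℝ → ℝ} (hh : AntitoneKernel h) {T : ℝ} {p p' : ℝ → H}
    (hp : C1Path T p p') : ∀ t ∈ Icc 0 T,
    memNormSq h p t ≤ memNormSq h p 0 + ∫ σ in (0 : ℝ)..t, 2 * ⟪memInt h p σ, p' σ⟫ := by
  obtain ⟨L, hL0, hL⟩ := hp.lipschitz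
  refine le_add_integral_of_dini (continuous_memNormSq hh.integrable hp.left)
    (continuous_const.mul ((continuous_memInt hh.integrable hp.left).inner hp.right.cont)) ?_
  intro t ht
  refine ⟨fun δ => 2 * ⟪memInt h p t, δ⁻¹ • (p (t + δ) - p t)⟫
        + 2 * L ^ 2 * δ * ∫ s in Ioi (0 : ℝ), h s, ?_, ?_⟩
  · have h1 : Tendsto (fun δ : ℝ => 2 * ⟪memInt h p t, δ⁻¹ • (p (t + δ) - p t)⟫) (𝓝[>] 0)
        (𝓝 (2 * ⟪memInt h p t, p' t⟫)) :=
      (tendsto_const_nhds.inner (hp.tendsto_diffQuot ht)).const_mul 2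
    have h2 : Tendsto (fun δ : ℝ => 2 * L ^ 2 * δ * ∫ s in Ioi (0 : ℝ), h s) (𝓝[>] 0)
        (𝓝 (2 * L ^ 2 * 0 * ∫ s in Ioi (0 : ℝ), h s)) :=
      ((tendsto_id.mono_left nhdsWithin_le_nhds).const_mul _).mul_const _
    simpa using h1.add h2
  · filter_upwards [eventually_add_le ht] with δ hδ
    exact memNormSq_add_le hh hp hL hL0 ht.1 hδ.1 hδ.2

variable {c : ℝ} {g : ℝ → ℝ}

/-- For g the loss is kept: convexity gives g(s + δ) ≤ g(s) - δ(-g'(s + δ)). The kernel is thus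
evaluated at the shifted age, which is why the dissipation appears at time t + δ; continuity in time
moves it back to t in the limit. -/
theorem MemoryKernel.memNormSq_add_le (hg : MemoryKernel c g) {T L : ℝ} {p p' : ℝ → H}
    (hp : C1Path T p p')
    (hL : ∀ a b, 0 ≤ a → a ≤ b → b ≤ T → ‖p b - p a‖ ≤ L * (b - a)) (hL0 : 0 ≤ L)
    {t δ : ℝ} (ht : 0 ≤ t) (hδ : 0 < δ) (htT : t + δ ≤ T) :
    memNormSq g p (t + δ) - memNormSq g p t
      ≤ δ * (2 * ⟪memInt g p t, δ⁻¹ • (p (t + δ) - p t)⟫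
        - memNormSq (fun s => -deriv g s) p (t + δ)
        + (2 * L ^ 2 * δ * (∫ s in Ioi (0 : ℝ), g s)
          + L ^ 2 * δ ^ 2 * ∫ s in Ioi (0 : ℝ), -deriv g s)) := by
  have hh := hg.antitoneKernel
  have hh' := hg.antitoneKernel_neg_deriv
  have hI : 0 ≤ ∫ s in Ioi (0 : ℝ), g s := setIntegral_nonneg measurableSet_Ioi hh.nonneg
  have h1 := setIntegral_Ioc_memNormSq_le hh hp.left hL hL0 ht htT
  have h1' := setIntegral_Ioc_memNormSq_le hh' hp.left hL hL0 ht htT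
  have i1 := hist_add_const_bddCont hh.integrable hp.left t (p (t + δ) - p t)
  have i1s := hist_add_const_bddCont (integrableOn_Ioi_shift hh.integrable hδ) hp.left t
    (p (t + δ) - p t)
  have i2 := hist_add_const_bddCont (integrableOn_Ioi_shift hh'.integrable hδ) hp.left t
    (p (t + δ) - p t)
  have h2 : ∫ s in Ioi (0 : ℝ), g (s + δ) * ‖hist p t s + (p (t + δ) - p t)‖ ^ 2
      ≤ ∫ s in Ioi (0 : ℝ), (g s * ‖hist p t s + (p (t + δ) - p t)‖ ^ 2
        - δ * (-deriv g (s + δ) * ‖hist p t s + (p (t + δ) - p t)‖ ^ 2)) := by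
    refine setIntegral_mono_on i1s (i1.sub (i2.const_mul δ)) measurableSet_Ioi fun s hs => ?_
    have := (hg.shift_bounds hs hδ).2
    have hx : 0 ≤ ‖hist p t s + (p (t + δ) - p t)‖ ^ 2 := by positivity
    nlinarith [mul_le_mul_of_nonneg_right this hx]
  rw [integral_sub i1 (i2.const_mul δ), integral_const_mul,
    integral_hist_add_const hh.integrable hp.left] at h2
  have h3 : ‖p (t + δ) - p t‖ ^ 2 ≤ (L * δ) ^ 2 := by
    have := hL t (t + δ) ht (by linarith) htT
    rw [add_sub_cancel_left] at this
    exact pow_le_pow_left₀ (norm_nonneg _) this 2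
  have h4 := memNormSq_shift hh'.integrable hp.left (t := t) hδ
  rw [memNormSq_shift hh.integrable hp.left hδ, inner_smul_right]
  have e : ∀ a x y z : ℝ, δ * (2 * (δ⁻¹ * a) - x + (2 * L ^ 2 * δ * y + L ^ 2 * δ ^ 2 * z))
      = 2 * a - δ * x + 2 * ((L * δ) ^ 2 * y) + δ * ((L * δ) ^ 2 * z) := by
    intro a x y z
    field_simp
    ring
  rw [e]
  have h5 := mul_le_mul_of_nonneg_right h3 hI
  have h6 := mul_le_mul_of_nonneg_left h1' hδ.le
  have h7 : δ * memNormSq (fun s => -deriv g s) p (t + δ) = _ := congrArg (δ * ·) h4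
  simp only [mul_add] at h7
  linarith

theorem MemoryKernel.memNormSq_le_integral (hg : MemoryKernel c g) {T : ℝ} {p p' : ℝ → H}
    (hp : C1Path T p p') : ∀ t ∈ Icc 0 T,
    memNormSq g p t ≤ memNormSq g p 0
      + ∫ σ in (0 : ℝ)..t, (2 * ⟪memInt g p σ, p' σ⟫ - memNormSq (fun s => -deriv g s) p σ) := by
  have hh := hg.antitoneKernel
  have hh' := hg.antitoneKernel_neg_deriv
  obtain ⟨L, hL0, hL⟩ := hp.lipschitz
  have hc' := continuous_memNormSq hh'.integrable hp.left
  refine le_add_integral_of_dini (continuous_memNormSq hh.integrable hp.left)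
    ((continuous_const.mul ((continuous_memInt hh.integrable hp.left).inner hp.right.cont)).sub
      hc') ?_
  intro t ht
  refine ⟨fun δ => 2 * ⟪memInt g p t, δ⁻¹ • (p (t + δ) - p t)⟫
        - memNormSq (fun s => -deriv g s) p (t + δ)
        + (2 * L ^ 2 * δ * (∫ s in Ioi (0 : ℝ), g s)
          + L ^ 2 * δ ^ 2 * ∫ s in Ioi (0 : ℝ), -deriv g s), ?_, ?_⟩
  · have h1 : Tendsto (fun δ : ℝ => 2 * ⟪memInt g p t, δ⁻¹ • (p (t + δ) - p t)⟫) (𝓝[>] 0)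
        (𝓝 (2 * ⟪memInt g p t, p' t⟫)) :=
      (tendsto_const_nhds.inner (hp.tendsto_diffQuot ht)).const_mul 2
    have h2 : Tendsto (fun δ : ℝ => memNormSq (fun s => -deriv g s) p (t + δ)) (𝓝[>] 0)
        (𝓝 (memNormSq (fun s => -deriv g s) p (t + 0))) :=
      ((hc'.comp (continuous_const.add continuous_id)).tendsto 0).mono_left nhdsWithin_le_nhds
    have h3 : Tendsto (fun δ : ℝ => 2 * L ^ 2 * δ * (∫ s in Ioi (0 : ℝ), g s)
          + L ^ 2 * δ ^ 2 * ∫ s in Ioi (0 : ℝ), -deriv g s) (𝓝[>] 0)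
        (𝓝 (2 * L ^ 2 * 0 * (∫ s in Ioi (0 : ℝ), g s)
          + L ^ 2 * 0 ^ 2 * ∫ s in Ioi (0 : ℝ), -deriv g s)) := by
      apply Tendsto.mono_left _ nhdsWithin_le_nhds
      apply Continuous.tendsto (f := fun δ : ℝ => 2 * L ^ 2 * δ * (∫ s in Ioi (0 : ℝ), g s)
          + L ^ 2 * δ ^ 2 * ∫ s in Ioi (0 : ℝ), -deriv g s)
      fun_prop
    have := (h1.sub h2).add h3
    simpa using this
  · filter_upwards [eventually_add_le ht] with δ hδ
    exact hg.memNormSq_add_le hp hL hL0 ht.1 hδ.1 hδ.2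

/-- Formally ∫ g η_t = ∫ g (p' - η_s), followed by integration by parts in s. In the proof the
difference quotient is split into the new layer, the variation of g, and the increment of p. -/
theorem MemoryKernel.c1Path_memInt (hg : MemoryKernel c g) {T : ℝ} {p p' : ℝ → H}
    (hp : C1Path T p p') :
    C1Path T (memInt g p)
      (fun t => (∫ s in Ioi (0 : ℝ), g s) • p' t - memInt (fun s => -deriv g s) p t) := by
  have hbdd : ∀ {h : ℝ → ℝ}, IntegrableOn h (Ioi 0) volume → BddCont (memInt h p) := by
    intro h hh
    obtain ⟨B, hB0, hB⟩ := hp.left.exists_nonneg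
    refine ⟨continuous_memInt hh hp.left, ∫ s in Ioi (0 : ℝ), ‖h s‖ * (2 * B), fun t => ?_⟩
    refine norm_integral_le_of_norm_le (hh.norm.mul_const _) (ae_of_all _ fun s => ?_)
    rw [norm_smul]
    exact mul_le_mul_of_nonneg_left (hist_norm_le hB0 hB t s) (norm_nonneg _)
  have hgi := hg.integrable
  have hgi' : IntegrableOn (fun s => -deriv g s) (Ioi 0) volume := hg.integrable_deriv.neg
  refine ⟨hbdd hgi, ?_, ?_⟩
  · have := (hp.right.const_smul (∫ s in Ioi (0 : ℝ), g s)).add ((hbdd hgi').const_smul (-1))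
    simpa [sub_eq_add_neg] using this
  intro t ht
  obtain ⟨L, hL0, hL⟩ := hp.lipschitz
  obtain ⟨B, hB0, hB⟩ := hp.left.exists_nonneg
  set G0 := ∫ s in Ioi (0 : ℝ), g s with hG0
  have main : Tendsto (fun δ : ℝ => δ⁻¹ • (memInt g p (t + δ) - memInt g p t)) (𝓝[>] 0)
      (𝓝 (G0 • p' t - memInt (fun s => -deriv g s) p t)) := by
    -- New layer: since ‖η‖ ≤ Lδ there, the quotient is at most L∫₀^δ g, which tends to zero even if
    -- g is unbounded at 0.
    have t1 : Tendsto (fun δ : ℝ => δ⁻¹ • ∫ s in Ioc 0 δ, g s • hist p (t + δ) s) (𝓝[>] 0)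
        (𝓝 0) := by
      have h0 := (tendsto_setIntegral_Ioc_zero hg.integrable).const_mul L
      rw [mul_zero] at h0
      refine squeeze_zero_norm' ?_ h0
      filter_upwards [eventually_add_le ht] with δ hδ
      have : ‖∫ s in Ioc 0 δ, g s • hist p (t + δ) s‖ ≤ ∫ s in Ioc 0 δ, g s * (L * δ) := by
        refine norm_integral_le_of_norm_le ((hgi.mono_set Ioc_subset_Ioi_self).mul_const _) ?_
        refine (ae_restrict_iff' measurableSet_Ioc).2 (ae_of_all _ fun s hs => ?_)
        rw [norm_smul, Real.norm_of_nonneg (hg.nonneg s hs.1)]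
        exact mul_le_mul_of_nonneg_left (hist_norm_le_of_lipschitz hL hL0 ht.1 hδ.2 hs)
          (hg.nonneg s hs.1)
      rw [norm_smul, norm_inv, Real.norm_of_nonneg hδ.1.le]
      rw [integral_mul_const] at this
      calc δ⁻¹ * ‖∫ s in Ioc 0 δ, g s • hist p (t + δ) s‖
          ≤ δ⁻¹ * ((∫ s in Ioc 0 δ, g s) * (L * δ)) :=
            mul_le_mul_of_nonneg_left this (inv_nonneg.2 hδ.1.le)
        _ = L * ∫ s in Ioc 0 δ, g s := by
            have := hδ.1.ne'
            field_simp
    -- Convexity bounds the difference quotient of g by |g'(s)|, giving an integrable majorant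
    -- independent of δ.
    have t2 : Tendsto (fun δ : ℝ => ∫ s in Ioi (0 : ℝ), (δ⁻¹ * (g (s + δ) - g s)) • hist p t s)
        (𝓝[>] 0) (𝓝 (∫ s in Ioi (0 : ℝ), deriv g s • hist p t s)) := by
      refine tendsto_integral_filter_of_dominated_convergence (fun s => ‖deriv g s‖ * (2 * B))
        ?_ ?_ (hg.integrable_deriv.norm.mul_const _) ?_
      · filter_upwards [self_mem_nhdsWithin] with δ hδ
        exact (((integrableOn_Ioi_shift hgi hδ).sub hgi).const_mul
          δ⁻¹).aestronglyMeasurable.smul (hist_aestronglyMeasurable hp.left.cont t)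
      · filter_upwards [self_mem_nhdsWithin] with δ hδ
        refine (ae_restrict_iff' measurableSet_Ioi).2 (ae_of_all _ fun s hs => ?_)
        rw [norm_smul]
        refine mul_le_mul ?_ (hist_norm_le hB0 hB t s) (norm_nonneg _) (norm_nonneg _)
        have h1 := hg.shift_bounds hs hδ
        have hδ' : (0 : ℝ) < δ := hδ
        have hsd : 0 < s + δ := add_pos hs hδ'
        have h2 : g (s + δ) - g s ≤ 0 :=
          h1.2.trans (mul_nonpos_of_nonpos_of_nonneg (hg.deriv_nonpos hsd) hδ'.le)
        rw [norm_mul, Real.norm_of_nonpos h2, Real.norm_of_nonpos (hg.deriv_nonpos hs),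
          Real.norm_of_nonneg (inv_nonneg.2 hδ'.le), inv_mul_le_iff₀ hδ']
        linarith [h1.1]
      · refine (ae_restrict_iff' measurableSet_Ioi).2 (ae_of_all _ fun s hs => ?_)
        refine Tendsto.smul_const ?_ _
        have := ((hg.diff s hs).hasDerivAt.tendsto_slope_zero).mono_left
          (nhdsWithin_mono 0 (fun x (hx : 0 < x) => hx.ne' : Ioi (0 : ℝ) ⊆ {0}ᶜ))
        exact this
    have t3 : Tendsto (fun δ : ℝ => (G0 - ∫ s in Ioc 0 δ, g s) • (δ⁻¹ • (p (t + δ) - p t)))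
        (𝓝[>] 0) (𝓝 ((G0 - 0) • p' t)) :=
      (tendsto_const_nhds.sub (tendsto_setIntegral_Ioc_zero hg.integrable)).smul
        (hp.tendsto_diffQuot ht)
    have hlim := (t1.add t2).add t3
    have e : 0 + (∫ s in Ioi (0 : ℝ), deriv g s • hist p t s) + (G0 - 0) • p' t
        = G0 • p' t - memInt (fun s => -deriv g s) p t := by
      simp only [memInt, neg_smul, integral_neg, zero_add, sub_zero, sub_neg_eq_add]
      abel
    rw [e] at hlim
    refine hlim.congr' ?_
    filter_upwards [self_mem_nhdsWithin] with δ hδ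
    have i0 := integrable_memInt hgi hp.left t
    have igs := integrableOn_Ioi_shift hgi hδ
    have i1 := integrable_memInt igs hp.left t
    have s1 := setIntegral_Ioi_shift (integrable_memInt hgi hp.left (t + δ)) hδ
    have s2 := setIntegral_Ioi_shift hgi hδ
    have e1 : memInt g p (t + δ) = (∫ s in Ioc 0 δ, g s • hist p (t + δ) s)
        + ((∫ s in Ioi (0 : ℝ), g (s + δ) • hist p t s)
          + (∫ s in Ioi (0 : ℝ), g (s + δ)) • (p (t + δ) - p t)) := by
      unfold memInt
      rw [s1]
      congr 1
      simp only [hist_add_add, smul_add]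
      rw [integral_add i1 (igs.smul_const _), integral_smul_const]
    have e2 : ∫ s in Ioi (0 : ℝ), (δ⁻¹ * (g (s + δ) - g s)) • hist p t s
        = δ⁻¹ • ((∫ s in Ioi (0 : ℝ), g (s + δ) • hist p t s) - memInt g p t) := by
      unfold memInt
      rw [← integral_sub i1 i0, ← integral_smul]
      simp only [mul_smul, sub_smul]
    have e3 : G0 - ∫ s in Ioc 0 δ, g s = ∫ s in Ioi (0 : ℝ), g (s + δ) := by
      rw [hG0, s2]; ring
    rw [e1, e2, e3, smul_comm _ δ⁻¹, ← smul_add, ← smul_add]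
    congr 1
    abel
  refine HasDerivWithinAt.Ici_of_Ioi ?_
  rw [hasDerivWithinAt_iff_tendsto_slope' (by simp)]
  have hmap : Tendsto (fun z => z - t) (𝓝[>] t) (𝓝[>] 0) := by
    apply tendsto_nhdsWithin_of_tendsto_nhds_of_eventually_within
    · have : Tendsto (fun z => z - t) (𝓝 t) (𝓝 (t - t)) := tendsto_id.sub_const t
      rw [sub_self] at this
      exact this.mono_left nhdsWithin_le_nhds
    · filter_upwards [self_mem_nhdsWithin] with z hz
      exact sub_pos.2 (mem_Ioi.1 hz)
  refine (main.comp hmap).congr fun z => ?_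
  simp [slope_def_module]

end Memory


/-! ### The abstract system and its Lyapunov functional. -/

section AbstractEnergy

set_option linter.unusedSectionVars false

variable {H : Type*} [NormedAddCommGroup H] [InnerProductSpace ℝ H]

local notation "⟪" x ", " y "⟫" => inner ℝ x y

theorem BddCont.inner {a b : ℝ → H} (ha : BddCont a) (hb : BddCont b) :
    BddCont (fun t => ⟪a t, b t⟫) := by
  obtain ⟨A, hA0, hA⟩ := ha.exists_nonneg
  obtain ⟨B, hB⟩ := hb.bdd
  exact ⟨ha.cont.inner hb.cont, A * B, fun t => (norm_inner_le_norm _ _).trans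
    (mul_le_mul (hA t) (hB t) (norm_nonneg _) hA0)⟩

theorem C1Path.inner {T : ℝ} {a a' b b' : ℝ → H} (ha : C1Path T a a') (hb : C1Path T b b') :
    C1Path T (fun t => ⟪a t, b t⟫) (fun t => ⟪a t, b' t⟫ + ⟪a' t, b t⟫) :=
  ⟨ha.left.inner hb.left, (ha.left.inner hb.right).add (ha.right.inner hb.left),
    fun t ht => (ha.deriv t ht).inner ℝ (hb.deriv t ht)⟩

theorem C1Path.eq_add_integral {T : ℝ} {a a' : ℝ → ℝ} (ha : C1Path T a a') {t : ℝ}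
    (ht : t ∈ Icc 0 T) : a t = a 0 + ∫ σ in (0 : ℝ)..t, a' σ := by
  rw [intervalIntegral.integral_eq_sub_of_hasDeriv_right ha.left.cont.continuousOn ?_
    (ha.right.cont.intervalIntegrable 0 t)]
  · ring
  · intro x hx
    rw [min_eq_left ht.1, max_eq_right ht.1] at hx
    exact (ha.deriv x ⟨hx.1.le, hx.2.trans_le ht.2⟩).Ioi_of_Ici

/-- The first order system with self-adjoint `G`, in which `p` plays the role of `G ψ`. -/
structure AbstractSolution (T τ b c : ℝ) (g : ℝ → ℝ) (G : H →L[ℝ] H) (p v w w' f : ℝ → H) :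
    Prop where
  symm : ∀ x y, ⟪G x, y⟫ = ⟪x, G y⟫
  path_p : C1Path T p (fun t => G (v t))
  path_v : C1Path T v w
  path_w : C1Path T w w'
  bdd_f : BddCont f
  eq_w : ∀ t ∈ Ico 0 T, τ • w' t = -w t - cgSq c g • G (p t) - b • G (G (v t))
    - G (memInt g p t) + f t

variable {T τ b c : ℝ} {g : ℝ → ℝ} {G : H →L[ℝ] H} {p v w w' f : ℝ → H}

theorem memInt_map [CompleteSpace H] {K : Type*} [NormedAddCommGroup K] [InnerProductSpace ℝ K]
    [CompleteSpace K] {h : ℝ → ℝ} (hh : IntegrableOn h (Ioi 0) volume)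
    (hp : BddCont p) (G : H →L[ℝ] K) (t : ℝ) :
    memInt h (fun t => G (p t)) t = G (memInt h p t) := by
  unfold memInt
  rw [← G.integral_comp_comm (integrable_memInt hh hp t)]
  refine setIntegral_congr_fun measurableSet_Ioi fun s _ => ?_
  simp only [map_smul]
  exact congrArg (h s • ·) (hist_map G.toLinearMap.toAddMonoidHom p t s)

/-- The system is linear with constant coefficients, so G maps solutions to solutions. The Lyapunov
estimate applied to the image supplies the terms with one more derivative. -/
theorem AbstractSolution.map [CompleteSpace H] (hg : MemoryKernel c g)
    (hs : AbstractSolution T τ b c g G p v w w' f) :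
    AbstractSolution T τ b c g G (fun t => G (p t)) (fun t => G (v t)) (fun t => G (w t))
      (fun t => G (w' t)) (fun t => G (f t)) where
  symm := hs.symm
  path_p := hs.path_p.clm G
  path_v := hs.path_v.clm G
  path_w := hs.path_w.clm G
  bdd_f := hs.bdd_f.clm G
  eq_w := fun t ht => by
    rw [memInt_map hg.integrable hs.path_p.left, ← map_smul, hs.eq_w t ht]
    simp

/-- The energy identity integrand. -/
theorem energy_integrand_identity (symm : ∀ x y, ⟪G x, y⟫ = ⟪x, G y⟫) (C τ b G0 : ℝ)
    (p v w m mh f : H) :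
    ⟪f - C • G p - b • G (G v) - G m, v + τ • w⟫ + C * ⟪p + τ • G v, G (v + τ • w)⟫
      + τ * (b - τ * C) * ⟪G v, G w⟫ + τ * (⟪m, G w⟫ + ⟪G0 • G v - mh, G v⟫)
    = -(b - τ * C - τ * G0) * ‖G v‖ ^ 2 - τ * ⟪mh, G v⟫ - ⟪m, G v⟫ + ⟪f, v + τ • w⟫ := by
  rw [← real_inner_self_eq_norm_sq]
  simp only [inner_add_left, inner_add_right, inner_sub_left, inner_smul_left, inner_smul_right,
    map_add, map_smul, symm, RCLike.conj_to_real]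
  ring

/-- The energy functional `½(‖z‖² + C‖y‖² + τ(b - τ C)‖G v‖²) + τ⟨m, G v⟩ + ½ M_g + τ/2 M_h`. -/
noncomputable def lyapunov (τ b c : ℝ) (g : ℝ → ℝ) (G : H →L[ℝ] H) (p v w : ℝ → H) (t : ℝ) : ℝ :=
  (1 / 2) * ⟪v t + τ • w t, v t + τ • w t⟫
    + (1 / 2) * cgSq c g * ⟪p t + τ • G (v t), p t + τ • G (v t)⟫
    + (1 / 2) * (τ * (b - τ * cgSq c g)) * ⟪G (v t), G (v t)⟫ + τ * ⟪memInt g p t, G (v t)⟫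
    + (1 / 2) * memNormSq g p t + τ / 2 * memNormSq (fun s => -deriv g s) p t

theorem inner_le_young (x y : H) {θ : ℝ} (hθ : 0 < θ) :
    |⟪x, y⟫| ≤ θ * ‖x‖ ^ 2 + 1 / (4 * θ) * ‖y‖ ^ 2 := by
  refine (abs_real_inner_le_norm x y).trans ?_
  have : θ * ‖x‖ ^ 2 + 1 / (4 * θ) * ‖y‖ ^ 2 - ‖x‖ * ‖y‖
      = θ * (‖x‖ - 1 / (2 * θ) * ‖y‖) ^ 2 := by field_simp; ring
  nlinarith [mul_nonneg hθ.le (sq_nonneg (‖x‖ - 1 / (2 * θ) * ‖y‖))]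

variable [CompleteSpace H]

/-- The differentiable part of the functional leaves -τ⟨∫(-g')η, Gv⟩ and -⟨∫gη, Gv⟩. These cancel
the production terms in the derivative bounds for ½τ∫(-g')‖η‖² and ½∫g‖η‖². The coefficient of ‖Gv‖²
is b - τc_g² - τ∫g = b - τc², positive under the assumption on b. -/
theorem AbstractSolution.lyapunov_le (hg : MemoryKernel c g) (hτ : 0 < τ)
    (hs : AbstractSolution T τ b c g G p v w w' f) {t : ℝ} (ht : t ∈ Icc 0 T) :
    lyapunov τ b c g G p v w t + ∫ σ in (0 : ℝ)..t, ((b - τ * c ^ 2) * ‖G (v σ)‖ ^ 2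
        + (1 / 2) * memNormSq (fun s => -deriv g s) p σ)
      ≤ lyapunov τ b c g G p v w 0 + ∫ σ in (0 : ℝ)..t, ⟪f σ, v σ + τ • w σ⟫ := by
  have hz := hs.path_v.add (hs.path_w.const_smul τ)
  have hGv := hs.path_v.clm G
  have hy := hs.path_p.add (hGv.const_smul τ)
  have hm := hg.c1Path_memInt hs.path_p
  have hS := ((((hz.inner hz).const_smul (1 / 2)).add
    ((hy.inner hy).const_smul ((1 / 2) * cgSq c g))).add
    ((hGv.inner hGv).const_smul ((1 / 2) * (τ * (b - τ * cgSq c g))))).add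
    ((hm.inner hGv).const_smul τ)
  have h1 := hS.eq_add_integral ht
  have h2 := hg.memNormSq_le_integral hs.path_p t ht
  have h3 := memNormSq_le_integral hg.antitoneKernel_neg_deriv hs.path_p t ht
  have cMg := continuous_memNormSq hg.integrable hs.path_p.left
  have cMh := continuous_memNormSq hg.antitoneKernel_neg_deriv.integrable hs.path_p.left
  have cmg := continuous_memInt hg.integrable hs.path_p.left
  have cmh := continuous_memInt hg.antitoneKernel_neg_deriv.integrable hs.path_p.left
  have cGv := hGv.left.cont
  have cz := hz.left.cont
  have cf := hs.bdd_f.cont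
  have h4 : ∫ σ in (0 : ℝ)..t, ((1 / 2 : ℝ) • (⟪v σ + τ • w σ, w σ + τ • w' σ⟫
          + ⟪w σ + τ • w' σ, v σ + τ • w σ⟫)
        + ((1 / 2) * cgSq c g) • (⟪p σ + τ • G (v σ), G (v σ) + τ • G (w σ)⟫
          + ⟪G (v σ) + τ • G (w σ), p σ + τ • G (v σ)⟫)
        + ((1 / 2) * (τ * (b - τ * cgSq c g))) • (⟪G (v σ), G (w σ)⟫ + ⟪G (w σ), G (v σ)⟫)
        + τ • (⟪memInt g p σ, G (w σ)⟫
          + ⟪(∫ s in Ioi (0 : ℝ), g s) • G (v σ) - memInt (fun s => -deriv g s) p σ, G (v σ)⟫))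
      = ∫ σ in (0 : ℝ)..t, (-(b - τ * c ^ 2) * ‖G (v σ)‖ ^ 2
        - τ * ⟪memInt (fun s => -deriv g s) p σ, G (v σ)⟫ - ⟪memInt g p σ, G (v σ)⟫
        + ⟪f σ, v σ + τ • w σ⟫) := by
    -- The equation for w' is available only on [0, T), so the endpoint t, which may equal T, is
    -- dropped as a null set.
    refine intervalIntegral.integral_congr_ae ?_
    have hne : ∀ᵐ σ ∂(volume : Measure ℝ), σ ≠ t := by simp [ae_iff, measure_singleton]
    filter_upwards [hne] with σ hσ hσt
    rw [uIoc_of_le ht.1] at hσt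
    have hσT : σ ∈ Ico 0 T := ⟨hσt.1.le, (lt_of_le_of_ne hσt.2 hσ).trans_le ht.2⟩
    have e := energy_integrand_identity hs.symm (cgSq c g) τ b (∫ s in Ioi (0 : ℝ), g s) (p σ)
      (v σ) (w σ) (memInt g p σ) (memInt (fun s => -deriv g s) p σ) (f σ)
    have ez : w σ + τ • w' σ = f σ - cgSq c g • G (p σ) - b • G (G (v σ)) - G (memInt g p σ) := by
      rw [hs.eq_w σ hσT]; abel
    have ey : G (v σ) + τ • G (w σ) = G (v σ + τ • w σ) := by simp
    have ec : b - τ * cgSq c g - τ * ∫ s in Ioi (0 : ℝ), g s = b - τ * c ^ 2 := by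
      unfold cgSq; ring
    rw [ec] at e
    rw [ez, ey, ← e]
    simp only [smul_eq_mul]
    rw [real_inner_comm (f σ - _ - _ - _), real_inner_comm (p σ + _), real_inner_comm (G (v σ))]
    ring
  have i1 : ∀ {u : ℝ → ℝ}, Continuous u → IntervalIntegrable u volume 0 t :=
    fun hu => hu.intervalIntegrable 0 t
  rw [h4] at h1
  have c1 : Continuous fun σ => ‖G (v σ)‖ ^ 2 := cGv.norm.pow 2
  have c2 : Continuous fun σ => ⟪memInt (fun s => -deriv g s) p σ, G (v σ)⟫ := cmh.inner cGv
  have c3 : Continuous fun σ => ⟪memInt g p σ, G (v σ)⟫ := cmg.inner cGv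
  have c4 : Continuous fun σ => ⟪f σ, v σ + τ • w σ⟫ := cf.inner cz
  have ca : Continuous fun σ => -(b - τ * c ^ 2) * ‖G (v σ)‖ ^ 2 := continuous_const.mul c1
  have cb : Continuous fun σ => τ * ⟪memInt (fun s => -deriv g s) p σ, G (v σ)⟫ :=
    continuous_const.mul c2
  have cd : Continuous fun σ => 2 * ⟪memInt g p σ, G (v σ)⟫ := continuous_const.mul c3
  have ce : Continuous fun σ => (b - τ * c ^ 2) * ‖G (v σ)‖ ^ 2 := continuous_const.mul c1
  have cg : Continuous fun σ => (1 / 2) * memNormSq (fun s => -deriv g s) p σ :=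
    continuous_const.mul cMh
  have ia := i1 ca
  have ib := i1 cb
  rw [intervalIntegral.integral_add ((ia.sub ib).sub (i1 c3)) (i1 c4),
    intervalIntegral.integral_sub (ia.sub ib) (i1 c3), intervalIntegral.integral_sub ia ib,
    intervalIntegral.integral_const_mul, intervalIntegral.integral_const_mul] at h1
  rw [intervalIntegral.integral_sub (i1 cd) (i1 cMh),
    intervalIntegral.integral_const_mul] at h2
  rw [intervalIntegral.integral_const_mul] at h3
  rw [intervalIntegral.integral_add (i1 ce) (i1 cg),
    intervalIntegral.integral_const_mul, intervalIntegral.integral_const_mul]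
  unfold lyapunov
  simp only [smul_eq_mul] at h1
  have h5 := mul_le_mul_of_nonneg_left h3 (by positivity : (0 : ℝ) ≤ τ / 2)
  linarith

/-- Exponential decay enters quantitatively through this bound: the energy measures η only with the
weight -g', which must also control the weight g. -/
theorem MemoryKernel.decay_memNormSq (hg : MemoryKernel c g) {ζ : ℝ}
    (hζ : ∀ s, 0 < s → deriv g s ≤ -ζ * g s) (hp : BddCont p) (t : ℝ) :
    ζ * memNormSq g p t ≤ memNormSq (fun s => -deriv g s) p t := by
  unfold memNormSq
  rw [← integral_const_mul]
  refine setIntegral_mono_on ((integrable_memNormSq hg.integrable hp t).const_mul ζ)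
    (integrable_memNormSq hg.antitoneKernel_neg_deriv.integrable hp t) measurableSet_Ioi
    fun s hs => ?_
  rw [← mul_assoc]
  exact mul_le_mul_of_nonneg_right (by linarith [hζ s hs]) (by positivity)

/-- The indefinite term τ⟨m, Gv⟩ is paid for by all of ½∫g‖η‖² and by part of the ‖Gv‖² term,
lowering b - τc_g² to b - τc². -/
theorem lyapunov_lower (hg : MemoryKernel c g) (hτ : 0 < τ) (hp : BddCont p) (t : ℝ) :
    (1 / 2) * ‖v t + τ • w t‖ ^ 2 + (1 / 2) * cgSq c g * ‖p t + τ • G (v t)‖ ^ 2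
      + (1 / 2) * (τ * (b - τ * c ^ 2)) * ‖G (v t)‖ ^ 2
      + τ / 2 * memNormSq (fun s => -deriv g s) p t ≤ lyapunov τ b c g G p v w t := by
  unfold lyapunov
  simp only [real_inner_self_eq_norm_sq]
  have h1 := norm_memInt_sq_le hg.antitoneKernel hp t
  set G0 := ∫ s in Ioi (0 : ℝ), g s with hG0
  have hpos : 0 < G0 := hg.integral_pos
  -- With this weight, Cauchy–Schwarz for m turns τθ‖m‖² into at most exactly the available ½∫g‖η‖².
  have h2 := inner_le_young (memInt g p t) (G (v t)) (θ := 1 / (2 * τ * G0)) (by positivity)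
  have e1 : 1 / (4 * (1 / (2 * τ * G0))) = τ * G0 / 2 := by field_simp; norm_num
  rw [e1] at h2
  have h3 : τ * (1 / (2 * τ * G0) * ‖memInt g p t‖ ^ 2) ≤ 1 / 2 * memNormSq g p t := by
    have : τ * (1 / (2 * τ * G0) * ‖memInt g p t‖ ^ 2) = ‖memInt g p t‖ ^ 2 / G0 / 2 := by
      field_simp
    rw [this]
    have : ‖memInt g p t‖ ^ 2 / G0 ≤ memNormSq g p t := by
      rw [div_le_iff₀ hpos]; linarith
    linarith
  have h4 := mul_le_mul_of_nonneg_left (neg_le_of_abs_le h2) hτ.le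
  have e2 : cgSq c g = c ^ 2 - G0 := rfl
  have e3 : (1 / 2) * (τ * (b - τ * cgSq c g)) * ‖G (v t)‖ ^ 2
      = (1 / 2) * (τ * (b - τ * c ^ 2)) * ‖G (v t)‖ ^ 2 + τ * (τ * G0 / 2 * ‖G (v t)‖ ^ 2) := by
    rw [e2]; ring
  rw [e3]
  linarith

theorem lyapunov_upper (hg : MemoryKernel c g) (hτ : 0 < τ) (hp : BddCont p) {ζ : ℝ}
    (hζ0 : 0 < ζ) (hζ : ∀ s, 0 < s → deriv g s ≤ -ζ * g s) (t : ℝ) :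
    lyapunov τ b c g G p v w t ≤ (1 / 2) * ‖v t + τ • w t‖ ^ 2
      + (1 / 2) * cgSq c g * ‖p t + τ • G (v t)‖ ^ 2
      + ((1 / 2) * (τ * (b - τ * cgSq c g)) + τ) * ‖G (v t)‖ ^ 2
      + ((1 / 2 + τ * ∫ s in Ioi (0 : ℝ), g s) / ζ + τ / 2)
        * memNormSq (fun s => -deriv g s) p t := by
  unfold lyapunov
  simp only [real_inner_self_eq_norm_sq]
  have h1 := norm_memInt_sq_le hg.antitoneKernel hp t
  set G0 := ∫ s in Ioi (0 : ℝ), g s with hG0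
  have hpos : 0 < G0 := hg.integral_pos
  have h2 := le_of_abs_le (inner_le_young (memInt g p t) (G (v t)) one_pos)
  have h5 : memNormSq g p t ≤ memNormSq (fun s => -deriv g s) p t / ζ := by
    rw [le_div_iff₀ hζ0]; linarith [hg.decay_memNormSq hζ hp t]
  have h6 := mul_le_mul_of_nonneg_left h5 (by positivity : 0 ≤ 1 / 2 + τ * G0)
  have h7 := mul_le_mul_of_nonneg_left h2 hτ.le
  have h8 := mul_le_mul_of_nonneg_left h1 hτ.le
  have h9 : 0 ≤ τ * ‖G (v t)‖ ^ 2 := by positivity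
  have e : ((1 / 2 + τ * G0) / ζ + τ / 2) * memNormSq (fun s => -deriv g s) p t
      = (1 / 2 + τ * G0) * (memNormSq (fun s => -deriv g s) p t / ζ)
        + τ / 2 * memNormSq (fun s => -deriv g s) p t := by ring
  rw [e]
  linarith

end AbstractEnergy


/-! ### The cross functional and the full abstract estimate. -/

section AbstractEstimate

set_option linter.unusedSectionVars false

variable {H : Type*} [NormedAddCommGroup H] [InnerProductSpace ℝ H]

local notation "⟪" x ", " y "⟫" => inner ℝ x y

/-- In the application Y = Gy, Z = Gz, V1 = Gv, V2 = G²v, M = Gm, W = w, γ = b - τC, and f - CY -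
γV2 - M is z'. The term ⟨y, Gz⟩ yields -C‖Y‖² but also +‖Z‖², which the weight -2τ on ⟨Gv, Gz⟩ turns
into -‖Z‖² since τGw = Z - V1. Young's inequality spends half of each good term: ⟨W, CY⟩ with weight
1/(6C) costs C/4 of ‖Y‖², and the other two Y-terms cost C/8 each. -/
theorem cross_functional_bound {C τ γ : ℝ} (hC : 0 < C) (Y Z V1 V2 M W f : H) :
    ⟪Y, f - C • Y - γ • V2 - M⟫ + ⟪Z, Z⟫ - 2 * τ * ⟪V2, f - C • Y - γ • V2 - M⟫
      - 2 * ⟪Z - V1, Z⟫ + 1 / (6 * C) * ⟪W, f - C • Y - γ • V2 - M - W⟫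
    ≤ -(1 / 2) * ‖Z‖ ^ 2 - C / 2 * ‖Y‖ ^ 2 - 1 / (12 * C) * ‖W‖ ^ 2 + 2 * ‖V1‖ ^ 2
      + (2 * (2 * τ * C - γ) ^ 2 / C + 2 * τ * γ + 1 + γ ^ 2 / (4 * C)) * ‖V2‖ ^ 2
      + (2 / C + τ ^ 2 + 1 / (4 * C)) * ‖M‖ ^ 2
      + (⟪Y, f⟫ - 2 * τ * ⟪V2, f⟫ + 1 / (6 * C) * ⟪W, f⟫) := by
  have e : ⟪Y, f - C • Y - γ • V2 - M⟫ + ⟪Z, Z⟫ - 2 * τ * ⟪V2, f - C • Y - γ • V2 - M⟫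
      - 2 * ⟪Z - V1, Z⟫ + 1 / (6 * C) * ⟪W, f - C • Y - γ • V2 - M - W⟫
      = -‖Z‖ ^ 2 - C * ‖Y‖ ^ 2 - 1 / (6 * C) * ‖W‖ ^ 2 + 2 * τ * γ * ‖V2‖ ^ 2
        + ⟪Y, (2 * τ * C - γ) • V2⟫ - ⟪Y, M⟫ + 2 * ⟪Z, V1⟫ + 2 * ⟪V2, τ • M⟫
        - 1 / (6 * C) * (⟪W, C • Y⟫ + ⟪W, γ • V2⟫ + ⟪W, M⟫)
        + (⟪Y, f⟫ - 2 * τ * ⟪V2, f⟫ + 1 / (6 * C) * ⟪W, f⟫) := by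
    simp only [inner_sub_left, inner_sub_right, inner_smul_right, real_inner_self_eq_norm_sq]
    rw [real_inner_comm V1 Z, real_inner_comm V2 Y]
    ring
  rw [e]
  have y1 := le_of_abs_le (inner_le_young Y ((2 * τ * C - γ) • V2) (θ := C / 8) (by positivity))
  have y2 := neg_le_of_abs_le (inner_le_young Y M (θ := C / 8) (by positivity))
  have y3 := le_of_abs_le (inner_le_young Z V1 (θ := 1 / 4) (by positivity))
  have y4 := le_of_abs_le (inner_le_young V2 (τ • M) (θ := 1 / 2) (by positivity))
  have y5 := neg_le_of_abs_le (inner_le_young W (C • Y) (θ := 1 / 6) (by positivity))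
  have y6 := neg_le_of_abs_le (inner_le_young W (γ • V2) (θ := 1 / 6) (by positivity))
  have y7 := neg_le_of_abs_le (inner_le_young W M (θ := 1 / 6) (by positivity))
  rw [norm_smul, mul_pow, Real.norm_eq_abs, sq_abs] at y1 y4 y5 y6
  have hε : 0 < 1 / (6 * C) := by positivity
  have y567 := mul_le_mul_of_nonneg_left (add_le_add (add_le_add y5 y6) y7) hε.le
  have e1 : 1 / (4 * (C / 8)) * ((2 * τ * C - γ) ^ 2 * ‖V2‖ ^ 2)
      = 2 * (2 * τ * C - γ) ^ 2 / C * ‖V2‖ ^ 2 := by field_simp; norm_num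
  have e2 : 1 / (4 * (C / 8)) * ‖M‖ ^ 2 = 2 / C * ‖M‖ ^ 2 := by field_simp; ring
  rw [e1] at y1
  rw [e2] at y2
  have e3 : 1 / (6 * C) * (-(1 / 6 * ‖W‖ ^ 2 + 1 / (4 * (1 / 6)) * (C ^ 2 * ‖Y‖ ^ 2))
      + -(1 / 6 * ‖W‖ ^ 2 + 1 / (4 * (1 / 6)) * (γ ^ 2 * ‖V2‖ ^ 2))
      + -(1 / 6 * ‖W‖ ^ 2 + 1 / (4 * (1 / 6)) * ‖M‖ ^ 2))
      = -(1 / (12 * C) * ‖W‖ ^ 2) - C / 4 * ‖Y‖ ^ 2 - γ ^ 2 / (4 * C) * ‖V2‖ ^ 2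
        - 1 / (4 * C) * ‖M‖ ^ 2 := by field_simp; ring
  rw [e3] at y567
  have e4 : 1 / (6 * C) * ‖W‖ ^ 2 = 2 * (1 / (12 * C) * ‖W‖ ^ 2) := by field_simp; ring
  rw [e4]
  norm_num at y3 y4
  linarith

theorem integral_add_le_of_le {J A B : ℝ → ℝ} {t : ℝ} (ht : 0 ≤ t) (hJ : Continuous J)
    (hA : Continuous A) (hB : Continuous B) (h : ∀ σ ∈ Ioo 0 t, J σ ≤ B σ - A σ) :
    (∫ σ in (0 : ℝ)..t, J σ) + ∫ σ in (0 : ℝ)..t, A σ ≤ ∫ σ in (0 : ℝ)..t, B σ := by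
  have h2 := intervalIntegral.integral_mono_on_of_le_Ioo (μ := volume) ht (hJ.intervalIntegrable 0 t)
    ((hB.sub hA).intervalIntegrable 0 t) h
  simp only [Pi.sub_apply] at h2
  rw [intervalIntegral.integral_sub (hB.intervalIntegrable 0 t) (hA.intervalIntegrable 0 t)] at h2
  linarith

variable {T τ b c : ℝ} {g : ℝ → ℝ} {G : H →L[ℝ] H} {p v w w' f : ℝ → H}

/-- `⟨y, G z⟩ - 2 τ ⟨G v, G z⟩ + (τ / (12 C)) ‖w‖²` with `y = p + τ G v`, `z = v + τ w`. -/
noncomputable def crossFunctional (τ c : ℝ) (g : ℝ → ℝ) (G : H →L[ℝ] H) (p v w : ℝ → H) (t : ℝ) :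
    ℝ :=
  ⟪p t + τ • G (v t), G (v t + τ • w t)⟫ + (-2 * τ) * ⟪G (v t), G (v t + τ • w t)⟫
    + 1 / (12 * cgSq c g) * τ * ⟪w t, w t⟫

variable [CompleteSpace H]

/-- This gains the dissipation of Gz, Gy and w that the Lyapunov functional lacks. The price
consists of Gv, G²v and the memory norm of Gp, all dissipated by the two Lyapunov estimates. -/
theorem AbstractSolution.crossFunctional_le (hg : MemoryKernel c g)
    (hs : AbstractSolution T τ b c g G p v w w' f) {t : ℝ} (ht : t ∈ Icc 0 T) {K2 K3 : ℝ}
    (hK2 : 2 * (2 * τ * cgSq c g - (b - τ * cgSq c g)) ^ 2 / cgSq c g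
      + 2 * τ * (b - τ * cgSq c g) + 1 + (b - τ * cgSq c g) ^ 2 / (4 * cgSq c g) ≤ K2)
    (hK3 : ∀ t, (2 / cgSq c g + τ ^ 2 + 1 / (4 * cgSq c g)) * ‖G (memInt g p t)‖ ^ 2
      ≤ K3 * memNormSq (fun s => -deriv g s) (fun t => G (p t)) t) :
    crossFunctional τ c g G p v w t
      + ∫ σ in (0 : ℝ)..t, ((1 / 2) * ‖G (v σ + τ • w σ)‖ ^ 2
          + cgSq c g / 2 * ‖G (p σ + τ • G (v σ))‖ ^ 2
          + 1 / (12 * cgSq c g) * ‖w σ‖ ^ 2)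
      ≤ crossFunctional τ c g G p v w 0
        + ∫ σ in (0 : ℝ)..t, (2 * ‖G (v σ)‖ ^ 2 + K2 * ‖G (G (v σ))‖ ^ 2
          + K3 * memNormSq (fun s => -deriv g s) (fun t => G (p t)) σ
          + (⟪G (f σ), p σ + τ • G (v σ)⟫ - 2 * ⟪G (f σ), τ • G (v σ)⟫
            + 1 / (6 * cgSq c g) * ⟪f σ, w σ⟫)) := by
  have hC : 0 < cgSq c g := by unfold cgSq; linarith [hg.integral_lt]
  have hz := hs.path_v.add (hs.path_w.const_smul τ)
  have hGz := hz.clm G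
  have hGv := hs.path_v.clm G
  have hy := hs.path_p.add (hGv.const_smul τ)
  have hJ := ((hy.inner hGz).add ((hGv.inner hGz).const_smul (-2 * τ))).add
    ((hs.path_w.inner hs.path_w).const_smul (1 / (12 * cgSq c g) * τ))
  have h1 := hJ.eq_add_integral ht
  have cMh := continuous_memNormSq hg.antitoneKernel_neg_deriv.integrable (hs.path_p.clm G).left
  have cGv := hGv.left.cont
  have cGGv := (hGv.clm G).left.cont
  have cGz := hGz.left.cont
  have cy := hy.left.cont
  have cGy := (hy.clm G).left.cont
  have cf := hs.bdd_f.cont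
  have cGf := (hs.bdd_f.clm G).cont
  have cw := hs.path_w.left.cont
  have cA : Continuous fun σ => ((1 / 2) * ‖G (v σ + τ • w σ)‖ ^ 2
          + cgSq c g / 2 * ‖G (p σ + τ • G (v σ))‖ ^ 2 + 1 / (12 * cgSq c g) * ‖w σ‖ ^ 2) :=
    ((continuous_const.mul (cGz.norm.pow 2)).add (continuous_const.mul (cGy.norm.pow 2))).add
      (continuous_const.mul (cw.norm.pow 2))
  have cB : Continuous fun σ => (2 * ‖G (v σ)‖ ^ 2 + K2 * ‖G (G (v σ))‖ ^ 2
          + K3 * memNormSq (fun s => -deriv g s) (fun t => G (p t)) σ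
          + (⟪G (f σ), p σ + τ • G (v σ)⟫ - 2 * ⟪G (f σ), τ • G (v σ)⟫
            + 1 / (6 * cgSq c g) * ⟪f σ, w σ⟫)) :=
    (((continuous_const.mul (cGv.norm.pow 2)).add (continuous_const.mul (cGGv.norm.pow 2))).add
      (continuous_const.mul cMh)).add (((cGf.inner cy).sub (continuous_const.mul
        (cGf.inner (cGv.const_smul τ)))).add (continuous_const.mul (cf.inner cw)))
  have h2 := integral_add_le_of_le ht.1 hJ.right.cont cA cB ?_
  · simp only [smul_eq_mul] at h1 h2
    unfold crossFunctional
    linarith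
  · intro σ hσ
    have hσT : σ ∈ Ico 0 T := ⟨hσ.1.le, hσ.2.trans_le ht.2⟩
    have e0 : G (p σ) = G (p σ + τ • G (v σ)) - τ • G (G (v σ)) := by simp
    have ez' : w σ + τ • w' σ = f σ - cgSq c g • G (p σ + τ • G (v σ))
        - (b - τ * cgSq c g) • G (G (v σ)) - G (memInt g p σ) := by
      rw [hs.eq_w σ hσT]
      simp only [map_add, map_smul]
      module
    have ew' : τ • w' σ = f σ - cgSq c g • G (p σ + τ • G (v σ))
        - (b - τ * cgSq c g) • G (G (v σ)) - G (memInt g p σ) - w σ := by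
      rw [← ez']; abel
    have key := cross_functional_bound (τ := τ) (γ := b - τ * cgSq c g) hC
      (G (p σ + τ • G (v σ))) (G (v σ + τ • w σ)) (G (v σ)) (G (G (v σ))) (G (memInt g p σ)) (w σ)
      (f σ)
    rw [← ew', ← ez'] at key
    have k1 : τ • G (w σ) = G (v σ + τ • w σ) - G (v σ) := by simp
    have k2 : G (v σ) + τ • G (w σ) = G (v σ + τ • w σ) := by simp
    have hV := mul_le_mul_of_nonneg_right hK2 (by positivity : 0 ≤ ‖G (G (v σ))‖ ^ 2)
    have hM := hK3 σ
    have s1 : ⟪p σ + τ • G (v σ), G (w σ + τ • w' σ)⟫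
        = ⟪G (p σ + τ • G (v σ)), w σ + τ • w' σ⟫ := (hs.symm _ _).symm
    have s2 : ⟪G (v σ), G (w σ + τ • w' σ)⟫ = ⟪G (G (v σ)), w σ + τ • w' σ⟫ := (hs.symm _ _).symm
    have s3 : ⟪G (f σ), p σ + τ • G (v σ)⟫ = ⟪G (p σ + τ • G (v σ)), f σ⟫ := by
      rw [hs.symm, real_inner_comm]
    have s4 : ⟪G (f σ), τ • G (v σ)⟫ = τ * ⟪G (G (v σ)), f σ⟫ := by
      rw [hs.symm, real_inner_comm, map_smul, inner_smul_left]; rfl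
    have s5 : ⟪f σ, w σ⟫ = ⟪w σ, f σ⟫ := real_inner_comm _ _
    have s6 : ⟪w σ, τ • w' σ⟫ = τ * ⟪w σ, w' σ⟫ := inner_smul_right _ _ _
    have s7 : ⟪w' σ, w σ⟫ = ⟪w σ, w' σ⟫ := real_inner_comm _ _
    have s8 : ⟪G (v σ + τ • w σ) - G (v σ), G (v σ + τ • w σ)⟫
        = τ * ⟪G (w σ), G (v σ + τ • w σ)⟫ := by rw [← k1, inner_smul_left]; rfl
    rw [s6, s8] at key
    simp only [smul_eq_mul]
    rw [k2, s1, s2, s3, s4, s5, s7]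
    have e12 : 1 / (12 * cgSq c g) * τ * (⟪w σ, w' σ⟫ + ⟪w σ, w' σ⟫)
        = 1 / (6 * cgSq c g) * (τ * ⟪w σ, w' σ⟫) := by field_simp; ring
    rw [e12]
    linarith

/-- The energy of the abstract system. -/
noncomputable def absEnergy (τ : ℝ) (g : ℝ → ℝ) (G : H →L[ℝ] H) (p v w : ℝ → H) (t : ℝ) : ℝ :=
  ‖p t + τ • G (v t)‖ ^ 2 + ‖v t + τ • w t‖ ^ 2 + ‖G (v t)‖ ^ 2
    + memNormSq (fun s => -deriv g s) p t + ‖w t‖ ^ 2 + ‖G (p t + τ • G (v t))‖ ^ 2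
    + ‖G (v t + τ • w t)‖ ^ 2 + ‖G (G (v t))‖ ^ 2
    + memNormSq (fun s => -deriv g s) (fun t => G (p t)) t

/-- The dissipation of the abstract system. -/
noncomputable def absDissipation (τ : ℝ) (g : ℝ → ℝ) (G : H →L[ℝ] H) (p v w : ℝ → H) (t : ℝ) :
    ℝ :=
  ‖G (v t)‖ ^ 2 + memNormSq (fun s => -deriv g s) p t + ‖G (p t + τ • G (v t))‖ ^ 2
    + ‖G (v t + τ • w t)‖ ^ 2 + ‖G (G (v t))‖ ^ 2
    + memNormSq (fun s => -deriv g s) (fun t => G (p t)) t + ‖w t‖ ^ 2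

/-- The sum of the absolute values of the pairings with the source. -/
noncomputable def absPairings (τ : ℝ) (G : H →L[ℝ] H) (p v w f : ℝ → H) (t : ℝ) : ℝ :=
  |⟪f t, v t + τ • w t⟫| + |⟪G (f t), G (v t + τ • w t)⟫| + |⟪f t, w t⟫|
    + |⟪G (f t), p t + τ • G (v t)⟫| + |⟪G (f t), τ • G (v t)⟫|


theorem continuous_absDissipation (hg : MemoryKernel c g)
    (hs : AbstractSolution T τ b c g G p v w w' f) : Continuous (absDissipation τ g G p v w) := by
  have hz := (hs.path_v.add (hs.path_w.const_smul τ)).clm G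
  have hGv := hs.path_v.clm G
  have hy := (hs.path_p.add (hGv.const_smul τ)).clm G
  have hh := hg.antitoneKernel_neg_deriv.integrable
  have c1 := hz.left.cont
  have c2 := hGv.left.cont
  have c3 := hy.left.cont
  have c4 := (hGv.clm G).left.cont
  have c5 := hs.path_w.left.cont
  exact ((((((c2.norm.pow 2).add (continuous_memNormSq hh hs.path_p.left)).add
    (c3.norm.pow 2)).add (c1.norm.pow 2)).add (c4.norm.pow 2)).add
    (continuous_memNormSq hh (hs.path_p.clm G).left)).add (c5.norm.pow 2)

theorem continuous_absPairings
    (hs : AbstractSolution T τ b c g G p v w w' f) : Continuous (absPairings τ G p v w f) := by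
  have hz := hs.path_v.add (hs.path_w.const_smul τ)
  have hGv := hs.path_v.clm G
  have hy := hs.path_p.add (hGv.const_smul τ)
  have c1 := hz.left.cont
  have c1' := (hz.clm G).left.cont
  have c2 := (hGv.const_smul τ).left.cont
  have c3 := hy.left.cont
  have c5 := hs.path_w.left.cont
  have cf := hs.bdd_f.cont
  have cGf := (hs.bdd_f.clm G).cont
  exact (((((cf.inner c1).abs.add (cGf.inner c1').abs).add (cf.inner c5).abs).add
    (cGf.inner c3).abs).add (cGf.inner c2).abs)

theorem integral_linear3 {A B D : ℝ → ℝ} (N t : ℝ) (hA : Continuous A) (hB : Continuous B)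
    (hD : Continuous D) :
    ∫ σ in (0 : ℝ)..t, (N * A σ + N * B σ + D σ)
      = N * (∫ σ in (0 : ℝ)..t, A σ) + N * (∫ σ in (0 : ℝ)..t, B σ) + ∫ σ in (0 : ℝ)..t, D σ := by
  have hA' : Continuous fun σ => N * A σ := continuous_const.mul hA
  have hB' : Continuous fun σ => N * B σ := continuous_const.mul hB
  rw [intervalIntegral.integral_add ((hA'.intervalIntegrable 0 t).add (hB'.intervalIntegrable 0 t))
    (hD.intervalIntegrable 0 t), intervalIntegral.integral_add (hA'.intervalIntegrable 0 t)
    (hB'.intervalIntegrable 0 t), intervalIntegral.integral_const_mul,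
    intervalIntegral.integral_const_mul]

/-- The lower bound of the full Lyapunov functional in terms of the energy. -/
theorem full_lower (hg : MemoryKernel c g) (hτ : 0 < τ)
    (hs : AbstractSolution T τ b c g G p v w w' f) {N : ℝ} (hN0 : 0 ≤ N)
    (hN1 : 3 ≤ N * cgSq c g) (hN2 : 3 + 2 * τ ≤ N) (hN3 : 2 * (τ + 1) ≤ N * (τ * (b - τ * c ^ 2)))
    (hN4 : 2 ≤ N * τ) {δ : ℝ} (hδ1 : δ ≤ 1) (hδ2 : δ ≤ 1 / (12 * cgSq c g) * τ) (t : ℝ) :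
    δ * absEnergy τ g G p v w t ≤ N * lyapunov τ b c g G p v w t
      + N * lyapunov τ b c g G (fun t => G (p t)) (fun t => G (v t)) (fun t => G (w t)) t
      + crossFunctional τ c g G p v w t := by
  have h1 := mul_le_mul_of_nonneg_left (lyapunov_lower (b := b) (v := v) (w := w) (G := G) hg hτ
    hs.path_p.left t) hN0
  have h2 := mul_le_mul_of_nonneg_left (lyapunov_lower (b := b) (v := fun t => G (v t))
    (w := fun t => G (w t)) (G := G) hg hτ (hs.path_p.clm G).left t) hN0
  have ez : G (v t) + τ • G (w t) = G (v t + τ • w t) := by simp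
  have ey : G (p t) + τ • G (G (v t)) = G (p t + τ • G (v t)) := by simp
  simp only [ez, ey] at h2
  -- The two cross products cost ½‖y‖² + τ‖Gv‖² + (½ + τ)‖Gz‖². The lower bounds on N cover this and
  -- leave at least the coefficient 1; only ‖w‖² has a fixed coefficient, hence the second condition
  -- on δ.
  have k1 := neg_le_of_abs_le (inner_le_young (p t + τ • G (v t)) (G (v t + τ • w t))
    (θ := 1 / 2) (by norm_num))
  have k2 := le_of_abs_le (inner_le_young (G (v t)) (G (v t + τ • w t))
    (θ := 1 / 2) (by norm_num))
  have k2' := mul_le_mul_of_nonneg_left k2 (by positivity : 0 ≤ 2 * τ)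
  unfold crossFunctional absEnergy
  rw [real_inner_self_eq_norm_sq (w t)]
  have m0 := memNormSq_nonneg hg.antitoneKernel_neg_deriv p t
  have m1 := memNormSq_nonneg hg.antitoneKernel_neg_deriv (fun t => G (p t)) t
  have q1 := sq_nonneg ‖p t + τ • G (v t)‖
  have q2 := sq_nonneg ‖v t + τ • w t‖
  have q3 := sq_nonneg ‖G (v t)‖
  have q4 := sq_nonneg ‖w t‖
  have q5 := sq_nonneg ‖G (p t + τ • G (v t))‖
  have q6 := sq_nonneg ‖G (v t + τ • w t)‖
  have q7 := sq_nonneg ‖G (G (v t))‖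
  generalize ‖p t + τ • G (v t)‖ ^ 2 = a1 at *
  generalize ‖v t + τ • w t‖ ^ 2 = a2 at *
  generalize ‖G (v t)‖ ^ 2 = a3 at *
  generalize ‖w t‖ ^ 2 = a4 at *
  generalize ‖G (p t + τ • G (v t))‖ ^ 2 = a5 at *
  generalize ‖G (v t + τ • w t)‖ ^ 2 = a6 at *
  generalize ‖G (G (v t))‖ ^ 2 = a7 at *
  generalize memNormSq (fun s => -deriv g s) p t = M0 at *
  generalize memNormSq (fun s => -deriv g s) (fun t => G (p t)) t = M1 at *
  have r1 := mul_le_mul_of_nonneg_right hN1 q1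
  have r2 := mul_le_mul_of_nonneg_right hN2 q2
  have r3 := mul_le_mul_of_nonneg_right hN3 q3
  have r5 := mul_le_mul_of_nonneg_right hN1 q5
  have r6 := mul_le_mul_of_nonneg_right hN2 q6
  have r7 := mul_le_mul_of_nonneg_right hN3 q7
  have r8 := mul_le_mul_of_nonneg_right hN4 m0
  have r9 := mul_le_mul_of_nonneg_right hN4 m1
  have d1 := mul_le_mul_of_nonneg_right hδ1 q1
  have d2 := mul_le_mul_of_nonneg_right hδ1 q2
  have d3 := mul_le_mul_of_nonneg_right hδ1 q3
  have d4 := mul_le_mul_of_nonneg_right hδ2 q4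
  have d5 := mul_le_mul_of_nonneg_right hδ1 q5
  have d6 := mul_le_mul_of_nonneg_right hδ1 q6
  have d7 := mul_le_mul_of_nonneg_right hδ1 q7
  have d8 := mul_le_mul_of_nonneg_right hδ1 m0
  have d9 := mul_le_mul_of_nonneg_right hδ1 m1
  have t1 := mul_nonneg hτ.le q2
  have t3 := mul_nonneg hτ.le q3
  have t7 := mul_nonneg hτ.le q7
  have e12 : (1 : ℝ) / (4 * (1 / 2)) = 1 / 2 := by norm_num
  rw [e12] at k1 k2'
  linarith

/-- The upper bound of the full Lyapunov functional in terms of the energy. -/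
theorem full_upper (hg : MemoryKernel c g) (hτ : 0 < τ) (hb : τ * c ^ 2 < b) :
    ∀ N : ℝ, 0 ≤ N → ∃ K : ℝ, 0 ≤ K ∧
      ∀ {H : Type} [NormedAddCommGroup H] [InnerProductSpace ℝ H] [CompleteSpace H]
      (T : ℝ) (G : H →L[ℝ] H) (p v w w' f : ℝ → H), AbstractSolution T τ b c g G p v w w' f →
      ∀ t, N * lyapunov τ b c g G p v w t
      + N * lyapunov τ b c g G (fun t => G (p t)) (fun t => G (v t)) (fun t => G (w t)) t
      + crossFunctional τ c g G p v w t ≤ K * absEnergy τ g G p v w t := by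
  intro N hN0
  obtain ⟨ζ, hζ0, hζ⟩ := hg.decay
  have hC : 0 < cgSq c g := by unfold cgSq; linarith [hg.integral_lt]
  have hG0 := hg.integral_pos
  have hγ : 0 < b - τ * cgSq c g := by
    have : cgSq c g = c ^ 2 - ∫ s in Ioi (0 : ℝ), g s := rfl
    have h1 := mul_pos hτ hG0
    rw [this]; linarith
  have hP1 : 0 ≤ N * ((1 / 2) * cgSq c g) := by positivity
  have hP2 : 0 ≤ N * ((1 / 2) * (τ * (b - τ * cgSq c g)) + τ) := by positivity
  have hP3 : 0 ≤ N * ((1 / 2 + τ * ∫ s in Ioi (0 : ℝ), g s) / ζ + τ / 2) := by positivity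
  have hP4 : 0 ≤ 1 / (12 * cgSq c g) * τ := by positivity
  set P1 := N * ((1 / 2) * cgSq c g) with hP1e
  set P2 := N * ((1 / 2) * (τ * (b - τ * cgSq c g)) + τ) with hP2e
  set P3 := N * ((1 / 2 + τ * ∫ s in Ioi (0 : ℝ), g s) / ζ + τ / 2) with hP3e
  set P4 := 1 / (12 * cgSq c g) * τ with hP4e
  -- The sum of all coefficients is a crude bound for each of them. It is chosen before the Hilbert
  -- space and the operator, so it is uniform in both.
  refine ⟨N + P1 + P2 + P3 + P4 + 1 + 2 * τ, by positivity, ?_⟩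
  intro H _ _ _ T G p v w w' f hs t
  have h1 := mul_le_mul_of_nonneg_left (lyapunov_upper (b := b) (v := v) (w := w) (G := G) hg hτ
    hs.path_p.left hζ0 hζ t) hN0
  have h2 := mul_le_mul_of_nonneg_left (lyapunov_upper (b := b) (v := fun t => G (v t))
    (w := fun t => G (w t)) (G := G) hg hτ (hs.path_p.clm G).left hζ0 hζ t) hN0
  have ez : G (v t) + τ • G (w t) = G (v t + τ • w t) := by simp
  have ey : G (p t) + τ • G (G (v t)) = G (p t + τ • G (v t)) := by simp
  simp only [ez, ey] at h2
  have k1 := le_of_abs_le (inner_le_young (p t + τ • G (v t)) (G (v t + τ • w t))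
    (θ := 1 / 2) (by norm_num))
  have k2 := neg_le_of_abs_le (inner_le_young (G (v t)) (G (v t + τ • w t))
    (θ := 1 / 2) (by norm_num))
  have k2' := mul_le_mul_of_nonneg_left k2 (by positivity : 0 ≤ 2 * τ)
  unfold crossFunctional absEnergy
  rw [real_inner_self_eq_norm_sq (w t)]
  have m0 := memNormSq_nonneg hg.antitoneKernel_neg_deriv p t
  have m1 := memNormSq_nonneg hg.antitoneKernel_neg_deriv (fun t => G (p t)) t
  have q1 := sq_nonneg ‖p t + τ • G (v t)‖
  have q2 := sq_nonneg ‖v t + τ • w t‖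
  have q3 := sq_nonneg ‖G (v t)‖
  have q4 := sq_nonneg ‖w t‖
  have q5 := sq_nonneg ‖G (p t + τ • G (v t))‖
  have q6 := sq_nonneg ‖G (v t + τ • w t)‖
  have q7 := sq_nonneg ‖G (G (v t))‖
  generalize ‖p t + τ • G (v t)‖ ^ 2 = a1 at *
  generalize ‖v t + τ • w t‖ ^ 2 = a2 at *
  generalize ‖G (v t)‖ ^ 2 = a3 at *
  generalize ‖w t‖ ^ 2 = a4 at *
  generalize ‖G (p t + τ • G (v t))‖ ^ 2 = a5 at *
  generalize ‖G (v t + τ • w t)‖ ^ 2 = a6 at *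
  generalize ‖G (G (v t))‖ ^ 2 = a7 at *
  generalize memNormSq (fun s => -deriv g s) p t = M0 at *
  generalize memNormSq (fun s => -deriv g s) (fun t => G (p t)) t = M1 at *
  have hτ0 := hτ.le
  have u1 : N * (1 / 2 * a2 + 1 / 2 * cgSq c g * a1
      + ((1 / 2) * (τ * (b - τ * cgSq c g)) + τ) * a3
      + ((1 / 2 + τ * ∫ s in Ioi (0 : ℝ), g s) / ζ + τ / 2) * M0)
      = N / 2 * a2 + P1 * a1 + P2 * a3 + P3 * M0 := by
    rw [hP1e, hP2e, hP3e]; ring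
  have u2 : N * (1 / 2 * a6 + 1 / 2 * cgSq c g * a5
      + ((1 / 2) * (τ * (b - τ * cgSq c g)) + τ) * a7
      + ((1 / 2 + τ * ∫ s in Ioi (0 : ℝ), g s) / ζ + τ / 2) * M1)
      = N / 2 * a6 + P1 * a5 + P2 * a7 + P3 * M1 := by
    rw [hP1e, hP2e, hP3e]; ring
  rw [u1] at h1
  rw [u2] at h2
  have e12 : (1 : ℝ) / (4 * (1 / 2)) = 1 / 2 := by norm_num
  rw [e12] at k1 k2'
  have expand : ∀ x, 0 ≤ x → 0 ≤ N * x ∧ 0 ≤ P1 * x ∧ 0 ≤ P2 * x ∧ 0 ≤ P3 * x ∧ 0 ≤ P4 * x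
      ∧ 0 ≤ τ * x := fun x hx => ⟨by positivity, by positivity, by positivity, by positivity,
        by positivity, by positivity⟩
  obtain ⟨x1, x2, x3, x4, x5, x6⟩ := expand a1 q1
  obtain ⟨y1, y2, y3, y4, y5, y6⟩ := expand a2 q2
  obtain ⟨z1, z2, z3, z4, z5, z6⟩ := expand a3 q3
  obtain ⟨s1, s2, s3, s4, s5, s6⟩ := expand a4 q4
  obtain ⟨b1, b2, b3, b4, b5, b6⟩ := expand a5 q5
  obtain ⟨c1, c2, c3, c4, c5, c6⟩ := expand a6 q6
  obtain ⟨d1, d2, d3, d4, d5, d6⟩ := expand a7 q7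
  obtain ⟨e1, e2, e3, e4, e5, e6⟩ := expand M0 m0
  obtain ⟨f1, f2, f3, f4, f5, f6⟩ := expand M1 m1
  linarith

/-- The functional is N times both Lyapunov functionals plus the cross functional. The order of
quantifiers matters: the constant knows nothing of the operator G, so it is unaffected by the
frequency cut-off. -/
theorem abstract_estimate (hg : MemoryKernel c g) (hτ : 0 < τ) (hb : τ * c ^ 2 < b) :
    ∃ C : ℝ, 0 < C ∧
      ∀ {H : Type} [NormedAddCommGroup H] [InnerProductSpace ℝ H] [CompleteSpace H]
      (T : ℝ) (G : H →L[ℝ] H) (p v w w' f : ℝ → H), AbstractSolution T τ b c g G p v w w' f →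
      ∀ t ∈ Icc 0 T, absEnergy τ g G p v w t + ∫ σ in (0 : ℝ)..t, absDissipation τ g G p v w σ
        ≤ C * (absEnergy τ g G p v w 0 + ∫ σ in (0 : ℝ)..t, absPairings τ G p v w f σ) := by
  obtain ⟨ζ, hζ0, hζ⟩ := hg.decay
  have hC : 0 < cgSq c g := by unfold cgSq; linarith [hg.integral_lt]
  have hG0 := hg.integral_pos
  have hβ : 0 < b - τ * c ^ 2 := by linarith
  have hγ : 0 < b - τ * cgSq c g := by
    have : cgSq c g = c ^ 2 - ∫ s in Ioi (0 : ℝ), g s := rfl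
    have h1 := mul_pos hτ hG0
    rw [this]; linarith
  obtain ⟨K2, hK2⟩ : ∃ K2, K2 = 2 * (2 * τ * cgSq c g - (b - τ * cgSq c g)) ^ 2 / cgSq c g
      + 2 * τ * (b - τ * cgSq c g) + 1 + (b - τ * cgSq c g) ^ 2 / (4 * cgSq c g) := ⟨_, rfl⟩
  obtain ⟨K3, hK3⟩ : ∃ K3, K3 = (2 / cgSq c g + τ ^ 2 + 1 / (4 * cgSq c g))
      * ((∫ s in Ioi (0 : ℝ), g s) / ζ) := ⟨_, rfl⟩
  have hK2p : 0 ≤ K2 := by rw [hK2]; positivity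
  have hK3p : 0 ≤ K3 := by rw [hK3]; positivity
  -- One summand for each lower bound required of N: `hN1`–`hN4` give coercivity of the functional,
  -- `hN5` and `hN6` absorb the errors of the cross functional.
  obtain ⟨N, hN⟩ : ∃ N, N = 3 + 2 * τ + (K2 + 3) / (b - τ * c ^ 2) + 2 * (K3 + 1)
      + 3 / cgSq c g + 2 * (τ + 1) / (τ * (b - τ * c ^ 2)) + 2 / τ := ⟨_, rfl⟩
  have p1 : 0 ≤ (K2 + 3) / (b - τ * c ^ 2) := by positivity
  have p2 : 0 ≤ 3 / cgSq c g := by positivity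
  have p3 : 0 ≤ 2 * (τ + 1) / (τ * (b - τ * c ^ 2)) := by positivity
  have p4 : 0 ≤ 2 / τ := by positivity
  have hN0 : 0 ≤ N := by rw [hN]; positivity
  have hN1 : 3 ≤ N * cgSq c g := by rw [← div_le_iff₀ hC]; linarith
  have hN2 : 3 + 2 * τ ≤ N := by linarith
  have hN3 : 2 * (τ + 1) ≤ N * (τ * (b - τ * c ^ 2)) := by
    rw [← div_le_iff₀ (by positivity)]; linarith
  have hN4 : 2 ≤ N * τ := by rw [← div_le_iff₀ hτ]; linarith
  have hN5 : K2 + 3 ≤ N * (b - τ * c ^ 2) := by rw [← div_le_iff₀ hβ]; linarith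
  have hN6 : 2 * (K3 + 1) ≤ N := by linarith
  obtain ⟨K, hK0, hK⟩ := full_upper hg hτ hb N hN0
  -- The entries are the remaining dissipation coefficients of Gz, Gy and w, together with the
  -- coefficient of ‖w‖² in the cross functional.
  obtain ⟨δ, hδ⟩ : ∃ δ, δ = min (min (1 / 2) (1 / (12 * cgSq c g) * τ))
      (min (cgSq c g / 2) (1 / (12 * cgSq c g))) := ⟨_, rfl⟩
  have hδ0 : 0 < δ := by
    rw [hδ]
    exact lt_min (lt_min (by norm_num) (by positivity)) (lt_min (by positivity) (by positivity))
  have hδ1 : δ ≤ 1 / 2 := by rw [hδ]; exact (min_le_left _ _).trans (min_le_left _ _)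
  have hδ2 : δ ≤ 1 / (12 * cgSq c g) * τ := by
    rw [hδ]; exact (min_le_left _ _).trans (min_le_right _ _)
  have hδ3 : δ ≤ cgSq c g / 2 := by rw [hδ]; exact (min_le_right _ _).trans (min_le_left _ _)
  have hδ4 : δ ≤ 1 / (12 * cgSq c g) := by
    rw [hδ]; exact (min_le_right _ _).trans (min_le_right _ _)
  have hq : 0 ≤ 1 / (6 * cgSq c g) := by positivity
  -- An upper bound for the coefficients of all pairings: N from the Lyapunov functionals, and 1, 2
  -- and 1/(6C) from the cross functional.
  obtain ⟨Q, hQ⟩ : ∃ Q, Q = N + 2 + 1 / (6 * cgSq c g) := ⟨_, rfl⟩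
  have hQ0 : 0 < Q := by rw [hQ]; positivity
  refine ⟨(K + Q) / δ, by positivity, ?_⟩
  intro H _ _ _ T G p v w w' f hs t ht
  have hs' := hs.map hg
  have h1 := mul_le_mul_of_nonneg_left (hs.lyapunov_le hg hτ ht) hN0
  have h2 := mul_le_mul_of_nonneg_left (hs'.lyapunov_le hg hτ ht) hN0
  have h3 := hs.crossFunctional_le hg ht (K2 := K2) (K3 := K3) hK2.ge (fun t => by
    have a1 := norm_memInt_sq_le hg.antitoneKernel (hs.path_p.clm G).left t
    have a2 := hg.decay_memNormSq hζ (hs.path_p.clm G).left t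
    rw [memInt_map hg.integrable hs.path_p.left] at a1
    rw [hK3, mul_assoc]
    refine mul_le_mul_of_nonneg_left ?_ (by positivity)
    refine a1.trans ?_
    rw [div_mul_eq_mul_div, mul_div_assoc]
    refine mul_le_mul_of_nonneg_left ?_ hG0.le
    rw [le_div_iff₀ hζ0]; linarith)
  have h4 := full_lower hg hτ hs hN0 hN1 hN2 hN3 hN4 (hδ1.trans (by norm_num)) hδ2 t
  have h5 := hK T G p v w w' f hs 0
  have hh := hg.antitoneKernel_neg_deriv
  have cM0 := continuous_memNormSq hh.integrable hs.path_p.left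
  have cM1 := continuous_memNormSq hh.integrable (hs.path_p.clm G).left
  have hz := hs.path_v.add (hs.path_w.const_smul τ)
  have hGv := hs.path_v.clm G
  have hy := hs.path_p.add (hGv.const_smul τ)
  have cz := hz.left.cont
  have cGz := (hz.clm G).left.cont
  have cz' := (hGv.add ((hs.path_w.clm G).const_smul τ)).left.cont
  have cGv := hGv.left.cont
  have cGGv := (hGv.clm G).left.cont
  have cy := hy.left.cont
  have cGy := (hy.clm G).left.cont
  have cw := hs.path_w.left.cont
  have cf := hs.bdd_f.cont
  have cGf := (hs.bdd_f.clm G).cont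
  have cA1 : Continuous fun σ => ((b - τ * c ^ 2) * ‖G (v σ)‖ ^ 2
        + (1 / 2) * memNormSq (fun s => -deriv g s) p σ) :=
    (continuous_const.mul (cGv.norm.pow 2)).add (continuous_const.mul cM0)
  have cA2 : Continuous fun σ => ((b - τ * c ^ 2) * ‖G (G (v σ))‖ ^ 2
        + (1 / 2) * memNormSq (fun s => -deriv g s) (fun t => G (p t)) σ) :=
    (continuous_const.mul (cGGv.norm.pow 2)).add (continuous_const.mul cM1)
  have cA3 : Continuous fun σ => ((1 / 2) * ‖G (v σ + τ • w σ)‖ ^ 2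
          + cgSq c g / 2 * ‖G (p σ + τ • G (v σ))‖ ^ 2 + 1 / (12 * cgSq c g) * ‖w σ‖ ^ 2) :=
    ((continuous_const.mul (cGz.norm.pow 2)).add (continuous_const.mul (cGy.norm.pow 2))).add
      (continuous_const.mul (cw.norm.pow 2))
  have cB1 : Continuous fun σ => ⟪f σ, v σ + τ • w σ⟫ := cf.inner cz
  have cB2 : Continuous fun σ => ⟪G (f σ), G (v σ) + τ • G (w σ)⟫ := cGf.inner cz'
  have cB3 : Continuous fun σ => (2 * ‖G (v σ)‖ ^ 2 + K2 * ‖G (G (v σ))‖ ^ 2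
          + K3 * memNormSq (fun s => -deriv g s) (fun t => G (p t)) σ
          + (⟪G (f σ), p σ + τ • G (v σ)⟫ - 2 * ⟪G (f σ), τ • G (v σ)⟫
            + 1 / (6 * cgSq c g) * ⟪f σ, w σ⟫)) :=
    (((continuous_const.mul (cGv.norm.pow 2)).add (continuous_const.mul (cGGv.norm.pow 2))).add
      (continuous_const.mul cM1)).add (((cGf.inner cy).sub (continuous_const.mul
        (cGf.inner (cGv.const_smul τ)))).add (continuous_const.mul (cf.inner cw)))
  have cD := continuous_absDissipation hg hs
  have cP := continuous_absPairings hs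
  have eA := integral_linear3 N t cA1 cA2 cA3
  have eB := integral_linear3 N t cB1 cB2 cB3
  have cD' : Continuous fun σ => δ * absDissipation τ g G p v w σ := continuous_const.mul cD
  have cP' : Continuous fun σ => Q * absPairings τ G p v w f σ := continuous_const.mul cP
  have hA : Continuous fun σ => (N * ((b - τ * c ^ 2) * ‖G (v σ)‖ ^ 2
        + (1 / 2) * memNormSq (fun s => -deriv g s) p σ) + N * ((b - τ * c ^ 2) * ‖G (G (v σ))‖ ^ 2
        + (1 / 2) * memNormSq (fun s => -deriv g s) (fun t => G (p t)) σ)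
        + ((1 / 2) * ‖G (v σ + τ • w σ)‖ ^ 2
          + cgSq c g / 2 * ‖G (p σ + τ • G (v σ))‖ ^ 2 + 1 / (12 * cgSq c g) * ‖w σ‖ ^ 2)) :=
    ((continuous_const.mul cA1).add (continuous_const.mul cA2)).add cA3
  have hB : Continuous fun σ => (N * ⟪f σ, v σ + τ • w σ⟫
      + N * ⟪G (f σ), G (v σ) + τ • G (w σ)⟫ + (2 * ‖G (v σ)‖ ^ 2 + K2 * ‖G (G (v σ))‖ ^ 2
          + K3 * memNormSq (fun s => -deriv g s) (fun t => G (p t)) σ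
          + (⟪G (f σ), p σ + τ • G (v σ)⟫ - 2 * ⟪G (f σ), τ • G (v σ)⟫
            + 1 / (6 * cgSq c g) * ⟪f σ, w σ⟫))) :=
    ((continuous_const.mul cB1).add (continuous_const.mul cB2)).add cB3
  -- Absorption happens under the integral: at each time the right-hand sides exceed the good terms
  -- by at most Q times the pairings, minus δ times the dissipation.
  have hBP := integral_add_le_of_le ht.1 hB cD' (hA.add cP') ?_
  · rw [intervalIntegral.integral_const_mul] at hBP
    have e := intervalIntegral.integral_add (hA.intervalIntegrable (μ := volume) 0 t)
      (cP'.intervalIntegrable 0 t)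
    rw [intervalIntegral.integral_const_mul] at e
    simp only [Pi.add_apply] at hBP
    rw [e, eA, eB] at hBP
    have hE0 : 0 ≤ absEnergy τ g G p v w 0 := by
      have m0 := memNormSq_nonneg hh p 0
      have m1 := memNormSq_nonneg hh (fun t => G (p t)) 0
      unfold absEnergy
      positivity
    have hP0 : 0 ≤ ∫ σ in (0 : ℝ)..t, absPairings τ G p v w f σ :=
      intervalIntegral.integral_nonneg ht.1 fun σ _ => by unfold absPairings; positivity
    rw [div_mul_eq_mul_div, le_div_iff₀ hδ0]
    have w1 := mul_nonneg hQ0.le hE0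
    have w2 := mul_nonneg hK0 hP0
    linarith
  · intro σ _
    have m0 := memNormSq_nonneg hh p σ
    have m1 := memNormSq_nonneg hh (fun t => G (p t)) σ
    have ez : G (v σ) + τ • G (w σ) = G (v σ + τ • w σ) := by simp
    simp only [Pi.add_apply]
    rw [ez]
    unfold absDissipation absPairings
    have q3 := sq_nonneg ‖G (v σ)‖
    have q4 := sq_nonneg ‖w σ‖
    have q5 := sq_nonneg ‖G (p σ + τ • G (v σ))‖
    have q6 := sq_nonneg ‖G (v σ + τ • w σ)‖
    have q7 := sq_nonneg ‖G (G (v σ))‖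
    have r3 := mul_le_mul_of_nonneg_right hN5 q3
    have r7 := mul_le_mul_of_nonneg_right hN5 q7
    have r8 := mul_le_mul_of_nonneg_right hN6 m0
    have r9 := mul_le_mul_of_nonneg_right hN6 m1
    have k3 := mul_nonneg hK2p q3
    have k8 := mul_nonneg hK3p m0
    have d3 := mul_le_mul_of_nonneg_right hδ1 q3
    have d4 := mul_le_mul_of_nonneg_right hδ4 q4
    have d5 := mul_le_mul_of_nonneg_right hδ3 q5
    have d6 := mul_le_mul_of_nonneg_right hδ1 q6
    have d7 := mul_le_mul_of_nonneg_right hδ1 q7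
    have d8 := mul_le_mul_of_nonneg_right hδ1 m0
    have d9 := mul_le_mul_of_nonneg_right hδ1 m1
    have b1 := mul_le_mul_of_nonneg_left (le_abs_self ⟪f σ, v σ + τ • w σ⟫) hN0
    have b2 := mul_le_mul_of_nonneg_left (le_abs_self ⟪G (f σ), G (v σ + τ • w σ)⟫) hN0
    have b3 := mul_le_mul_of_nonneg_left (le_abs_self ⟪f σ, w σ⟫) hq
    have b4 := le_abs_self ⟪G (f σ), p σ + τ • G (v σ)⟫
    have b5 := neg_abs_le ⟪G (f σ), τ • G (v σ)⟫
    have n1 := abs_nonneg ⟪f σ, v σ + τ • w σ⟫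
    have n2 := abs_nonneg ⟪G (f σ), G (v σ + τ • w σ)⟫
    have n3 := abs_nonneg ⟪f σ, w σ⟫
    have n4 := abs_nonneg ⟪G (f σ), p σ + τ • G (v σ)⟫
    have n5 := abs_nonneg ⟪G (f σ), τ • G (v σ)⟫
    have nN : ∀ x : ℝ, 0 ≤ x → 0 ≤ N * x ∧ 0 ≤ 1 / (6 * cgSq c g) * x :=
      fun x hx => ⟨by positivity, by positivity⟩
    obtain ⟨_, _⟩ := nN _ n1
    obtain ⟨_, _⟩ := nN _ n2
    obtain ⟨_, _⟩ := nN _ n3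
    obtain ⟨_, _⟩ := nN _ n4
    obtain ⟨_, _⟩ := nN _ n5
    rw [hQ]
    linarith

end AbstractEstimate


/-! ### Elementary calculus of weak derivatives. -/

section WeakCalculus

variable {n : ℕ} {j : Fin n}

theorem WeaklyDiff.hasWeakPartial {u : E n → ℝ} (h : WeaklyDiff j u) :
    HasWeakPartial j u (wpartial j u) := by
  unfold wpartial
  rw [dif_pos h]
  exact Classical.choose_spec h

theorem HasWeakPartial.weaklyDiff {u du : E n → ℝ} (h : HasWeakPartial j u du) :
    WeaklyDiff j u := ⟨du, h⟩

theorem HasWeakPartial.ae_unique {u du du' : E n → ℝ} (h : HasWeakPartial j u du)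
    (h' : HasWeakPartial j u du') : du =ᵐ[volume] du' := by
  refine ae_eq_of_integral_contDiff_smul_eq h.2.1 h'.2.1 fun φ hφ hc => ?_
  have := (h.2.2 φ hφ hc).symm.trans (h'.2.2 φ hφ hc)
  simpa [mul_comm] using this

theorem HasWeakPartial.wpartial_ae {u du : E n → ℝ} (h : HasWeakPartial j u du) :
    wpartial j u =ᵐ[volume] du :=
  h.weaklyDiff.hasWeakPartial.ae_unique h

theorem _root_.MeasureTheory.LocallyIntegrable.congr_ae {u v : E n → ℝ}
    (h : LocallyIntegrable u volume) (huv : u =ᵐ[volume] v) : LocallyIntegrable v volume :=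
  fun x => by
    obtain ⟨s, hs, hi⟩ := h x
    exact ⟨s, hs, hi.congr (ae_restrict_of_ae huv)⟩

theorem HasWeakPartial.congr {u du u' du' : E n → ℝ} (h : HasWeakPartial j u du)
    (hu : u =ᵐ[volume] u') (hdu : du =ᵐ[volume] du') : HasWeakPartial j u' du' := by
  refine ⟨h.1.congr_ae hu, h.2.1.congr_ae hdu, fun φ hφ hc => ?_⟩
  have e1 : ∫ x, u' x * fderiv ℝ φ x (EuclideanSpace.single j 1)
      = ∫ x, u x * fderiv ℝ φ x (EuclideanSpace.single j 1) :=
    integral_congr_ae (by filter_upwards [hu] with x hx; rw [hx])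
  have e2 : ∫ x, du' x * φ x = ∫ x, du x * φ x :=
    integral_congr_ae (by filter_upwards [hdu] with x hx; rw [hx])
  rw [e1, e2, h.2.2 φ hφ hc]

theorem contDiff_fderiv_single {φ : E n → ℝ} (hφ : ContDiff ℝ ∞ φ) (j : Fin n) :
    ContDiff ℝ ∞ (fun x => fderiv ℝ φ x (EuclideanSpace.single j 1)) :=
  (hφ.fderiv_right (m := ∞) (by simp)).clm_apply contDiff_const

theorem hasCompactSupport_fderiv_single {φ : E n → ℝ} (hc : HasCompactSupport φ) (j : Fin n) :
    HasCompactSupport (fun x => fderiv ℝ φ x (EuclideanSpace.single j 1)) :=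
  (hc.fderiv ℝ).comp_left (g := fun L : E n →L[ℝ] ℝ => L (EuclideanSpace.single j 1)) (by simp)

theorem integrable_mul_test {u φ : E n → ℝ} (hu : LocallyIntegrable u volume)
    (hφ : Continuous φ) (hc : HasCompactSupport φ) : Integrable (fun x => u x * φ x) volume := by
  have := hu.integrable_smul_right_of_hasCompactSupport hφ hc
  simpa [mul_comm] using this

theorem HasWeakPartial.add {u du v dv : E n → ℝ} (hu : HasWeakPartial j u du)
    (hv : HasWeakPartial j v dv) : HasWeakPartial j (u + v) (du + dv) := by
  refine ⟨hu.1.add hv.1, hu.2.1.add hv.2.1, fun φ hφ hc => ?_⟩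
  have cd := (contDiff_fderiv_single hφ j).continuous
  have hd := hasCompactSupport_fderiv_single hc j
  simp only [Pi.add_apply, add_mul]
  rw [integral_add (integrable_mul_test hu.1 cd hd) (integrable_mul_test hv.1 cd hd),
    integral_add (integrable_mul_test hu.2.1 hφ.continuous hc)
      (integrable_mul_test hv.2.1 hφ.continuous hc), hu.2.2 φ hφ hc, hv.2.2 φ hφ hc]
  ring

theorem HasWeakPartial.const_smul {u du : E n → ℝ} (hu : HasWeakPartial j u du) (a : ℝ) :
    HasWeakPartial j (a • u) (a • du) := by
  refine ⟨hu.1.smul a, hu.2.1.smul a, fun φ hφ hc => ?_⟩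
  simp only [Pi.smul_apply, smul_eq_mul, mul_assoc]
  rw [integral_const_mul, integral_const_mul, hu.2.2 φ hφ hc]
  ring

/-- Second weak derivatives commute. -/
theorem HasWeakPartial.swap {i : Fin n} {u ui uj uij : E n → ℝ} (hi : HasWeakPartial i u ui)
    (hj : HasWeakPartial j u uj) (hij : HasWeakPartial j ui uij) : HasWeakPartial i uj uij := by
  refine ⟨hj.2.1, hij.2.1, fun φ hφ hc => ?_⟩
  have h1 := hij.2.2 φ hφ hc
  have h2 := hi.2.2 _ (contDiff_fderiv_single hφ j) (hasCompactSupport_fderiv_single hc j)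
  have h3 := hj.2.2 _ (contDiff_fderiv_single hφ i) (hasCompactSupport_fderiv_single hc i)
  have e : ∀ x, fderiv ℝ (fun x => fderiv ℝ φ x (EuclideanSpace.single j 1)) x
        (EuclideanSpace.single i 1)
      = fderiv ℝ (fun x => fderiv ℝ φ x (EuclideanSpace.single i 1)) x
        (EuclideanSpace.single j 1) := by
    intro x
    have hd : DifferentiableAt ℝ (fderiv ℝ φ) x :=
      ((hφ.fderiv_right (m := ∞) (by simp)).differentiable (by simp)) x
    have hs : IsSymmSndFDerivAt ℝ φ x := hφ.contDiffAt.isSymmSndFDerivAt (by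
      rw [minSmoothness_of_isRCLikeNormedField]; exact WithTop.coe_le_coe.2 (le_top : (2 : ℕ∞) ≤ ⊤))
    have hf : ∀ a : E n, fderiv ℝ (fun x => fderiv ℝ φ x a) x = (fderiv ℝ (fderiv ℝ φ) x).flip a := by
      intro a
      rw [fderiv_clm_apply hd (differentiableAt_const a)]
      simp
    rw [hf, hf]
    exact hs _ _
  simp only [e] at h2
  linarith

end WeakCalculus

/-! ### Weak derivatives and the Fourier transform on L². -/

section Fourier

open FourierTransform SchwartzMap LineDeriv

variable {n : ℕ} {j : Fin n}

/-- The space of square integrable complex functions on `ℝⁿ`. -/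
abbrev HC (n : ℕ) : Type := Lp ℂ 2 (volume : Measure (E n))

/-- Weak derivatives of `L²` functions may be tested with `H¹` smooth functions. -/
theorem HasWeakPartial.integral_of_memLp {u du φ : E n → ℝ} (h : HasWeakPartial j u du)
    (hu : MemLp u 2 volume) (hdu : MemLp du 2 volume) (hφ : ContDiff ℝ ∞ φ)
    (hφ2 : MemLp φ 2 volume)
    (hdφ : MemLp (fun x => fderiv ℝ φ x (EuclideanSpace.single j 1)) 2 volume) :
    ∫ x, u x * fderiv ℝ φ x (EuclideanSpace.single j 1) = -∫ x, du x * φ x := by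
  set e : E n := EuclideanSpace.single j 1
  -- The test function is multiplied by χ(x/(k+1)). The commutator term carries the factor 1/(k+1)
  -- and a bounded derivative of χ, so it vanishes in the limit by dominated convergence.
  let χ : ContDiffBump (0 : E n) := ⟨1, 2, one_pos, one_lt_two⟩
  have hχc : ContDiff ℝ ∞ χ := χ.contDiff
  have hχs : HasCompactSupport χ := χ.hasCompactSupport
  obtain ⟨M, hM⟩ : ∃ M, ∀ x, ‖fderiv ℝ χ x e‖ ≤ M := by
    have hc := (contDiff_fderiv_single hχc j).continuous
    exact hc.bounded_above_of_compact_support (hasCompactSupport_fderiv_single hχs j)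
  let r : ℕ → ℝ := fun k => ((k : ℝ) + 1)⁻¹
  have hr0 : ∀ k, 0 < r k := fun k => by positivity
  have hr1 : ∀ k, r k ≤ 1 := fun k => inv_le_one_of_one_le₀ (by simp)
  have hrlim : Tendsto r atTop (𝓝 0) := tendsto_one_div_add_atTop_nhds_zero_nat.congr
    fun k => by simp [r]
  let X : ℕ → E n → ℝ := fun k x => χ (r k • x)
  have hXc : ∀ k, ContDiff ℝ ∞ (X k) := fun k => hχc.comp (contDiff_const_smul (r k))
  have hXs : ∀ k, HasCompactSupport (X k) := fun k =>
    hχs.comp_homeomorph (Homeomorph.smulOfNeZero (r k) (hr0 k).ne')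
  have hX01 : ∀ k x, ‖X k x‖ ≤ 1 := fun k x => by
    rw [Real.norm_of_nonneg (χ.nonneg)]; exact χ.le_one
  have hXd : ∀ k x, fderiv ℝ (X k) x e = r k * fderiv ℝ χ (r k • x) e := by
    intro k x
    have h1 : HasFDerivAt (fun x : E n => r k • x) (r k • ContinuousLinearMap.id ℝ (E n)) x :=
      (hasFDerivAt_id x).const_smul (r k)
    have h2 := ((hχc.differentiable (by simp)) (r k • x)).hasFDerivAt.comp x h1
    have h3 : fderiv ℝ (X k) x = _ := h2.fderiv
    rw [h3]
    simp
  have hXlim : ∀ x, ∀ᶠ k in atTop, X k x = 1 := by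
    intro x
    have : Tendsto (fun k => r k • x) atTop (𝓝 ((0 : ℝ) • x)) := hrlim.smul_const x
    rw [zero_smul] at this
    filter_upwards [this.eventually (Metric.closedBall_mem_nhds (0 : E n) one_pos)] with k hk
    exact χ.one_of_mem_closedBall hk
  have key : ∀ k, ∫ x, u x * (X k x * fderiv ℝ φ x e + r k * fderiv ℝ χ (r k • x) e * φ x)
      = -∫ x, du x * (X k x * φ x) := by
    intro k
    have := h.2.2 (fun x => X k x * φ x) ((hXc k).mul hφ) ((hXs k).mul_right)
    rw [← this]
    refine integral_congr_ae (ae_of_all _ fun x => ?_)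
    have hd : fderiv ℝ (fun x => X k x * φ x) x
        = X k x • fderiv ℝ φ x + φ x • fderiv ℝ (X k) x :=
      fderiv_fun_mul ((hXc k).differentiable (by simp) x) (hφ.differentiable (by simp) x)
    simp only [hd, add_apply, smul_apply, smul_eq_mul]
    rw [hXd]
    ring
  have mX : ∀ k, Continuous (X k) := fun k => (hXc k).continuous
  have cdχ : Continuous fun x => fderiv ℝ χ x e := (contDiff_fderiv_single hχc j).continuous
  have lim1 : Tendsto (fun k => ∫ x, u x * (X k x * fderiv ℝ φ x e
      + r k * fderiv ℝ χ (r k • x) e * φ x)) atTop (𝓝 (∫ x, u x * fderiv ℝ φ x e)) := by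
    refine tendsto_integral_of_dominated_convergence
      (fun x => |u x * fderiv ℝ φ x e| + M * |u x * φ x|) (fun k => ?_)
      ((hu.integrable_mul hdφ).norm.add ((hu.integrable_mul hφ2).norm.const_mul M)) (fun k => ?_) ?_
    · refine hu.aestronglyMeasurable.mul (((mX k).aestronglyMeasurable.mul
        hdφ.aestronglyMeasurable).add (AEStronglyMeasurable.mul ?_ hφ2.aestronglyMeasurable))
      exact (continuous_const.mul (cdχ.comp (continuous_const_smul (r k)))).aestronglyMeasurable
    · refine ae_of_all _ fun x => ?_
      rw [mul_add]
      refine (norm_add_le _ _).trans (add_le_add ?_ ?_)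
      · rw [mul_left_comm, norm_mul]
        exact (mul_le_mul_of_nonneg_right (hX01 k x) (norm_nonneg _)).trans (by simp)
      · have e1 : u x * (r k * fderiv ℝ χ (r k • x) e * φ x)
            = (r k * fderiv ℝ χ (r k • x) e) * (u x * φ x) := by ring
        rw [e1, norm_mul]
        refine mul_le_mul_of_nonneg_right ?_ (norm_nonneg _)
        rw [norm_mul, Real.norm_of_nonneg (hr0 k).le]
        calc r k * ‖fderiv ℝ χ (r k • x) e‖ ≤ 1 * M :=
              mul_le_mul (hr1 k) (hM _) (norm_nonneg _) zero_le_one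
          _ = M := one_mul M
    · refine ae_of_all _ fun x => ?_
      have t1 : Tendsto (fun k => X k x * fderiv ℝ φ x e) atTop (𝓝 (1 * fderiv ℝ φ x e)) :=
        (tendsto_const_nhds.congr' ((hXlim x).mono fun k hk => hk.symm)).mul_const _
      have t2 : Tendsto (fun k => r k * fderiv ℝ χ (r k • x) e) atTop (𝓝 0) := by
        refine squeeze_zero_norm (a := fun k => r k * M) (fun k => ?_) (by simpa using hrlim.mul_const M)
        rw [norm_mul, Real.norm_of_nonneg (hr0 k).le]
        exact mul_le_mul_of_nonneg_left (hM _) (hr0 k).le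
      have := (t1.add (t2.mul_const (φ x))).const_mul (u x)
      simpa using this
  have lim2 : Tendsto (fun k => -∫ x, du x * (X k x * φ x)) atTop (𝓝 (-∫ x, du x * φ x)) := by
    refine Tendsto.neg (tendsto_integral_of_dominated_convergence
      (fun x => |du x * φ x|) (fun k => ?_) (hdu.integrable_mul hφ2).norm (fun k => ?_) ?_)
    · exact hdu.aestronglyMeasurable.mul ((mX k).aestronglyMeasurable.mul hφ2.aestronglyMeasurable)
    · refine ae_of_all _ fun x => ?_
      rw [mul_left_comm, norm_mul]
      exact (mul_le_mul_of_nonneg_right (hX01 k x) (norm_nonneg _)).trans (by simp)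
    · refine ae_of_all _ fun x => ?_
      have t1 : Tendsto (fun k => X k x * φ x) atTop (𝓝 (1 * φ x)) :=
        (tendsto_const_nhds.congr' ((hXlim x).mono fun k hk => hk.symm)).mul_const _
      simpa using t1.const_mul (du x)
  simp only [key] at lim1
  exact tendsto_nhds_unique lim1 lim2

/-- Real and imaginary parts of φ are tested separately. Complex test functions are needed because
Fourier transforms of test functions are complex. -/
theorem HasWeakPartial.integral_schwartz {u du : E n → ℝ} (h : HasWeakPartial j u du)
    (hu : MemLp u 2 volume) (hdu : MemLp du 2 volume) (φ : 𝓢(E n, ℂ)) :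
    ∫ x, (∂_{EuclideanSpace.single j (1 : ℝ)} φ) x • (u x : ℂ) = -∫ x, φ x • (du x : ℂ) := by
  set e : E n := EuclideanSpace.single j 1
  have hφ2 : MemLp φ 2 volume := φ.memLp 2 volume
  have hd2 : MemLp (∂_{e} φ : 𝓢(E n, ℂ)) 2 volume := (∂_{e} φ).memLp 2 volume
  have hφs : ContDiff ℝ ∞ φ := φ.smooth ⊤
  have hdφ : ∀ x, HasFDerivAt φ (fderiv ℝ φ x) x := fun x =>
    (hφs.differentiable (by simp) x).hasFDerivAt
  have part : ∀ L : ℂ →L[ℝ] ℝ, L (∫ x, (∂_{e} φ) x • (u x : ℂ)) = L (-∫ x, φ x • (du x : ℂ)) := by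
    intro L
    have hLd : ∀ x, fderiv ℝ (fun x => L (φ x)) x e = L ((∂_{e} φ) x) := by
      intro x
      have := (L.hasFDerivAt.comp x (hdφ x)).fderiv
      have h' : fderiv ℝ (fun x => L (φ x)) x = _ := this
      rw [h']; rfl
    have hLφ : MemLp (fun x => L (φ x)) 2 volume := L.comp_memLp' hφ2
    have hLdφ : MemLp (fun x => fderiv ℝ (fun x => L (φ x)) x e) 2 volume := by
      simp only [hLd]; exact L.comp_memLp' hd2
    have main := h.integral_of_memLp hu hdu (L.contDiff.comp hφs) hLφ hLdφ
    have i1 : Integrable (fun x => (∂_{e} φ) x • (u x : ℂ)) volume := hd2.integrable_mul hu.ofReal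
    have i2 : Integrable (fun x => φ x • (du x : ℂ)) volume := hφ2.integrable_mul hdu.ofReal
    have hL : ∀ (z : ℂ) (a : ℝ), L (z • (a : ℂ)) = a * L z := by
      intro z a
      have : z • (a : ℂ) = a • z := by rw [smul_eq_mul, mul_comm, Complex.real_smul]
      rw [this, map_smul, smul_eq_mul]
    rw [map_neg, ← L.integral_comp_comm i1, ← L.integral_comp_comm i2]
    simp only [hL]
    simp only [← hLd]
    exact main
  exact Complex.ext (part Complex.reCLM) (part Complex.imCLM)

open Classical in
/-- The Fourier transform in `L²` of a real function; zero if the function is not in `L²`. -/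
noncomputable def ft (u : E n → ℝ) : HC n :=
  if h : MemLp u 2 volume then 𝓕 (h.ofReal (K := ℂ)).toLp else 0

theorem ft_of_memLp {u : E n → ℝ} (h : MemLp u 2 volume) :
    ft u = 𝓕 ((h.ofReal (K := ℂ)).toLp) := dif_pos h

/-- The duality characterising the L² transform. It allows identities for `ft` to be checked against
Schwartz functions. -/
theorem integral_schwartz_ft {u : E n → ℝ} (hu : MemLp u 2 volume) (φ : 𝓢(E n, ℂ)) :
    ∫ ξ, φ ξ • ft u ξ = ∫ x, (𝓕 φ) x • (u x : ℂ) := by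
  have h := congrArg (fun T : TemperedDistribution (E n) ℂ => T φ)
    (Lp.fourier_toTemperedDistribution_eq (hu.ofReal (K := ℂ)).toLp)
  simp only [TemperedDistribution.fourier_apply, Lp.toTemperedDistribution_apply] at h
  rw [ft_of_memLp hu, ← h]
  refine integral_congr_ae ?_
  filter_upwards [(hu.ofReal (K := ℂ)).coeFn_toLp] with x hx
  rw [hx]
  rfl

theorem ae_eq_of_integral_schwartz {f g : E n → ℂ} (hf : LocallyIntegrable f volume)
    (hg : LocallyIntegrable g volume) (h : ∀ φ : 𝓢(E n, ℂ), ∫ x, φ x • f x = ∫ x, φ x • g x) :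
    f =ᵐ[volume] g := by
  refine ae_eq_of_integral_contDiff_smul_eq hf hg fun φ hφ hc => ?_
  have hg₁ : HasCompactSupport (Complex.ofRealCLM ∘ φ) := hc.comp_left rfl
  have hg₂ : ContDiff ℝ ∞ (Complex.ofRealCLM ∘ φ) := by fun_prop
  have := h (hg₁.toSchwartzMap hg₂)
  simpa using this

/-- The symbol `2 π i ξ_j` of the partial derivative `∂_j`. -/
noncomputable def sym1 (j : Fin n) (ξ : E n) : ℂ := 2 * Real.pi * Complex.I * (ξ j : ℂ)

theorem continuous_sym1 (j : Fin n) : Continuous (sym1 j) := by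
  unfold sym1; fun_prop

theorem locallyIntegrable_sym1_mul (f : HC n) (j : Fin n) :
    LocallyIntegrable (fun ξ => sym1 j ξ * f ξ) volume := by
  have h := (Lp.memLp f).locallyIntegrable one_le_two
  exact (locallyIntegrableOn_univ.1
    ((locallyIntegrableOn_univ.2 h).continuousOn_mul (continuous_sym1 j).continuousOn
      isOpen_univ.isLocallyClosed))

/-- By duality the claim moves to the test function, where the derivative of 𝓕φ is the transform of
-2πiξ_jφ. -/
theorem HasWeakPartial.ft_eq {u du : E n → ℝ} (h : HasWeakPartial j u du)
    (hu : MemLp u 2 volume) (hdu : MemLp du 2 volume) :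
    ft du =ᵐ[volume] fun ξ => sym1 j ξ * ft u ξ := by
  refine ae_eq_of_integral_schwartz ((Lp.memLp _).locallyIntegrable one_le_two)
    (locallyIntegrable_sym1_mul _ j) fun φ => ?_
  rw [integral_schwartz_ft hdu, ← neg_eq_iff_eq_neg.2 (h.integral_schwartz hu hdu (𝓕 φ)),
    SchwartzMap.lineDerivOp_fourier_eq, ← integral_schwartz_ft hu, ← integral_neg]
  refine integral_congr_ae (ae_of_all _ fun ξ => ?_)
  have : (inner ℝ · (EuclideanSpace.single j (1 : ℝ)) : E n → ℝ).HasTemperateGrowth := by fun_prop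
  have e : (-(2 * Real.pi * Complex.I) • smulLeftCLM ℂ
      (inner ℝ · (EuclideanSpace.single j (1 : ℝ))) φ) ξ
      = -(2 * Real.pi * Complex.I) * ((ξ j : ℂ) * φ ξ) := by
    rw [_root_.smul_apply, smulLeftCLM_apply_apply this]
    simp [EuclideanSpace.inner_single_right]
  simp only [e, sym1, smul_eq_mul]
  ring

end Fourier


/-! ### Plancherel for real functions, and derivatives recovered from symbols. -/

section FourierL2

open FourierTransform SchwartzMap LineDeriv

variable {n : ℕ} {j : Fin n}

theorem ft_congr {u v : E n → ℝ} (h : u =ᵐ[volume] v) : ft u = ft v := by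
  by_cases hu : MemLp u 2 volume
  · have hv : MemLp v 2 volume := (memLp_congr_ae h).1 hu
    rw [ft_of_memLp hu, ft_of_memLp hv]
    congr 1
    rw [MemLp.toLp_eq_toLp_iff]
    filter_upwards [h] with x hx
    rw [hx]
  · have hv : ¬ MemLp v 2 volume := fun hv => hu ((memLp_congr_ae h).2 hv)
    unfold ft
    rw [dif_neg hu, dif_neg hv]

theorem ft_add {u v : E n → ℝ} (hu : MemLp u 2 volume) (hv : MemLp v 2 volume) :
    ft (u + v) = ft u + ft v := by
  rw [ft_of_memLp hu, ft_of_memLp hv, ft_of_memLp (hu.add hv), ← FourierTransform.fourier_add,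
    ← MemLp.toLp_add]
  congr 1
  rw [MemLp.toLp_eq_toLp_iff]
  exact ae_of_all _ fun x => by simp

theorem ft_smul {u : E n → ℝ} (hu : MemLp u 2 volume) (a : ℝ) : ft (a • u) = a • ft u := by
  have : a • ft u = (a : ℂ) • ft u := by
    apply Lp.ext
    filter_upwards [Lp.coeFn_smul a (ft u), Lp.coeFn_smul (a : ℂ) (ft u)] with x h1 h2
    rw [h1, h2]; simp
  rw [this, ft_of_memLp hu, ft_of_memLp (hu.const_smul a), ← FourierTransform.fourier_smul,
    ← MemLp.toLp_const_smul]
  congr 1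
  rw [MemLp.toLp_eq_toLp_iff]
  exact ae_of_all _ fun x => by simp

theorem inner_HC (f g : HC n) : inner ℝ f g = ∫ x, (inner ℝ (f x) (g x) : ℝ) :=
  L2.inner_def (𝕜 := ℝ) f g

/-- The energy argument uses the real inner product, Plancherel the complex one. -/
theorem inner_HC_eq_re (f g : HC n) : inner ℝ f g = (inner ℂ f g : ℂ).re := by
  rw [inner_HC, L2.inner_def (𝕜 := ℂ) f g]
  have := (Complex.reCLM.integral_comp_comm (L2.integrable_inner (𝕜 := ℂ) f g))
  simp only [Complex.reCLM_apply] at this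
  rw [← this]
  rfl

theorem inner_ft {u v : E n → ℝ} (hu : MemLp u 2 volume) (hv : MemLp v 2 volume) :
    inner ℝ (ft u) (ft v) = ∫ x, u x * v x := by
  rw [inner_HC_eq_re, ft_of_memLp hu, ft_of_memLp hv, Lp.inner_fourier_eq, ← inner_HC_eq_re,
    inner_HC]
  refine integral_congr_ae ?_
  filter_upwards [(hu.ofReal (K := ℂ)).coeFn_toLp, (hv.ofReal (K := ℂ)).coeFn_toLp] with x h1 h2
  rw [h1, h2]
  simp [mul_comm]

theorem norm_ft {u : E n → ℝ} (hu : MemLp u 2 volume) : ‖ft u‖ = (eLpNorm u 2 volume).toReal := by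
  rw [ft_of_memLp hu, Lp.norm_fourier_eq, Lp.norm_toLp]
  congr 1
  exact eLpNorm_congr_norm_ae (ae_of_all _ fun x => by simp)

theorem integral_schwartz_fourier (f : HC n) (φ : 𝓢(E n, ℂ)) :
    ∫ ξ, φ ξ • (𝓕 f : HC n) ξ = ∫ x, (𝓕 φ) x • f x := by
  have h := congrArg (fun T : TemperedDistribution (E n) ℂ => T φ)
    (Lp.fourier_toTemperedDistribution_eq f)
  simp only [TemperedDistribution.fourier_apply, Lp.toTemperedDistribution_apply] at h
  exact h.symm

/-- A square integrable function whose Fourier transform times `2 π i ξ_j` is square integrable has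
a weak partial derivative in `L²`. -/
theorem exists_hasWeakPartial {u : E n → ℝ} (hu : MemLp u 2 volume)
    (h : MemLp (fun ξ => sym1 j ξ * ft u ξ) 2 volume) :
    ∃ du, HasWeakPartial j u du ∧ MemLp du 2 volume := by
  set d : HC n := h.toLp with hd
  set D : HC n := 𝓕⁻ d with hD
  have hFD : (𝓕 D : HC n) = d := fourier_fourierInv_eq d
  -- The inverse transform D need not be shown to be real: u and the test functions are real, so the
  -- real part of the duality identity already exhibits Re D as the weak derivative.
  have hDm : MemLp (fun x => (D x).re) 2 volume := (Lp.memLp D).re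
  refine ⟨fun x => (D x).re, ⟨hu.locallyIntegrable one_le_two, hDm.locallyIntegrable one_le_two,
    fun φ hφ hc => ?_⟩, hDm⟩
  have hg₁ : HasCompactSupport (Complex.ofRealCLM ∘ φ) := hc.comp_left rfl
  have hg₂ : ContDiff ℝ ∞ (Complex.ofRealCLM ∘ φ) := by fun_prop
  set Φ : 𝓢(E n, ℂ) := hg₁.toSchwartzMap hg₂ with hΦ
  have hΦa : ∀ x, Φ x = (φ x : ℂ) := fun x => rfl
  have hΦd : ∀ x, (∂_{EuclideanSpace.single j (1 : ℝ)} Φ : 𝓢(E n, ℂ)) x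
      = (fderiv ℝ φ x (EuclideanSpace.single j 1) : ℂ) := by
    intro x
    have h1 : HasFDerivAt φ (fderiv ℝ φ x) x := (hφ.differentiable (by simp) x).hasFDerivAt
    have h2 : HasFDerivAt (fun x => Φ x) (Complex.ofRealCLM.comp (fderiv ℝ φ x)) x :=
      Complex.ofRealCLM.hasFDerivAt.comp x h1
    rw [SchwartzMap.lineDerivOp_apply_eq_fderiv, h2.fderiv]
    rfl
  have hinv : 𝓕 (𝓕⁻ Φ) = Φ := fourier_fourierInv_eq Φ
  have ht : (inner ℝ · (EuclideanSpace.single j (1 : ℝ)) : E n → ℝ).HasTemperateGrowth := by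
    fun_prop
  have main : ∫ x, (∂_{EuclideanSpace.single j (1 : ℝ)} Φ : 𝓢(E n, ℂ)) x • (u x : ℂ)
      = -∫ x, Φ x • D x := by
    rw [← hinv, SchwartzMap.lineDerivOp_fourier_eq, ← integral_schwartz_ft hu,
      ← integral_schwartz_fourier, hFD, ← integral_neg]
    refine integral_congr_ae ?_
    filter_upwards [h.coeFn_toLp] with ξ hξ
    have e : (-(2 * Real.pi * Complex.I) • smulLeftCLM ℂ
        (inner ℝ · (EuclideanSpace.single j (1 : ℝ))) (𝓕⁻ Φ)) ξ
        = -(2 * Real.pi * Complex.I) * ((ξ j : ℂ) * (𝓕⁻ Φ) ξ) := by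
      rw [_root_.smul_apply, smulLeftCLM_apply_apply ht]
      simp [EuclideanSpace.inner_single_right]
    rw [hd, hξ, e]
    simp only [sym1, smul_eq_mul]
    ring
  have i2 : Integrable (fun x => Φ x • D x) volume := (Φ.memLp 2 volume).integrable_mul (Lp.memLp D)
  have hre := congrArg Complex.re main
  have e1 : ∀ x, (∂_{EuclideanSpace.single j (1 : ℝ)} Φ : 𝓢(E n, ℂ)) x • (u x : ℂ)
      = ((u x * fderiv ℝ φ x (EuclideanSpace.single j 1) : ℝ) : ℂ) := by
    intro x
    rw [hΦd, smul_eq_mul]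
    push_cast
    ring
  simp only [e1] at hre
  rw [integral_complex_ofReal, Complex.ofReal_re, Complex.neg_re] at hre
  have e2 := Complex.reCLM.integral_comp_comm i2
  simp only [Complex.reCLM_apply] at e2
  rw [← e2] at hre
  rw [hre]
  congr 1
  refine integral_congr_ae (ae_of_all _ fun x => ?_)
  simp [hΦa, mul_comm]

theorem weakPartial_of_memLp_sym {u : E n → ℝ} (hu : MemLp u 2 volume)
    (h : MemLp (fun ξ => sym1 j ξ * ft u ξ) 2 volume) :
    WeaklyDiff j u ∧ MemLp (wpartial j u) 2 volume
      ∧ ft (wpartial j u) =ᵐ[volume] fun ξ => sym1 j ξ * ft u ξ := by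
  obtain ⟨du, hdu, hm⟩ := exists_hasWeakPartial hu h
  have hm' : MemLp (wpartial j u) 2 volume := (memLp_congr_ae hdu.wpartial_ae).2 hm
  exact ⟨hdu.weaklyDiff, hm', hdu.weaklyDiff.hasWeakPartial.ft_eq hu hm'⟩

end FourierL2

/-! ### Symbols of iterated derivatives. -/

section Symbols

variable {n : ℕ}

/-- The symbol of the iterated partial derivative `∂_{i₁} ⋯ ∂_{i_κ}`. -/
noncomputable def symI {κ : ℕ} (I : Fin κ → Fin n) (ξ : E n) : ℂ := ∏ i, sym1 (I i) ξ

theorem symI_succ {κ : ℕ} (I : Fin (κ + 1) → Fin n) (ξ : E n) :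
    symI I ξ = sym1 (I 0) ξ * symI (Fin.tail I) ξ := by
  unfold symI
  rw [Fin.prod_univ_succ]
  rfl

theorem continuous_symI {κ : ℕ} (I : Fin κ → Fin n) : Continuous (symI I) :=
  continuous_finsetProd _ fun i _ => continuous_sym1 (I i)

/-- The modulus `2 π |ξ|` of the symbol of the gradient. -/
noncomputable def rad (ξ : E n) : ℝ := 2 * Real.pi * ‖ξ‖

theorem continuous_rad : Continuous (rad : E n → ℝ) := by unfold rad; fun_prop

theorem rad_nonneg (ξ : E n) : 0 ≤ rad ξ := by unfold rad; positivity

theorem norm_sym1_sq (j : Fin n) (ξ : E n) : ‖sym1 j ξ‖ ^ 2 = (2 * Real.pi) ^ 2 * (ξ j) ^ 2 := by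
  unfold sym1
  simp only [norm_mul, Complex.norm_real, Complex.norm_I, Complex.norm_ofNat, mul_pow,
    Real.norm_eq_abs, sq_abs]
  ring

theorem sum_norm_sym1_sq (ξ : E n) : ∑ j, ‖sym1 j ξ‖ ^ 2 = rad ξ ^ 2 := by
  simp only [norm_sym1_sq, ← Finset.mul_sum, rad, mul_pow]
  rw [EuclideanSpace.norm_sq_eq]
  simp

theorem sum_sym1_sq (ξ : E n) : ∑ j, sym1 j ξ * sym1 j ξ = -((rad ξ : ℂ) ^ 2) := by
  have h : ∀ j : Fin n, sym1 j ξ * sym1 j ξ = -((‖sym1 j ξ‖ ^ 2 : ℝ) : ℂ) := by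
    intro j
    rw [norm_sym1_sq]
    unfold sym1
    push_cast
    linear_combination (4 * (Real.pi : ℂ) ^ 2 * (ξ j : ℂ) ^ 2) * Complex.I_mul_I
  simp only [h, Finset.sum_neg_distrib]
  rw [← Complex.ofReal_sum, sum_norm_sym1_sq]
  push_cast
  rfl

/-- Expanding (∑_j |2πξ_j|²)^κ gives one summand for each index tuple. This identifies norms of the
full tensor ∇^κu with norms of |∇|^κu. -/
theorem sum_norm_symI_sq (κ : ℕ) (ξ : E n) :
    ∑ I : Fin κ → Fin n, ‖symI I ξ‖ ^ 2 = (rad ξ ^ κ) ^ 2 := by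
  simp only [symI, norm_prod, ← Finset.prod_pow]
  rw [← Fintype.piFinset_univ, ← Finset.prod_univ_sum (fun _ => Finset.univ)
    (fun (_ : Fin κ) (j : Fin n) => ‖sym1 j ξ‖ ^ 2)]
  simp only [sum_norm_sym1_sq, Finset.prod_const, Finset.card_univ, Fintype.card_fin]
  rw [← pow_mul, ← pow_mul, mul_comm]

end Symbols


/-! ### Functions with a symbol, and the energies as norms in frequency. -/

section HasSymbol

variable {n : ℕ}

/-- No differentiability is required, since both sides take the default value 0 when there is no
weak derivative. -/
theorem wpartial_congr {j : Fin n} {u v : E n → ℝ} (h : u =ᵐ[volume] v) :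
    wpartial j u =ᵐ[volume] wpartial j v := by
  by_cases hu : WeaklyDiff j u
  · exact (hu.hasWeakPartial.congr h EventuallyEq.rfl).wpartial_ae.symm
  · have hv : ¬ WeaklyDiff j v := fun hv =>
      hu (hv.hasWeakPartial.congr h.symm EventuallyEq.rfl).weaklyDiff
    unfold wpartial
    rw [dif_neg hu, dif_neg hv]

theorem WeaklyDiff.congr {j : Fin n} {u v : E n → ℝ} (hu : WeaklyDiff j u)
    (h : u =ᵐ[volume] v) : WeaklyDiff j v :=
  (hu.hasWeakPartial.congr h EventuallyEq.rfl).weaklyDiff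

theorem wgrad_congr {u v : E n → ℝ} (h : u =ᵐ[volume] v) :
    ∀ (κ : ℕ) (I : Fin κ → Fin n), wgrad κ u I =ᵐ[volume] wgrad κ v I
  | 0, _ => h
  | κ + 1, I => wpartial_congr (wgrad_congr h κ (Fin.tail I))

theorem wgrad_add {u v : E n → ℝ} {m : ℕ}
    (hu : ∀ κ, κ < m → ∀ (I : Fin κ → Fin n) (j : Fin n), WeaklyDiff j (wgrad κ u I))
    (hv : ∀ κ, κ < m → ∀ (I : Fin κ → Fin n) (j : Fin n), WeaklyDiff j (wgrad κ v I)) :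
    ∀ κ, κ ≤ m → ∀ I : Fin κ → Fin n, wgrad κ (u + v) I =ᵐ[volume] wgrad κ u I + wgrad κ v I
  | 0, _, _ => EventuallyEq.rfl
  | κ + 1, h, I => by
    have ih := wgrad_add hu hv κ (by omega) (Fin.tail I)
    exact (wpartial_congr ih).trans (((hu κ (by omega) (Fin.tail I) (I 0)).hasWeakPartial.add
      (hv κ (by omega) (Fin.tail I) (I 0)).hasWeakPartial).wpartial_ae)

theorem wgrad_smul {u : E n → ℝ} {m : ℕ} (a : ℝ)
    (hu : ∀ κ, κ < m → ∀ (I : Fin κ → Fin n) (j : Fin n), WeaklyDiff j (wgrad κ u I)) :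
    ∀ κ, κ ≤ m → ∀ I : Fin κ → Fin n, wgrad κ (a • u) I =ᵐ[volume] a • wgrad κ u I
  | 0, _, _ => EventuallyEq.rfl
  | κ + 1, h, I => by
    have ih := wgrad_smul a hu κ (by omega) (Fin.tail I)
    exact (wpartial_congr ih).trans
      (((hu κ (by omega) (Fin.tail I) (I 0)).hasWeakPartial.const_smul a).wpartial_ae)

/-- The weak derivatives of `u` of orders `a, …, m` are in `L²`, and their Fourier transforms are
given by the symbols of the derivatives times `q`. -/
structure HasSymbol (a m : ℕ) (u : E n → ℝ) (q : E n → ℂ) : Prop where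
  loc : LocallyIntegrable u volume
  meas : AEStronglyMeasurable q volume
  diff : ∀ κ, κ < m → ∀ (I : Fin κ → Fin n) (j : Fin n), WeaklyDiff j (wgrad κ u I)
  memLp : ∀ κ, a ≤ κ → κ ≤ m → ∀ I : Fin κ → Fin n, MemLp (wgrad κ u I) 2 volume
  ft_eq : ∀ κ, a ≤ κ → κ ≤ m → ∀ I : Fin κ → Fin n,
    ft (wgrad κ u I) =ᵐ[volume] fun ξ => symI I ξ * q ξ

theorem HasSymbol.mono {a m a' m' : ℕ} {u : E n → ℝ} {q : E n → ℂ} (h : HasSymbol a m u q)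
    (ha : a ≤ a') (hm : m' ≤ m) : HasSymbol a' m' u q where
  loc := h.loc
  meas := h.meas
  diff κ hκ := h.diff κ (by omega)
  memLp κ h1 h2 := h.memLp κ (by omega) (by omega)
  ft_eq κ h1 h2 := h.ft_eq κ (by omega) (by omega)

theorem HasSymbol.add {a m : ℕ} {u v : E n → ℝ} {q r : E n → ℂ} (hu : HasSymbol a m u q)
    (hv : HasSymbol a m v r) : HasSymbol a m (u + v) (q + r) where
  loc := hu.loc.add hv.loc
  meas := hu.meas.add hv.meas
  diff κ hκ I j := by
    have e := wgrad_add hu.diff hv.diff κ hκ.le I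
    exact (((hu.diff κ hκ I j).hasWeakPartial.add
      (hv.diff κ hκ I j).hasWeakPartial).weaklyDiff).congr e.symm
  memLp κ h1 h2 I := (memLp_congr_ae (wgrad_add hu.diff hv.diff κ h2 I)).2
    ((hu.memLp κ h1 h2 I).add (hv.memLp κ h1 h2 I))
  ft_eq κ h1 h2 I := by
    rw [ft_congr (wgrad_add hu.diff hv.diff κ h2 I),
      ft_add (hu.memLp κ h1 h2 I) (hv.memLp κ h1 h2 I)]
    filter_upwards [Lp.coeFn_add (ft (wgrad κ u I)) (ft (wgrad κ v I)), hu.ft_eq κ h1 h2 I,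
      hv.ft_eq κ h1 h2 I] with ξ e1 e2 e3
    rw [e1, Pi.add_apply, e2, e3, Pi.add_apply, mul_add]

theorem HasSymbol.smul {a m : ℕ} {u : E n → ℝ} {q : E n → ℂ} (hu : HasSymbol a m u q) (c : ℝ) :
    HasSymbol a m (c • u) (c • q) where
  loc := hu.loc.smul c
  meas := hu.meas.const_smul c
  diff κ hκ I j := by
    have e := wgrad_smul c hu.diff κ hκ.le I
    exact (((hu.diff κ hκ I j).hasWeakPartial.const_smul c).weaklyDiff).congr e.symm
  memLp κ h1 h2 I := (memLp_congr_ae (wgrad_smul c hu.diff κ h2 I)).2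
    ((hu.memLp κ h1 h2 I).const_smul c)
  ft_eq κ h1 h2 I := by
    rw [ft_congr (wgrad_smul c hu.diff κ h2 I), ft_smul (hu.memLp κ h1 h2 I)]
    filter_upwards [Lp.coeFn_smul c (ft (wgrad κ u I)), hu.ft_eq κ h1 h2 I] with ξ e1 e2
    rw [e1, Pi.smul_apply, e2, Pi.smul_apply, mul_smul_comm]

theorem HasSymbol.sub {a m : ℕ} {u v : E n → ℝ} {q r : E n → ℂ} (hu : HasSymbol a m u q)
    (hv : HasSymbol a m v r) : HasSymbol a m (u - v) (q - r) := by
  have := hu.add (hv.smul (-1))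
  simpa [sub_eq_add_neg] using this

/-- Extension of a symbol from the lowest order to all orders. -/
theorem hasSymbol_of_base {a m : ℕ} {u : E n → ℝ} {q : E n → ℂ} (loc : LocallyIntegrable u volume)
    (meas : AEStronglyMeasurable q volume)
    (diff : ∀ κ, κ < m → ∀ (I : Fin κ → Fin n) (j : Fin n), WeaklyDiff j (wgrad κ u I))
    (memLp : ∀ κ, a ≤ κ → κ ≤ m → ∀ I : Fin κ → Fin n, MemLp (wgrad κ u I) 2 volume)
    (base : ∀ I : Fin a → Fin n, ft (wgrad a u I) =ᵐ[volume] fun ξ => symI I ξ * q ξ) :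
    HasSymbol a m u q where
  loc := loc
  meas := meas
  diff := diff
  memLp := memLp
  ft_eq κ h1 := by
    induction κ, h1 using Nat.le_induction with
    | base => exact fun _ => base
    | succ κ h1 ih =>
      intro h2 I
      have e := ih (by omega) (Fin.tail I)
      have hd := (diff κ (by omega) (Fin.tail I) (I 0)).hasWeakPartial
      have := hd.ft_eq (memLp κ h1 (by omega) (Fin.tail I)) (memLp (κ + 1) (by omega) h2 I)
      refine EventuallyEq.trans this ?_
      filter_upwards [e] with ξ hξ
      rw [hξ, symI_succ, mul_assoc]

theorem MemSobolev.memLp {m : ℕ} {u : E n → ℝ} (h : MemSobolev m u) : MemLp u 2 volume :=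
  h.2 0 (Nat.zero_le _) Fin.elim0

theorem MemSobolev.hasSymbol {m : ℕ} {u : E n → ℝ} (h : MemSobolev m u) :
    HasSymbol 0 m u (ft u) :=
  hasSymbol_of_base (h.memLp.locallyIntegrable one_le_two) (Lp.memLp _).aestronglyMeasurable h.1
    (fun κ _ => h.2 κ) (fun I => ae_of_all _ fun ξ => by simp [symI, wgrad])

theorem ae_rad_ne_zero (hn : 0 < n) : ∀ᵐ ξ : E n, rad ξ ≠ 0 := by
  have : NeZero n := ⟨hn.ne'⟩
  have : ∀ᵐ ξ : E n, ξ ≠ 0 := by simp [ae_iff, measure_singleton]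
  filter_upwards [this] with ξ hξ
  have := norm_pos_iff.2 hξ
  unfold rad
  positivity

/-- A function whose gradient is in `H^{m-1}` has a symbol. -/
theorem MemHomSobolev.exists_hasSymbol {m : ℕ} (hm : 2 ≤ m) {u : E n → ℝ}
    (h : MemHomSobolev m u) : ∃ q, HasSymbol 1 m u q := by
  let X : Fin n → E n → ℂ := fun j => ft (wpartial j u)
  have h1 : ∀ j, MemLp (wpartial j u) 2 volume := fun j => h.2.2 1 le_rfl (by omega) fun _ => j
  have h2 : ∀ i j, MemLp (wpartial i (wpartial j u)) 2 volume := fun i j =>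
    h.2.2 2 (by omega) hm (Fin.cons i fun _ => j)
  have d1 : ∀ j, HasWeakPartial j u (wpartial j u) := fun j =>
    (h.2.1 0 (by omega) Fin.elim0 j).hasWeakPartial
  have d2 : ∀ i j, HasWeakPartial i (wpartial j u) (wpartial i (wpartial j u)) := fun i j =>
    (h.2.1 1 (by omega) (fun _ => j) i).hasWeakPartial
  -- The gradient is curl-free on the Fourier side, because second weak derivatives commute.
  have curl : ∀ i j, ∀ᵐ ξ : E n, sym1 i ξ * X j ξ = sym1 j ξ * X i ξ := by
    intro i j
    have e1 := (d2 i j).ft_eq (h1 j) (h2 i j)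
    have e2 := (d2 j i).ft_eq (h1 i) (h2 j i)
    have e3 := ft_congr (((d1 j).swap (d1 i) (d2 i j)).ae_unique (d2 j i))
    rw [e3] at e1
    filter_upwards [e1, e2] with ξ a1 a2
    exact a1.symm.trans a2
  have meas : AEStronglyMeasurable (fun ξ => -(∑ j, sym1 j ξ * X j ξ) / ((rad ξ : ℂ) ^ 2))
      volume := by
    have hc : AEStronglyMeasurable (fun ξ : E n => ((rad ξ : ℂ) ^ 2)⁻¹) volume :=
      (((Complex.continuous_ofReal.comp continuous_rad).pow 2).measurable.inv).aestronglyMeasurable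
    simp only [div_eq_mul_inv]
    refine AEStronglyMeasurable.mul (AEStronglyMeasurable.neg ?_) hc
    refine Finset.aestronglyMeasurable_fun_sum _ fun j _ => ?_
    exact (continuous_sym1 j).aestronglyMeasurable.mul (Lp.memLp _).aestronglyMeasurable
  -- Formally this is the transform of Δ⁻¹ div ∇u. The curl relation shows that its gradient symbol
  -- returns each X_j away from ξ = 0, a null set.
  refine ⟨fun ξ => -(∑ j, sym1 j ξ * X j ξ) / ((rad ξ : ℂ) ^ 2),
    hasSymbol_of_base h.1 meas h.2.1 h.2.2 fun I => ?_⟩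
  have hall : ∀ᵐ ξ : E n, ∀ j, sym1 (I 0) ξ * X j ξ = sym1 j ξ * X (I 0) ξ :=
    ae_all_iff.2 fun j => curl _ _
  filter_upwards [hall, ae_rad_ne_zero (Fin.pos (I 0))] with ξ hξ hr
  have hr' : (rad ξ : ℂ) ^ 2 ≠ 0 := pow_ne_zero 2 (Complex.ofReal_ne_zero.2 hr)
  have e : symI I ξ = sym1 (I 0) ξ := by simp [symI]
  change X (I 0) ξ = _
  rw [e, mul_div_assoc', eq_div_iff hr', mul_neg, Finset.mul_sum]
  have : ∀ j, sym1 (I 0) ξ * (sym1 j ξ * X j ξ) = sym1 j ξ * sym1 j ξ * X (I 0) ξ := by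
    intro j
    rw [mul_left_comm, hξ j, mul_assoc]
  simp only [this, ← Finset.sum_mul, sum_sym1_sq]
  ring

open Classical in
/-- The class in `L²` of a function; zero if the function is not in `L²`. -/
noncomputable def toL2 (f : E n → ℂ) : HC n := if h : MemLp f 2 volume then h.toLp else 0

theorem toL2_coe {f : E n → ℂ} (h : MemLp f 2 volume) : toL2 f =ᵐ[volume] f := by
  unfold toL2
  rw [dif_pos h]
  exact h.coeFn_toLp

/-- The class of `(2 π |ξ|)^κ q(ξ)`. -/
noncomputable def radL2 (κ : ℕ) (q : E n → ℂ) : HC n := toL2 fun ξ => (rad ξ : ℂ) ^ κ * q ξ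

/-- Summing |symI|²|q|² over all index tuples gives |rad^κ q|². Integrability of q itself is neither
available nor used when a = 1. -/
theorem HasSymbol.memLp_rad {a m κ : ℕ} {u : E n → ℝ} {q : E n → ℂ} (h : HasSymbol a m u q)
    (h1 : a ≤ κ) (h2 : κ ≤ m) : MemLp (fun ξ => (rad ξ : ℂ) ^ κ * q ξ) 2 volume := by
  have hm : AEStronglyMeasurable (fun ξ => (rad ξ : ℂ) ^ κ * q ξ) volume :=
    ((Complex.continuous_ofReal.comp continuous_rad).pow κ).aestronglyMeasurable.mul h.meas
  rw [memLp_two_iff_integrable_sq_norm hm]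
  have : Integrable (fun ξ => ∑ I : Fin κ → Fin n, ‖ft (wgrad κ u I) ξ‖ ^ 2) volume :=
    integrable_finsetSum _ fun I _ =>
      (memLp_two_iff_integrable_sq_norm (Lp.memLp _).aestronglyMeasurable).1 (Lp.memLp _)
  refine this.congr ?_
  have hall : ∀ᵐ ξ, ∀ I : Fin κ → Fin n, ft (wgrad κ u I) ξ = symI I ξ * q ξ :=
    ae_all_iff.2 fun I => h.ft_eq κ h1 h2 I
  filter_upwards [hall] with ξ hξ
  simp only [hξ, norm_mul, mul_pow, ← Finset.sum_mul, sum_norm_symI_sq]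
  simp [abs_of_nonneg (rad_nonneg ξ)]

theorem HasSymbol.radL2_coe {a m κ : ℕ} {u : E n → ℝ} {q : E n → ℂ} (h : HasSymbol a m u q)
    (h1 : a ≤ κ) (h2 : κ ≤ m) : radL2 κ q =ᵐ[volume] fun ξ => (rad ξ : ℂ) ^ κ * q ξ :=
  toL2_coe (h.memLp_rad h1 h2)

theorem inner_mul_left_eq (z a b : ℂ) :
    (inner ℝ (z * a) (z * b) : ℝ) = ‖z‖ ^ 2 * inner ℝ a b := by
  rw [← Complex.normSq_eq_norm_sq, Complex.normSq_apply]
  simp only [Complex.inner, map_mul, Complex.mul_re, Complex.mul_im, Complex.conj_re,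
    Complex.conj_im]
  ring

/-- Plancherel for tensors. The components of both factors share the multipliers s_i, so only
∑|s_i|² survives in the pairing; one statement covers ∇^κ and Δ∇^κ. -/
theorem sum_integral_symbol {ι : Type*} [Fintype ι] {κ : ℕ} {s : ι → E n → ℂ}
    {U V : ι → E n → ℝ} {q r : E n → ℂ} {Q R : HC n}
    (hU : ∀ i, MemLp (U i) 2 volume) (hV : ∀ i, MemLp (V i) 2 volume)
    (hUq : ∀ i, ft (U i) =ᵐ[volume] fun ξ => s i ξ * q ξ)
    (hVr : ∀ i, ft (V i) =ᵐ[volume] fun ξ => s i ξ * r ξ)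
    (hs : ∀ ξ, ∑ i, ‖s i ξ‖ ^ 2 = (rad ξ ^ κ) ^ 2)
    (hQ : Q =ᵐ[volume] fun ξ => (rad ξ : ℂ) ^ κ * q ξ)
    (hR : R =ᵐ[volume] fun ξ => (rad ξ : ℂ) ^ κ * r ξ) :
    ∑ i, ∫ x, U i x * V i x = inner ℝ Q R := by
  have e : ∀ i, ∫ x, U i x * V i x = ∫ ξ, (inner ℝ (ft (U i) ξ) (ft (V i) ξ) : ℝ) := fun i => by
    rw [← inner_ft (hU i) (hV i), inner_HC]
  simp only [e]
  rw [← integral_finsetSum _ fun i _ => L2.integrable_inner (𝕜 := ℝ) _ _, inner_HC]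
  refine integral_congr_ae ?_
  filter_upwards [ae_all_iff.2 hUq, ae_all_iff.2 hVr, hQ, hR] with ξ h1 h2 h3 h4
  simp only [h1, h2, h3, h4, inner_mul_left_eq, ← Finset.sum_mul, hs]
  simp [abs_of_nonneg (rad_nonneg ξ)]

theorem HasSymbol.sum_integral_wgrad {a m a' m' κ : ℕ} {u v : E n → ℝ} {q r : E n → ℂ}
    (hu : HasSymbol a m u q) (hv : HasSymbol a' m' v r) (h1 : a ≤ κ) (h2 : κ ≤ m) (h1' : a' ≤ κ)
    (h2' : κ ≤ m') :
    ∑ I : Fin κ → Fin n, ∫ x, wgrad κ u I x * wgrad κ v I x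
      = inner ℝ (radL2 κ q) (radL2 κ r) :=
  sum_integral_symbol (hu.memLp κ h1 h2) (hv.memLp κ h1' h2') (hu.ft_eq κ h1 h2)
    (hv.ft_eq κ h1' h2') (sum_norm_symI_sq κ) (hu.radL2_coe h1 h2) (hv.radL2_coe h1' h2')

theorem HasSymbol.gradSq_eq {a m κ : ℕ} {u : E n → ℝ} {q : E n → ℂ} (hu : HasSymbol a m u q)
    (h1 : a ≤ κ) (h2 : κ ≤ m) : gradSq κ u = ‖radL2 κ q‖ ^ 2 := by
  rw [← real_inner_self_eq_norm_sq, ← hu.sum_integral_wgrad hu h1 h2 h1 h2]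
  simp only [gradSq, sq]

theorem HasSymbol.memLp_wlap {a m κ : ℕ} {u : E n → ℝ} {q : E n → ℂ} (hu : HasSymbol a m u q)
    (h1 : a ≤ κ + 2) (h2 : κ + 2 ≤ m) (I : Fin κ → Fin n) :
    MemLp (wlap (wgrad κ u I)) 2 volume ∧
      ft (wlap (wgrad κ u I)) =ᵐ[volume] fun ξ => -((rad ξ : ℂ) ^ 2) * symI I ξ * q ξ := by
  let U : Fin n → E n → ℝ := fun j => wpartial j (wpartial j (wgrad κ u I))
  have hU : ∀ j, MemLp (U j) 2 volume := fun j =>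
    hu.memLp (κ + 2) h1 h2 (Fin.cons j (Fin.cons j I))
  have hUf : ∀ j, ft (U j) =ᵐ[volume] fun ξ => sym1 j ξ * sym1 j ξ * (symI I ξ * q ξ) := by
    intro j
    have := hu.ft_eq (κ + 2) h1 h2 (Fin.cons j (Fin.cons j I))
    refine EventuallyEq.trans this (ae_of_all _ fun ξ => ?_)
    simp only [symI_succ, Fin.cons_zero, Fin.tail_cons]
    ring
  -- Integrability is carried through the induction because additivity of `ft` requires it.
  have key : ∀ s : Finset (Fin n), MemLp (∑ j ∈ s, U j) 2 volume ∧
      ft (∑ j ∈ s, U j) =ᵐ[volume] fun ξ => (∑ j ∈ s, sym1 j ξ * sym1 j ξ) * (symI I ξ * q ξ) := by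
    classical
    intro s
    induction s using Finset.induction_on with
    | empty =>
      refine ⟨by simp, ?_⟩
      have : ft (0 : E n → ℝ) = 0 := by
        have := ft_smul (MemLp.zero' : MemLp (0 : E n → ℝ) 2 volume) 0
        simpa using this
      simp only [Finset.sum_empty, this]
      filter_upwards [Lp.coeFn_zero ℂ 2 (volume : Measure (E n))] with ξ hξ
      rw [hξ]; simp
    | insert j s hj ih =>
      rw [Finset.sum_insert hj]
      refine ⟨(hU j).add ih.1, ?_⟩
      rw [ft_add (hU j) ih.1]
      filter_upwards [Lp.coeFn_add (ft (U j)) (ft (∑ j ∈ s, U j)), hUf j, ih.2] with ξ e1 e2 e3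
      rw [e1, Pi.add_apply, e2, e3, Finset.sum_insert hj]
      ring
  have e : wlap (wgrad κ u I) = ∑ j ∈ Finset.univ, U j := by
    ext x; simp [wlap, U]
  rw [e]
  refine ⟨(key _).1, EventuallyEq.trans (key _).2 (ae_of_all _ fun ξ => ?_)⟩
  simp only [sum_sym1_sq]
  ring

/-- Since Δ has symbol -rad², the norms of Δ∇^κu and ∇^{κ+2}u coincide. -/
theorem HasSymbol.lapGradSq_eq {a m κ : ℕ} {u : E n → ℝ} {q : E n → ℂ} (hu : HasSymbol a m u q)
    (h1 : a ≤ κ + 2) (h2 : κ + 2 ≤ m) : lapGradSq κ u = ‖radL2 (κ + 2) q‖ ^ 2 := by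
  rw [← real_inner_self_eq_norm_sq, ← sum_integral_symbol (s := fun I : Fin κ → Fin n =>
    fun ξ => -((rad ξ : ℂ) ^ 2) * symI I ξ) (κ := κ + 2) (fun I => (hu.memLp_wlap h1 h2 I).1)
    (fun I => (hu.memLp_wlap h1 h2 I).1) (fun I => (hu.memLp_wlap h1 h2 I).2)
    (fun I => (hu.memLp_wlap h1 h2 I).2) (fun ξ => ?_) (hu.radL2_coe h1 h2) (hu.radL2_coe h1 h2)]
  · simp only [lapGradSq, sq]
  · simp only [norm_mul, norm_neg, mul_pow, ← Finset.mul_sum, sum_norm_symI_sq]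
    simp [abs_of_nonneg (rad_nonneg ξ)]
    ring

theorem HasSymbol.pair0_eq {m a' m' κ : ℕ} {f v : E n → ℝ} {q r : E n → ℂ}
    (hf : HasSymbol 0 m f q) (hv : HasSymbol a' m' v r) (h2 : κ ≤ m) (h1' : a' ≤ κ)
    (h2' : κ ≤ m') : pair0 κ f (wgrad κ v) = inner ℝ (radL2 κ q) (radL2 κ r) :=
  hf.sum_integral_wgrad hv (Nat.zero_le _) h2 h1' h2'

/-- The extra index j becomes the first entry of a (κ+1)-tuple, matching the recursion in `wgrad`.
-/
theorem HasSymbol.pair1_eq {m a' m' κ : ℕ} {f v : E n → ℝ} {q r : E n → ℂ}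
    (hf : HasSymbol 0 m f q) (hv : HasSymbol a' m' v r) (h2 : κ + 1 ≤ m) (h1' : a' ≤ κ + 1)
    (h2' : κ + 1 ≤ m') :
    pair1 κ f (wgrad κ v) = inner ℝ (radL2 (κ + 1) q) (radL2 (κ + 1) r) := by
  rw [← hf.sum_integral_wgrad hv (Nat.zero_le _) h2 h1' h2', pair1]
  rw [← (Fin.consEquiv fun _ : Fin (κ + 1) => Fin n).sum_comp]
  rw [Fintype.sum_prod_type_right]
  refine Finset.sum_congr rfl fun I _ => Finset.sum_congr rfl fun j _ => ?_
  rfl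

theorem HasSymbol.pair1_smul_eq {m a' m' κ : ℕ} {f v : E n → ℝ} {q r : E n → ℂ} (τ : ℝ)
    (hf : HasSymbol 0 m f q) (hv : HasSymbol a' m' v r) (h2 : κ + 1 ≤ m) (h1' : a' ≤ κ + 1)
    (h2' : κ + 1 ≤ m') :
    pair1 κ f (τ • wgrad κ v) = inner ℝ (radL2 (κ + 1) q) (τ • radL2 (κ + 1) r) := by
  rw [inner_smul_right, ← hf.pair1_eq hv h2 h1' h2', pair1, pair1, Finset.mul_sum]
  refine Finset.sum_congr rfl fun I _ => ?_
  rw [Finset.mul_sum]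
  refine Finset.sum_congr rfl fun j _ => ?_
  rw [← integral_const_mul]
  have e := ((hv.diff κ (by omega) I j).hasWeakPartial.const_smul τ).wpartial_ae
  refine integral_congr_ae ?_
  filter_upwards [e] with x hx
  rw [Pi.smul_apply, hx, Pi.smul_apply, smul_eq_mul]
  ring

end HasSymbol


/-! ### Convolutions and the Fourier transform of a product. -/

section Product

open FourierTransform SchwartzMap ENNReal

variable {n : ℕ}

/-- Cauchy–Schwarz with respect to the measure P dμ. -/
theorem lintegral_mul_sq_le {α : Type*} [MeasurableSpace α] {μ : Measure α} {P F : α → ℝ≥0∞}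
    (hP : Measurable P) (hF : Measurable F) :
    (∫⁻ t, P t * F t ∂μ) ^ 2 ≤ (∫⁻ t, P t ∂μ) * ∫⁻ t, P t * F t ^ 2 ∂μ := by
  have h := ENNReal.lintegral_mul_norm_pow_le (μ := μ) hP.aemeasurable
    (hP.mul (hF.pow_const 2)).aemeasurable (p := 1 / 2) (q := 1 / 2) (by norm_num) (by norm_num)
    (by norm_num)
  have e : ∀ t, P t ^ (1 / 2 : ℝ) * (P * fun x => F x ^ 2) t ^ (1 / 2 : ℝ) = P t * F t := by
    intro t
    rw [← ENNReal.mul_rpow_of_nonneg _ _ (by norm_num)]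
    have : P t * (P * fun x => F x ^ 2) t = (P t * F t) ^ (2 : ℝ) := by
      simp only [Pi.mul_apply, ENNReal.rpow_two]; ring
    rw [this, ← ENNReal.rpow_mul]
    norm_num
  simp only [e] at h
  calc (∫⁻ t, P t * F t ∂μ) ^ 2
      ≤ ((∫⁻ t, P t ∂μ) ^ (1 / 2 : ℝ) * (∫⁻ t, P t * F t ^ 2 ∂μ) ^ (1 / 2 : ℝ)) ^ 2 := by
        gcongr
        simpa using h
    _ = _ := by
        rw [mul_pow, ← ENNReal.rpow_two, ← ENNReal.rpow_two, ← ENNReal.rpow_mul,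
          ← ENNReal.rpow_mul]
        norm_num

/-- Young's inequality L¹ ∗ L² ⊂ L², from weighted Cauchy–Schwarz, Tonelli and translation
invariance. -/
theorem lintegral_conv_sq_le {P Q : E n → ℝ≥0∞} (hP : Measurable P) (hQ : Measurable Q) :
    ∫⁻ x, (∫⁻ t, P t * Q (x - t)) ^ 2 ≤ (∫⁻ t, P t) ^ 2 * ∫⁻ t, Q t ^ 2 := by
  calc ∫⁻ x, (∫⁻ t, P t * Q (x - t)) ^ 2
      ≤ ∫⁻ x, (∫⁻ t, P t) * ∫⁻ t, P t * Q (x - t) ^ 2 :=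
        lintegral_mono fun x => lintegral_mul_sq_le hP (hQ.comp (measurable_const.sub measurable_id))
    _ = (∫⁻ t, P t) * ∫⁻ x, ∫⁻ t, P t * Q (x - t) ^ 2 := by
        refine lintegral_const_mul _ ?_
        refine Measurable.lintegral_prod_right' (f := fun p : E n × E n => P p.2 * Q (p.1 - p.2) ^ 2) ?_
        exact (hP.comp measurable_snd).mul
          ((hQ.comp (measurable_fst.sub measurable_snd)).pow_const 2)
    _ = (∫⁻ t, P t) * ∫⁻ t, ∫⁻ x, P t * Q (x - t) ^ 2 := by
        rw [lintegral_lintegral_swap]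
        exact ((hP.comp measurable_snd).mul
          ((hQ.comp (measurable_fst.sub measurable_snd)).pow_const 2)).aemeasurable
    _ = (∫⁻ t, P t) * ∫⁻ t, P t * ∫⁻ x, Q x ^ 2 := by
        congr 1
        refine lintegral_congr fun t => ?_
        rw [lintegral_const_mul _ (f := fun x => Q (x - t) ^ 2)
          ((hQ.comp (measurable_id.sub measurable_const)).pow_const 2)]
        congr 1
        exact lintegral_sub_right_eq_self (fun x => Q x ^ 2) t
    _ = _ := by rw [lintegral_mul_const _ hP]; ring

theorem eLpNorm_two_sq {F : Type*} [ENorm F] {α : Type*} [MeasurableSpace α]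
    {μ : Measure α} (f : α → F) : eLpNorm f 2 μ ^ 2 = ∫⁻ x, ‖f x‖ₑ ^ 2 ∂μ := by
  rw [eLpNorm_eq_lintegral_rpow_enorm_toReal (by norm_num) (by norm_num)]
  rw [← ENNReal.rpow_two, ← ENNReal.rpow_mul]
  simp

theorem integral_fourierInv_mul {r : E n → ℂ} (hr : Integrable r volume) (φ : 𝓢(E n, ℂ)) :
    ∫ x, φ x • 𝓕⁻ r x = ∫ ξ, (𝓕⁻ φ) ξ • r ξ := by
  have h := VectorFourier.integral_fourierIntegral_smul_eq_flip (L := -innerₗ (E n))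
    (μ := (volume : Measure (E n))) (ν := (volume : Measure (E n))) (e := Real.fourierChar)
    (f := φ) (g := r) Real.continuous_fourierChar (by
      exact (continuous_inner (𝕜 := ℝ) (E := E n)).neg) φ.integrable hr
  rw [SchwartzMap.fourierInv_coe]
  convert! h.symm using 3 with x ξ
  · congr 1
    rw [Real.fourierInv_eq]
    simp [VectorFourier.fourierIntegral, real_inner_comm]

theorem continuous_fourierInv {r : E n → ℂ} (hr : Integrable r volume) : Continuous (𝓕⁻ r) := by
  have e : 𝓕⁻ r = fun x => 𝓕 r (-x) := by ext x; exact Real.fourierInv_eq_fourier_neg r x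
  rw [e]
  exact (VectorFourier.fourierIntegral_continuous Real.continuous_fourierChar
    (by exact continuous_inner) hr).comp continuous_neg

/-- Inversion formula for square integrable functions with integrable Fourier transform. -/
theorem ae_eq_fourierInv {u : E n → ℝ} (hu : MemLp u 2 volume) (hi : Integrable (ft u) volume) :
    (fun x => (u x : ℂ)) =ᵐ[volume] 𝓕⁻ (ft u : E n → ℂ) := by
  refine ae_eq_of_integral_schwartz ((hu.ofReal (K := ℂ)).locallyIntegrable one_le_two)
    (continuous_fourierInv hi).locallyIntegrable fun φ => ?_
  rw [integral_fourierInv_mul hi, integral_schwartz_ft hu]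
  have hinv : 𝓕 (𝓕⁻ φ) = φ := fourier_fourierInv_eq φ
  rw [hinv]

theorem ft_eq_of_ae_eq_fourierInv {u : E n → ℝ} {r : E n → ℂ} (hu : MemLp u 2 volume)
    (hr : Integrable r volume) (h : (fun x => (u x : ℂ)) =ᵐ[volume] 𝓕⁻ r) :
    ft u =ᵐ[volume] r := by
  refine ae_eq_of_integral_schwartz ((Lp.memLp _).locallyIntegrable one_le_two)
    hr.locallyIntegrable fun φ => ?_
  have hinv : 𝓕⁻ (𝓕 φ) = φ := fourierInv_fourier_eq φ
  rw [integral_schwartz_ft hu]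
  conv_rhs => rw [← hinv]
  rw [← integral_fourierInv_mul hr]
  refine integral_congr_ae ?_
  filter_upwards [h] with x hx
  rw [hx]

/-- By inversion u is bounded almost everywhere by the L¹ norm of its transform. -/
theorem memLp_mul_of_integrable_ft {u v : E n → ℝ} (hu : MemLp u 2 volume) (hv : MemLp v 2 volume)
    (hi : Integrable (ft u) volume) : MemLp (u * v) 2 volume := by
  refine MemLp.of_le_mul (c := ∫ ξ, ‖ft u ξ‖) hv
    (hu.aestronglyMeasurable.mul hv.aestronglyMeasurable) ?_
  filter_upwards [ae_eq_fourierInv hu hi] with x hx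
  rw [Pi.mul_apply, norm_mul]
  gcongr
  have : ‖u x‖ = ‖𝓕⁻ (ft u : E n → ℂ) x‖ := by rw [← hx]; simp
  rw [this, Real.fourierInv_eq]
  refine (norm_integral_le_integral_norm _).trans (le_of_eq ?_)
  simp

/-- The Fourier transform of a product is the convolution of the Fourier transforms. -/
theorem ft_mul {u v : E n → ℝ} (hu : MemLp u 2 volume) (hv : MemLp v 2 volume)
    (hiu : Integrable (ft u) volume) (hiv : Integrable (ft v) volume) :
    ft (u * v) =ᵐ[volume] fun x => ∫ t, ft u t * ft v (x - t) := by
  have hr : Integrable (fun x => ∫ t, ft u t * ft v (x - t)) volume :=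
    hiu.integrable_convolution (ContinuousLinearMap.mul ℂ ℂ) hiv
  refine ft_eq_of_ae_eq_fourierInv (memLp_mul_of_integrable_ft hu hv hiu) hr ?_
  filter_upwards [ae_eq_fourierInv hu hiu, ae_eq_fourierInv hv hiv] with x h1 h2
  rw [Pi.mul_apply, Complex.ofReal_mul, h1, h2, Real.fourierInv_eq_fourier_neg,
    Real.fourierInv_eq_fourier_neg, Real.fourierInv_eq_fourier_neg,
    ← Real.fourier_mul_convolution_eq hiu hiv]
  rfl

end Product


/-! ### The algebra property of H^s for s > n/2. -/

section SobolevAlgebra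

open ENNReal

variable {n : ℕ}

/-- The weight `(1 + 2 π |ξ|)^s`. -/
noncomputable def jap (s : ℕ) (ξ : E n) : ℝ := (1 + rad ξ) ^ s

theorem jap_pos (s : ℕ) (ξ : E n) : 0 < jap s ξ := by
  have := rad_nonneg ξ
  unfold jap
  positivity

theorem continuous_jap (s : ℕ) : Continuous (jap s : E n → ℝ) := by
  unfold jap
  exact (continuous_const.add continuous_rad).pow s

theorem rad_pow_le_jap {κ s : ℕ} (h : κ ≤ s) (ξ : E n) : rad ξ ^ κ ≤ jap s ξ := by
  have := rad_nonneg ξ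
  calc rad ξ ^ κ ≤ (1 + rad ξ) ^ κ := by gcongr; linarith
    _ ≤ jap s ξ := pow_le_pow_right₀ (by linarith) h

theorem norm_symI_le {κ : ℕ} (I : Fin κ → Fin n) (ξ : E n) : ‖symI I ξ‖ ≤ rad ξ ^ κ := by
  have h := sum_norm_symI_sq (n := n) κ ξ
  refine le_of_sq_le_sq ?_ (pow_nonneg (rad_nonneg ξ) κ)
  rw [← h]
  exact Finset.single_le_sum (f := fun I : Fin κ → Fin n => ‖symI I ξ‖ ^ 2)
    (fun i _ => by positivity) (Finset.mem_univ I)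

theorem rad_pow_le_sum (κ : ℕ) (ξ : E n) : rad ξ ^ κ ≤ ∑ I : Fin κ → Fin n, ‖symI I ξ‖ := by
  refine le_of_sq_le_sq ?_ (Finset.sum_nonneg fun _ _ => norm_nonneg _)
  rw [← sum_norm_symI_sq (n := n) κ ξ]
  exact Finset.sum_sq_le_sq_sum_of_nonneg fun i _ => norm_nonneg _

theorem add_pow_le_two_pow {a b : ℝ} (ha : 0 ≤ a) (hb : 0 ≤ b) (s : ℕ) :
    (a + b) ^ s ≤ 2 ^ s * (a ^ s + b ^ s) := by
  have key : (a + b) ^ s ≤ (2 * max a b) ^ s := by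
    gcongr
    linarith [le_max_left a b, le_max_right a b]
  refine key.trans ?_
  rw [mul_pow]
  gcongr
  rcases max_cases a b with ⟨h, _⟩ | ⟨h, _⟩ <;> rw [h]
  · linarith [pow_nonneg hb s]
  · linarith [pow_nonneg ha s]

theorem jap_le (s : ℕ) (ξ : E n) : jap s ξ ≤ 2 ^ s * (1 + rad ξ ^ s) := by
  simpa [jap] using add_pow_le_two_pow zero_le_one (rad_nonneg ξ) s

/-- The weight of a product can be put on one factor at a time, because the frequencies t and x - t
add up to x. -/
theorem jap_le_add (s : ℕ) (x t : E n) : jap s x ≤ 2 ^ s * (jap s t + jap s (x - t)) := by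
  have h : rad x ≤ rad t + rad (x - t) := by
    unfold rad
    rw [← mul_add]
    gcongr
    simpa using norm_add_le t (x - t)
  have h1 := rad_nonneg t
  have h2 := rad_nonneg (x - t)
  have h3 := rad_nonneg x
  refine le_trans ?_ (add_pow_le_two_pow (add_nonneg zero_le_one h1) (add_nonneg zero_le_one h2) s)
  exact pow_le_pow_left₀ (by linarith) (by linarith) s

/-- The `H^s` norm, measured in the Fourier variables. -/
noncomputable def sobNorm (s : ℕ) (u : E n → ℝ) : ℝ≥0∞ :=
  eLpNorm (fun ξ => (jap s ξ : ℂ) * ft u ξ) 2 volume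

theorem measurable_ft (u : E n → ℝ) : Measurable (ft u) := (Lp.stronglyMeasurable _).measurable

theorem aestronglyMeasurable_jap_mul (s : ℕ) (u : E n → ℝ) :
    AEStronglyMeasurable (fun ξ => (jap s ξ : ℂ) * ft u ξ) volume :=
  (Complex.continuous_ofReal.comp (continuous_jap s)).aestronglyMeasurable.mul
    (Lp.memLp _).aestronglyMeasurable

theorem lintegral_inv_jap_lt_top {s : ℕ} (hs : (n : ℝ) < 2 * s) :
    ∫⁻ ξ : E n, ENNReal.ofReal ((jap s ξ)⁻¹) ^ 2 < ⊤ := by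
  have h := (integrable_one_add_norm (E := E n) (μ := volume) (r := 2 * s)
    (by simpa using hs)).lintegral_lt_top
  refine lt_of_le_of_lt (lintegral_mono fun ξ => ?_) h
  rw [← ENNReal.ofReal_pow (inv_nonneg.2 (jap_pos s ξ).le)]
  refine ENNReal.ofReal_le_ofReal ?_
  have hx := norm_nonneg ξ
  rw [Real.rpow_neg (by positivity), inv_pow]
  have e : (1 + ‖ξ‖) ^ (2 * s : ℝ) = ((1 + ‖ξ‖) ^ s) ^ 2 := by
    rw [← pow_mul, ← Real.rpow_natCast]; push_cast; ring_nf
  rw [e]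
  have h1 : ‖ξ‖ ≤ rad ξ := by unfold rad; nlinarith [Real.pi_gt_three]
  have h2 : (1 + ‖ξ‖) ^ s ≤ jap s ξ := pow_le_pow_left₀ (by positivity) (by linarith) s
  gcongr

/-- Cauchy–Schwarz against the inverse weight, which is square integrable exactly because 2s > n
enters `lintegral_inv_jap_lt_top`. -/
theorem exists_lintegral_ft_le {s : ℕ} (hs : (n : ℝ) < 2 * s) :
    ∃ K : ℝ≥0∞, K < ⊤ ∧ ∀ u : E n → ℝ, ∫⁻ ξ, ‖ft u ξ‖ₑ ≤ K * sobNorm s u := by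
  refine ⟨(∫⁻ ξ : E n, ENNReal.ofReal ((jap s ξ)⁻¹) ^ 2) ^ (1 / 2 : ℝ),
    ENNReal.rpow_lt_top_of_nonneg (by norm_num) (lintegral_inv_jap_lt_top hs).ne, fun u => ?_⟩
  have h := ENNReal.lintegral_mul_le_Lp_mul_Lq (volume : Measure (E n)) Real.HolderConjugate.two_two
    (f := fun ξ => ENNReal.ofReal ((jap s ξ)⁻¹)) (g := fun ξ => ‖(jap s ξ : ℂ) * ft u ξ‖ₑ)
    ((continuous_jap s).measurable.inv.ennreal_ofReal.aemeasurable)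
    (aestronglyMeasurable_jap_mul s u).enorm
  have e : ∀ ξ, ENNReal.ofReal ((jap s ξ)⁻¹) * ‖(jap s ξ : ℂ) * ft u ξ‖ₑ = ‖ft u ξ‖ₑ := by
    intro ξ
    have := jap_pos s ξ
    rw [← ofReal_norm, ← ofReal_norm, ← ENNReal.ofReal_mul (by positivity),
      norm_mul, Complex.norm_real, Real.norm_of_nonneg this.le, inv_mul_cancel_left₀ this.ne']
  simp only [Pi.mul_apply, e, ENNReal.rpow_two] at h
  refine h.trans (le_of_eq ?_)
  rw [← eLpNorm_two_sq, ← ENNReal.rpow_two, ← ENNReal.rpow_mul]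
  norm_num [sobNorm]

theorem integrable_ft {s : ℕ} (hs : (n : ℝ) < 2 * s) {u : E n → ℝ} (hu : sobNorm s u < ⊤) :
    Integrable (ft u) volume := by
  obtain ⟨K, hK, h⟩ := exists_lintegral_ft_le hs
  exact ⟨(Lp.memLp _).aestronglyMeasurable, lt_of_le_of_lt (h u) (ENNReal.mul_lt_top hK hu)⟩

/-- `H^s` is an algebra if `s > n / 2`. -/
theorem exists_sobNorm_mul_le {s : ℕ} (hs : (n : ℝ) < 2 * s) :
    ∃ K : ℝ≥0∞, K < ⊤ ∧ ∀ u v : E n → ℝ, MemLp u 2 volume → MemLp v 2 volume →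
      sobNorm s u < ⊤ → sobNorm s v < ⊤ → sobNorm s (u * v) ≤ K * (sobNorm s u * sobNorm s v) := by
  obtain ⟨K, hK, hL⟩ := exists_lintegral_ft_le (n := n) hs
  refine ⟨2 ^ s * (2 * K), ENNReal.mul_lt_top (by simp) (ENNReal.mul_lt_top (by simp) hK),
    fun u v hu hv hsu hsv => ?_⟩
  let P : E n → ℝ≥0∞ := fun t => ‖ft u t‖ₑ
  let Q : E n → ℝ≥0∞ := fun t => ‖ft v t‖ₑ
  let P' : E n → ℝ≥0∞ := fun t => ‖(jap s t : ℂ) * ft u t‖ₑ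
  let Q' : E n → ℝ≥0∞ := fun t => ‖(jap s t : ℂ) * ft v t‖ₑ
  have mj : Measurable fun ξ : E n => (jap s ξ : ℂ) :=
    (Complex.continuous_ofReal.comp (continuous_jap s)).measurable
  have mP : Measurable P := (measurable_ft u).enorm
  have mQ : Measurable Q := (measurable_ft v).enorm
  have mP' : Measurable P' := (mj.mul (measurable_ft u)).enorm
  have mQ' : Measurable Q' := (mj.mul (measurable_ft v)).enorm
  -- In each of A and B only one factor carries the weight. Young's inequality places the unweighted
  -- factor in L¹ and the weighted one in L².
  let A : E n → ℝ≥0∞ := fun x => ∫⁻ t, Q t * P' (x - t)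
  let B : E n → ℝ≥0∞ := fun x => ∫⁻ t, P t * Q' (x - t)
  have mconv : ∀ {F G : E n → ℝ≥0∞}, Measurable F → Measurable G →
      Measurable fun x => ∫⁻ t, F t * G (x - t) := fun {F G} hF hG =>
    Measurable.lintegral_prod_right' (f := fun p : E n × E n => F p.2 * G (p.1 - p.2))
      ((hF.comp measurable_snd).mul (hG.comp (measurable_fst.sub measurable_snd)))
  have young : ∀ {F G : E n → ℝ≥0∞}, Measurable F → Measurable G →
      eLpNorm (fun x => ∫⁻ t, F t * G (x - t)) 2 volume ≤ (∫⁻ t, F t) * eLpNorm G 2 volume := by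
    intro F G hF hG
    rw [← ENNReal.pow_le_pow_left_iff (n := 2) (by norm_num), mul_pow, eLpNorm_two_sq,
      eLpNorm_two_sq]
    exact lintegral_conv_sq_le hF hG
  have hpt : ∀ᵐ x, ‖(jap s x : ℂ) * ft (u * v) x‖ₑ ≤ 2 ^ s * (A x + B x) := by
    filter_upwards [ft_mul hu hv (integrable_ft hs hsu) (integrable_ft hs hsv)] with x hx
    have hA : A x = ∫⁻ t, P' t * Q (x - t) := by
      rw [← lintegral_sub_left_eq_self _ x]
      refine lintegral_congr fun t => ?_
      have e : x - (x - t) = t := by abel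
      rw [e, mul_comm]
    have m1 : Measurable fun t => P' t * Q (x - t) :=
      mP'.mul (mQ.comp (measurable_const.sub measurable_id))
    have m2 : Measurable fun t => P t * Q' (x - t) :=
      mP.mul (mQ'.comp (measurable_const.sub measurable_id))
    rw [hx, enorm_mul, hA, ← lintegral_add_left m1, ← lintegral_const_mul' _ _ (by simp)]
    calc ‖(jap s x : ℂ)‖ₑ * ‖∫ t, ft u t * ft v (x - t)‖ₑ
        ≤ ‖(jap s x : ℂ)‖ₑ * ∫⁻ t, ‖ft u t * ft v (x - t)‖ₑ := by
          gcongr; exact enorm_integral_le_lintegral_enorm _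
      _ = ∫⁻ t, ‖(jap s x : ℂ)‖ₑ * ‖ft u t * ft v (x - t)‖ₑ := by
          rw [lintegral_const_mul']; exact enorm_ne_top
      _ ≤ _ := by
          refine lintegral_mono fun t => ?_
          have e : ‖(jap s x : ℂ)‖ₑ ≤ 2 ^ s * (‖(jap s t : ℂ)‖ₑ + ‖(jap s (x - t) : ℂ)‖ₑ) := by
            simp only [← ofReal_norm, Complex.norm_real,
              Real.norm_of_nonneg (jap_pos _ _).le]
            rw [← ENNReal.ofReal_add (jap_pos _ _).le (jap_pos _ _).le]
            have : (2 : ℝ≥0∞) ^ s = ENNReal.ofReal (2 ^ s) := by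
              rw [ENNReal.ofReal_pow (by norm_num)]; simp
            rw [this, ← ENNReal.ofReal_mul (by positivity)]
            exact ENNReal.ofReal_le_ofReal (jap_le_add s x t)
          simp only [P, P', Q, Q', enorm_mul]
          refine (mul_le_mul_left e _).trans (le_of_eq ?_)
          ring
  have h1 : sobNorm s (u * v) ≤ eLpNorm (fun x => 2 ^ s * (A x + B x)) 2 volume :=
    eLpNorm_mono_enorm_ae hpt
  have h2 : eLpNorm (fun x => 2 ^ s * (A x + B x)) 2 volume
      ≤ 2 ^ s * (eLpNorm A 2 volume + eLpNorm B 2 volume) := by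
    have e : eLpNorm (fun x => 2 ^ s * (A x + B x)) 2 volume
        = 2 ^ s * eLpNorm (A + B) 2 volume := by
      refine (ENNReal.pow_right_strictMono (n := 2) (by norm_num)).injective ?_
      beta_reduce
      rw [mul_pow, eLpNorm_two_sq, eLpNorm_two_sq,
        ← lintegral_const_mul _ (((mconv mQ mP').add (mconv mP mQ')).enorm.pow_const 2)]
      refine lintegral_congr fun x => ?_
      simp only [enorm_eq_self, mul_pow, Pi.add_apply]
      rfl
    rw [e]
    gcongr
    exact eLpNorm_add_le (mconv mQ mP').aestronglyMeasurable (mconv mP mQ').aestronglyMeasurable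
      one_le_two
  refine h1.trans (h2.trans ?_)
  have hA := young mQ mP'
  have hB := young mP mQ'
  have eP : eLpNorm P' 2 volume = sobNorm s u := eLpNorm_enorm _
  have eQ : eLpNorm Q' 2 volume = sobNorm s v := eLpNorm_enorm _
  rw [eP] at hA
  rw [eQ] at hB
  calc 2 ^ s * (eLpNorm A 2 volume + eLpNorm B 2 volume)
      ≤ 2 ^ s * (K * sobNorm s v * sobNorm s u + K * sobNorm s u * sobNorm s v) := by
        gcongr
        · exact hA.trans (by gcongr; exact hL v)
        · exact hB.trans (by gcongr; exact hL u)
    _ = _ := by ring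

end SobolevAlgebra


/-! ### Continuity in time with values in Sobolev spaces, and the nonlinearity. -/

section ContSobolev

open ENNReal

variable {n : ℕ}

theorem eLpNorm_ft {u : E n → ℝ} (hu : MemLp u 2 volume) :
    eLpNorm (ft u) 2 volume = eLpNorm u 2 volume := by
  rw [← ENNReal.toReal_eq_toReal_iff' (Lp.memLp _).eLpNorm_ne_top hu.eLpNorm_ne_top, ← norm_ft hu,
    Lp.norm_def]

theorem HasSymbol.memSobolev {s : ℕ} {u : E n → ℝ} {q : E n → ℂ} (h : HasSymbol 0 s u q) :
    MemSobolev s u := ⟨h.diff, fun κ => h.memLp κ (Nat.zero_le _)⟩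

theorem HasSymbol.eLpNorm_wgrad {a m κ : ℕ} {u : E n → ℝ} {q : E n → ℂ} (h : HasSymbol a m u q)
    (h1 : a ≤ κ) (h2 : κ ≤ m) (I : Fin κ → Fin n) :
    eLpNorm (wgrad κ u I) 2 volume = eLpNorm (fun ξ => symI I ξ * q ξ) 2 volume := by
  rw [← eLpNorm_ft (h.memLp κ h1 h2 I)]
  exact eLpNorm_congr_ae (h.ft_eq κ h1 h2 I)

theorem MemSobolev.add {s : ℕ} {u v : E n → ℝ} (hu : MemSobolev s u) (hv : MemSobolev s v) :
    MemSobolev s (u + v) := (hu.hasSymbol.add hv.hasSymbol).memSobolev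

theorem MemSobolev.smul {s : ℕ} {u : E n → ℝ} (hu : MemSobolev s u) (a : ℝ) :
    MemSobolev s (a • u) := (hu.hasSymbol.smul a).memSobolev

theorem MemSobolev.sub {s : ℕ} {u v : E n → ℝ} (hu : MemSobolev s u) (hv : MemSobolev s v) :
    MemSobolev s (u - v) := (hu.hasSymbol.sub hv.hasSymbol).memSobolev

theorem MemSobolev.mono {s s' : ℕ} {u : E n → ℝ} (hu : MemSobolev s u) (h : s' ≤ s) :
    MemSobolev s' u :=
  ⟨fun κ hκ => hu.1 κ (by omega), fun κ hκ => hu.2 κ (by omega)⟩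

theorem wgrad_sub {u v : E n → ℝ} {m κ : ℕ}
    (hu : ∀ κ, κ < m → ∀ (I : Fin κ → Fin n) (j : Fin n), WeaklyDiff j (wgrad κ u I))
    (hv : ∀ κ, κ < m → ∀ (I : Fin κ → Fin n) (j : Fin n), WeaklyDiff j (wgrad κ v I))
    (h : κ ≤ m) (I : Fin κ → Fin n) : wgrad κ (u - v) I =ᵐ[volume] wgrad κ u I - wgrad κ v I := by
  have h1 := wgrad_add hu (v := (-1 : ℝ) • v) (fun κ hκ I j =>
    ((hv κ hκ I j).hasWeakPartial.const_smul (-1)).weaklyDiff.congr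
      (wgrad_smul (-1) hv κ hκ.le I).symm) κ h I
  have h2 := wgrad_smul (-1) hv κ h I
  have e : u - v = u + (-1 : ℝ) • v := by rw [neg_one_smul, sub_eq_add_neg]
  rw [e]
  filter_upwards [h1, h2] with x a b
  rw [a, Pi.add_apply, b, Pi.sub_apply, Pi.smul_apply]
  simp [sub_eq_add_neg]

theorem MemSobolev.eLpNorm_wgrad_le {s κ : ℕ} {u : E n → ℝ} (hu : MemSobolev s u) (h : κ ≤ s)
    (I : Fin κ → Fin n) : eLpNorm (wgrad κ u I) 2 volume ≤ sobNorm s u := by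
  rw [hu.hasSymbol.eLpNorm_wgrad (Nat.zero_le _) h I]
  refine eLpNorm_mono fun ξ => ?_
  rw [norm_mul, norm_mul, Complex.norm_real, Real.norm_of_nonneg (jap_pos s ξ).le]
  gcongr
  exact (norm_symI_le I ξ).trans (rad_pow_le_jap h ξ)

/-- The orders 0 and s suffice, because (1 + r)^s ≤ 2^s(1 + r^s). -/
theorem MemSobolev.sobNorm_le {s : ℕ} {u : E n → ℝ} (hu : MemSobolev s u) :
    sobNorm s u ≤ 2 ^ s * (eLpNorm u 2 volume
      + ∑ I : Fin s → Fin n, eLpNorm (wgrad s u I) 2 volume) := by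
  have m1 : AEStronglyMeasurable (fun ξ => ‖ft u ξ‖) volume :=
    (Lp.memLp (ft u)).aestronglyMeasurable.norm
  have m2 : ∀ I : Fin s → Fin n, AEStronglyMeasurable (fun ξ => ‖symI I ξ * ft u ξ‖) volume :=
    fun I => ((continuous_symI I).aestronglyMeasurable.mul
      (Lp.memLp (ft u)).aestronglyMeasurable).norm
  have h1 : sobNorm s u ≤ eLpNorm ((2 : ℝ) ^ s • ((fun ξ => ‖ft u ξ‖)
      + ∑ I : Fin s → Fin n, fun ξ => ‖symI I ξ * ft u ξ‖)) 2 volume := by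
    refine eLpNorm_mono_real fun ξ => ?_
    simp only [Pi.smul_apply, Pi.add_apply, Finset.sum_apply, norm_mul, Complex.norm_real,
      Real.norm_of_nonneg (jap_pos s ξ).le, ← Finset.sum_mul, smul_eq_mul]
    calc jap s ξ * ‖ft u ξ‖
        ≤ 2 ^ s * (1 + ∑ I : Fin s → Fin n, ‖symI I ξ‖) * ‖ft u ξ‖ := by
          gcongr
          exact (jap_le s ξ).trans (by gcongr; exact rad_pow_le_sum s ξ)
      _ = _ := by ring
  refine h1.trans ?_
  rw [eLpNorm_const_smul]
  have e : ‖(2 : ℝ) ^ s‖ₑ = 2 ^ s := by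
    rw [enorm_pow]
    congr 1
    simp [Real.enorm_eq_ofReal]
  rw [e]
  gcongr
  refine (eLpNorm_add_le m1 (Finset.aestronglyMeasurable_sum _ fun I _ => m2 I) one_le_two).trans ?_
  gcongr
  · rw [eLpNorm_norm, eLpNorm_ft hu.memLp]
  · refine (eLpNorm_sum_le (fun I _ => m2 I) one_le_two).trans ?_
    refine Finset.sum_le_sum fun I _ => ?_
    rw [eLpNorm_norm, hu.hasSymbol.eLpNorm_wgrad (Nat.zero_le _) le_rfl I]

theorem MemSobolev.sobNorm_lt_top {s : ℕ} {u : E n → ℝ} (hu : MemSobolev s u) :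
    sobNorm s u < ⊤ := by
  refine lt_of_le_of_lt hu.sobNorm_le (ENNReal.mul_lt_top (by simp) (ENNReal.add_lt_top.2
    ⟨hu.memLp.eLpNorm_lt_top, ENNReal.sum_lt_top.2 fun I _ => (hu.2 s le_rfl I).eLpNorm_lt_top⟩))

/-- Weak derivatives are built one order at a time by inverse transform. This is how products, known
only through their transforms, are shown to be weakly differentiable. -/
theorem memSobolev_of_sobNorm {s : ℕ} {u : E n → ℝ} (hu : MemLp u 2 volume)
    (hs : sobNorm s u < ⊤) : MemSobolev s u := by
  have hsym : ∀ κ ≤ s, ∀ I : Fin κ → Fin n, MemLp (fun ξ => symI I ξ * ft u ξ) 2 volume := by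
    intro κ hκ I
    have hj : MemLp (fun ξ => (jap s ξ : ℂ) * ft u ξ) 2 volume :=
      ⟨aestronglyMeasurable_jap_mul s u, hs⟩
    refine hj.of_le ((continuous_symI I).aestronglyMeasurable.mul
      (Lp.memLp (ft u)).aestronglyMeasurable) (ae_of_all _ fun ξ => ?_)
    rw [norm_mul, norm_mul, Complex.norm_real, Real.norm_of_nonneg (jap_pos s ξ).le]
    gcongr
    exact (norm_symI_le I ξ).trans (rad_pow_le_jap hκ ξ)
  have key : ∀ κ ≤ s, ∀ I : Fin κ → Fin n, MemLp (wgrad κ u I) 2 volume ∧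
      ft (wgrad κ u I) =ᵐ[volume] fun ξ => symI I ξ * ft u ξ := by
    intro κ
    induction κ with
    | zero => exact fun _ I => ⟨hu, ae_of_all _ fun ξ => by simp [symI, wgrad]⟩
    | succ κ ih =>
      intro hκ I
      obtain ⟨h1, h2⟩ := ih (by omega) (Fin.tail I)
      have e : (fun ξ => symI I ξ * ft u ξ)
          =ᵐ[volume] fun ξ => sym1 (I 0) ξ * ft (wgrad κ u (Fin.tail I)) ξ := by
        filter_upwards [h2] with ξ hξ
        rw [hξ, symI_succ, mul_assoc]
      obtain ⟨-, h3, h4⟩ := weakPartial_of_memLp_sym h1 ((memLp_congr_ae e).1 (hsym _ hκ I))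
      exact ⟨h3, EventuallyEq.trans h4 e.symm⟩
  refine ⟨fun κ hκ I j => ?_, fun κ hκ I => (key κ hκ I).1⟩
  obtain ⟨h1, h2⟩ := key κ hκ.le I
  have e : (fun ξ => symI (Fin.cons j I : Fin (κ + 1) → Fin n) ξ * ft u ξ)
      =ᵐ[volume] fun ξ => sym1 j ξ * ft (wgrad κ u I) ξ := by
    filter_upwards [h2] with ξ hξ
    rw [hξ, symI_succ, mul_assoc, Fin.cons_zero, Fin.tail_cons]
  exact (weakPartial_of_memLp_sym h1 ((memLp_congr_ae e).1 (hsym _ hκ _))).1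

theorem sobNorm_add_le {s : ℕ} {u v : E n → ℝ} (hu : MemLp u 2 volume) (hv : MemLp v 2 volume) :
    sobNorm s (u + v) ≤ sobNorm s u + sobNorm s v := by
  refine le_trans (le_of_eq ?_) (eLpNorm_add_le (aestronglyMeasurable_jap_mul s u)
    (aestronglyMeasurable_jap_mul s v) one_le_two)
  refine eLpNorm_congr_ae ?_
  rw [ft_add hu hv]
  filter_upwards [Lp.coeFn_add (ft u) (ft v)] with ξ hξ
  rw [hξ, Pi.add_apply, Pi.add_apply, mul_add]

theorem sobNorm_smul {s : ℕ} {u : E n → ℝ} (hu : MemLp u 2 volume) (a : ℝ) :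
    sobNorm s (a • u) = ‖a‖ₑ * sobNorm s u := by
  rw [sobNorm, sobNorm, ← eLpNorm_const_smul]
  refine eLpNorm_congr_ae ?_
  rw [ft_smul hu]
  filter_upwards [Lp.coeFn_smul a (ft u)] with ξ hξ
  rw [hξ, Pi.smul_apply, Pi.smul_apply, mul_smul_comm]

theorem contSobolev_iff {T : ℝ} {s : ℕ} {u : ℝ → E n → ℝ} :
    ContSobolev T s u ↔ (∀ t ∈ Icc (0 : ℝ) T, MemSobolev s (u t)) ∧
      ∀ t ∈ Icc (0 : ℝ) T, Tendsto (fun r => sobNorm s (u r - u t)) (𝓝[Icc 0 T] t) (𝓝 0) := by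
  refine and_congr_right fun hm => ⟨fun h t ht => ?_, fun h κ hκ I t ht => ?_⟩
  · have lim : Tendsto (fun r => 2 ^ s * (eLpNorm (u r - u t) 2 volume
        + ∑ I : Fin s → Fin n, eLpNorm (wgrad s (u r) I - wgrad s (u t) I) 2 volume))
        (𝓝[Icc 0 T] t) (𝓝 (2 ^ s * (0 + ∑ _I : Fin s → Fin n, 0))) := by
      refine ENNReal.Tendsto.const_mul (Tendsto.add (h 0 (Nat.zero_le _) Fin.elim0 t ht)
        (tendsto_finsetSum _ fun I _ => h s le_rfl I t ht)) (Or.inr (by simp))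
    simp only [Finset.sum_const_zero, add_zero, mul_zero] at lim
    refine tendsto_of_tendsto_of_tendsto_of_le_of_le' tendsto_const_nhds lim
      (Eventually.of_forall fun _ => zero_le) ?_
    filter_upwards [self_mem_nhdsWithin] with r hr
    refine ((hm r hr).sub (hm t ht)).sobNorm_le.trans (le_of_eq ?_)
    congr 2
    exact Finset.sum_congr rfl fun I _ => eLpNorm_congr_ae (wgrad_sub (hm r hr).1 (hm t ht).1 le_rfl I)
  · refine tendsto_of_tendsto_of_tendsto_of_le_of_le' tendsto_const_nhds (h t ht)
      (Eventually.of_forall fun _ => zero_le) ?_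
    filter_upwards [self_mem_nhdsWithin] with r hr
    rw [← eLpNorm_congr_ae (wgrad_sub (hm r hr).1 (hm t ht).1 hκ I)]
    exact ((hm r hr).sub (hm t ht)).eLpNorm_wgrad_le hκ I

theorem ContSobolev.mono {T : ℝ} {s s' : ℕ} {u : ℝ → E n → ℝ} (hu : ContSobolev T s u)
    (h : s' ≤ s) : ContSobolev T s' u :=
  ⟨fun t ht => (hu.1 t ht).mono h, fun κ hκ => hu.2 κ (by omega)⟩

theorem ContSobolev.add {T : ℝ} {s : ℕ} {u v : ℝ → E n → ℝ} (hu : ContSobolev T s u)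
    (hv : ContSobolev T s v) : ContSobolev T s (fun t => u t + v t) := by
  rw [contSobolev_iff] at hu hv ⊢
  refine ⟨fun t ht => (hu.1 t ht).add (hv.1 t ht), fun t ht => ?_⟩
  have lim := (hu.2 t ht).add (hv.2 t ht)
  rw [add_zero] at lim
  refine tendsto_of_tendsto_of_tendsto_of_le_of_le' tendsto_const_nhds lim
    (Eventually.of_forall fun _ => zero_le) ?_
  filter_upwards [self_mem_nhdsWithin] with r hr
  rw [add_sub_add_comm]
  exact sobNorm_add_le ((hu.1 r hr).memLp.sub (hu.1 t ht).memLp)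
    ((hv.1 r hr).memLp.sub (hv.1 t ht).memLp)

theorem ContSobolev.smul {T : ℝ} {s : ℕ} {u : ℝ → E n → ℝ} (hu : ContSobolev T s u) (a : ℝ) :
    ContSobolev T s (fun t => a • u t) := by
  rw [contSobolev_iff] at hu ⊢
  refine ⟨fun t ht => (hu.1 t ht).smul a, fun t ht => ?_⟩
  have lim := ENNReal.Tendsto.const_mul (a := ‖a‖ₑ) (hu.2 t ht) (Or.inr enorm_ne_top)
  rw [mul_zero] at lim
  refine lim.congr' ?_
  filter_upwards [self_mem_nhdsWithin] with r hr
  rw [← smul_sub, sobNorm_smul ((hu.1 r hr).memLp.sub (hu.1 t ht).memLp)]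

theorem ContSobolev.mul {T : ℝ} {s : ℕ} (hs : (n : ℝ) < 2 * s) {u v : ℝ → E n → ℝ}
    (hu : ContSobolev T s u) (hv : ContSobolev T s v) : ContSobolev T s (fun t => u t * v t) := by
  rw [contSobolev_iff] at hu hv ⊢
  obtain ⟨K, hK, hmul⟩ := exists_sobNorm_mul_le (n := n) hs
  have mul2 : ∀ {u v : E n → ℝ}, MemSobolev s u → MemSobolev s v → MemSobolev s (u * v) := by
    intro u v hu hv
    exact memSobolev_of_sobNorm (memLp_mul_of_integrable_ft hu.memLp hv.memLp
      (integrable_ft hs hu.sobNorm_lt_top)) (lt_of_le_of_lt (hmul u v hu.memLp hv.memLp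
        hu.sobNorm_lt_top hv.sobNorm_lt_top) (ENNReal.mul_lt_top hK
          (ENNReal.mul_lt_top hu.sobNorm_lt_top hv.sobNorm_lt_top)))
  refine ⟨fun t ht => mul2 (hu.1 t ht) (hv.1 t ht), fun t ht => ?_⟩
  have ft1 := (hu.1 t ht).sobNorm_lt_top.ne
  have ft2 := (hv.1 t ht).sobNorm_lt_top.ne
  have lim : Tendsto (fun r => K * (sobNorm s (u r - u t) * (sobNorm s (v r - v t) + sobNorm s (v t)))
      + K * (sobNorm s (u t) * sobNorm s (v r - v t))) (𝓝[Icc 0 T] t)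
      (𝓝 (K * (0 * (0 + sobNorm s (v t))) + K * (sobNorm s (u t) * 0))) := by
    refine Tendsto.add (ENNReal.Tendsto.const_mul (ENNReal.Tendsto.mul (hu.2 t ht) (Or.inr ?_)
      ((hv.2 t ht).add tendsto_const_nhds) (Or.inr ENNReal.zero_ne_top)) (Or.inr hK.ne))
      (ENNReal.Tendsto.const_mul (ENNReal.Tendsto.const_mul (hv.2 t ht) (Or.inr ft1)) (Or.inr hK.ne))
    simpa using ft2
  simp only [zero_mul, mul_zero, add_zero] at lim
  refine tendsto_of_tendsto_of_tendsto_of_le_of_le' tendsto_const_nhds lim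
    (Eventually.of_forall fun _ => zero_le) ?_
  filter_upwards [self_mem_nhdsWithin] with r hr
  have du := (hu.1 r hr).sub (hu.1 t ht)
  have dv := (hv.1 r hr).sub (hv.1 t ht)
  -- Bilinear splitting; the moving factor v r is then bounded through v r - v t and the fixed v t,
  -- so no uniform bound is needed beforehand.
  have e : u r * v r - u t * v t = (u r - u t) * v r + u t * (v r - v t) := by ring
  rw [e]
  refine (sobNorm_add_le (mul2 du (hv.1 r hr)).memLp (mul2 (hu.1 t ht) dv).memLp).trans ?_
  gcongr
  · refine (hmul _ _ du.memLp (hv.1 r hr).memLp du.sobNorm_lt_top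
      (hv.1 r hr).sobNorm_lt_top).trans ?_
    gcongr
    calc sobNorm s (v r) = sobNorm s ((v r - v t) + v t) := by rw [sub_add_cancel]
      _ ≤ _ := sobNorm_add_le dv.memLp (hv.1 t ht).memLp
  · exact hmul _ _ (hu.1 t ht).memLp dv.memLp (hu.1 t ht).sobNorm_lt_top dv.sobNorm_lt_top

theorem ContSobolev.sum {ι : Type*} {T : ℝ} {s : ℕ} {u : ι → ℝ → E n → ℝ} (S : Finset ι)
    (hS : S.Nonempty) (hu : ∀ i, ContSobolev T s (u i)) :
    ContSobolev T s (fun t => ∑ i ∈ S, u i t) := by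
  classical
  induction hS using Finset.Nonempty.cons_induction with
  | singleton i => simpa using hu i
  | cons i S hi _ ih =>
    simp only [Finset.sum_cons]
    exact (hu i).add ih

/-- The first index of a tuple is the outermost derivative, so a derivative taken first sits at the
end. No commutation of derivatives is involved. -/
theorem wgrad_wpartial (u : E n → ℝ) (j : Fin n) : ∀ (κ : ℕ) (I : Fin κ → Fin n),
    wgrad κ (wpartial j u) I = wgrad (κ + 1) u (Fin.snoc I j : Fin (κ + 1) → Fin n)
  | 0, I => by simp [wgrad, Fin.snoc]
  | κ + 1, I => by
    rw [wgrad, wgrad_wpartial u j κ (Fin.tail I)]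
    conv_rhs => rw [wgrad]
    have e : (Fin.snoc I j : Fin (κ + 2) → Fin n)
        = (Fin.cons (I 0) (Fin.snoc (Fin.tail I) j : Fin (κ + 1) → Fin n)) := by
      rw [Fin.cons_snoc_eq_snoc_cons, Fin.cons_self_tail]
    rw [e, Fin.cons_zero, Fin.tail_cons]

theorem ContHomSobolev.wpartial {T : ℝ} {s : ℕ} {u : ℝ → E n → ℝ} (hu : ContHomSobolev T (s + 1) u)
    (j : Fin n) : ContSobolev T s (fun t => wpartial j (u t)) := by
  refine ⟨fun t ht => ⟨fun κ hκ I i => ?_, fun κ hκ I => ?_⟩, fun κ hκ I => ?_⟩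
  · rw [wgrad_wpartial]
    exact (hu.1 t ht).2.1 (κ + 1) (by omega) _ i
  · rw [wgrad_wpartial]
    exact (hu.1 t ht).2.2 (κ + 1) (by omega) (by omega) _
  · simp only [wgrad_wpartial]
    exact hu.2 (κ + 1) (by omega) (by omega) _

theorem ContSobolev.contHomSobolev {T : ℝ} {s : ℕ} {u : ℝ → E n → ℝ} (hu : ContSobolev T s u) :
    ContHomSobolev T s u :=
  ⟨fun t ht => ⟨(hu.1 t ht).memLp.locallyIntegrable one_le_two, (hu.1 t ht).1,
    fun κ _ => (hu.1 t ht).2 κ⟩, fun κ _ => hu.2 κ⟩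

/-- Both ∇ψ and ∇v are one order below ψ and v, hence continuous into the algebra H^s to which w
also belongs. -/
theorem contSobolev_nonlin {T k : ℝ} {s : ℕ} (hn : 0 < n) (hs : (n : ℝ) < 2 * s)
    {ψ v w : ℝ → E n → ℝ} (hψ : ContHomSobolev T (s + 1) ψ) (hv : ContSobolev T (s + 1) v)
    (hw : ContSobolev T s w) : ContSobolev T s (fun t => nonlin k (ψ t) (v t) (w t)) := by
  have h1 := ((hv.mono (Nat.le_succ s)).mul hs hw).smul k
  have h2 := ContSobolev.sum (Finset.univ : Finset (Fin n)) ⟨⟨0, hn⟩, Finset.mem_univ _⟩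
    fun j => (hψ.wpartial j).mul hs (hv.contHomSobolev.wpartial j)
  have h3 := (h1.add h2).smul 2
  convert h3 using 2 with t
  ext x
  simp [nonlin, mul_assoc]

end ContSobolev


/-! ### From weak time derivatives to differentiable paths in L². -/

section Paths

variable {n : ℕ}

/-- The real Hilbert space `L²(ℝⁿ)`. -/
abbrev RC (n : ℕ) : Type := Lp ℝ 2 (volume : Measure (E n))

open Classical in
/-- The class in `L²` of a real function; zero if the function is not in `L²`. -/
noncomputable def toR (u : E n → ℝ) : RC n := if h : MemLp u 2 volume then h.toLp else 0

theorem toR_coe {u : E n → ℝ} (h : MemLp u 2 volume) : toR u =ᵐ[volume] u := by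
  unfold toR
  rw [dif_pos h]
  exact h.coeFn_toLp

theorem toR_congr {u v : E n → ℝ} (hu : MemLp u 2 volume) (h : u =ᵐ[volume] v) :
    toR u = toR v :=
  Lp.ext ((toR_coe hu).trans (h.trans (toR_coe ((memLp_congr_ae h).1 hu)).symm))

theorem toR_sub {u v : E n → ℝ} (hu : MemLp u 2 volume) (hv : MemLp v 2 volume) :
    toR (u - v) = toR u - toR v := by
  apply Lp.ext
  filter_upwards [toR_coe (hu.sub hv), Lp.coeFn_sub (toR u) (toR v), toR_coe hu, toR_coe hv]
    with x h1 h2 h3 h4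
  rw [h1, h2, Pi.sub_apply, Pi.sub_apply, h3, h4]

theorem toR_sum {ι : Type*} (S : Finset ι) {u : ι → E n → ℝ} (hu : ∀ i, MemLp (u i) 2 volume) :
    toR (∑ i ∈ S, u i) = ∑ i ∈ S, toR (u i) := by
  classical
  apply Lp.ext
  refine (toR_coe (memLp_finsetSum' S fun i _ => hu i)).trans ?_
  induction S using Finset.induction_on with
  | empty =>
    simpa using (Lp.coeFn_zero ℝ 2 (volume : Measure (E n))).symm
  | insert i S hi ih =>
    rw [Finset.sum_insert hi, Finset.sum_insert hi]
    filter_upwards [ih, Lp.coeFn_add (toR (u i)) (∑ i ∈ S, toR (u i)), toR_coe (hu i)]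
      with x h1 h2 h3
    rw [h2, Pi.add_apply, Pi.add_apply, h1, h3]

theorem norm_toR {u : E n → ℝ} (h : MemLp u 2 volume) : ‖toR u‖ = (eLpNorm u 2 volume).toReal := by
  unfold toR
  rw [dif_pos h, Lp.norm_toLp]

theorem inner_toR {φ : E n → ℝ} (hφ : MemLp φ 2 volume) (f : RC n) :
    inner ℝ (toR φ) f = ∫ x, f x * φ x := by
  rw [L2.inner_def]
  refine integral_congr_ae ?_
  filter_upwards [toR_coe hφ] with x hx
  rw [hx]
  rfl

/-- The Fourier transform on the real space `L²(ℝⁿ)`. -/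
noncomputable def ftL : RC n →L[ℝ] HC n :=
  LinearMap.mkContinuous
    { toFun := fun f => ft f
      map_add' := fun f g => by
        rw [ft_congr (Lp.coeFn_add f g), ft_add (Lp.memLp f) (Lp.memLp g)]
      map_smul' := fun a f => by
        rw [ft_congr (Lp.coeFn_smul a f), ft_smul (Lp.memLp f)]
        rfl } 1 fun f => by
    rw [one_mul]
    exact le_of_eq ((norm_ft (Lp.memLp f)).trans (Lp.norm_def f).symm)

theorem ftL_toR {u : E n → ℝ} (h : MemLp u 2 volume) : ftL (toR u) = ft u :=
  ft_congr (toR_coe h)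

/-- The projection of the real line to `[0,T]`. -/
noncomputable def clamp (T t : ℝ) : ℝ := max 0 (min T t)

theorem continuous_clamp (T : ℝ) : Continuous (clamp T) := by unfold clamp; fun_prop

theorem clamp_mem {T : ℝ} (hT : 0 ≤ T) (t : ℝ) : clamp T t ∈ Icc 0 T :=
  ⟨le_max_left _ _, max_le hT (min_le_left _ _)⟩

theorem clamp_of_mem {T t : ℝ} (ht : t ∈ Icc 0 T) : clamp T t = t := by
  unfold clamp
  rw [min_eq_right ht.2, max_eq_right ht.1]

theorem BddCont.of_continuousOn {K : Type*} [NormedAddCommGroup K] [NormedSpace ℝ K] {T : ℝ}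
    (hT : 0 ≤ T) {F : ℝ → K} (h : ContinuousOn F (Icc 0 T)) :
    BddCont (fun t => F (clamp T t)) := by
  obtain ⟨B, hB⟩ := isCompact_Icc.exists_bound_of_continuousOn h
  exact ⟨h.comp_continuous (continuous_clamp T) (clamp_mem hT), B, fun t => hB _ (clamp_mem hT t)⟩

theorem ContL2.continuousOn {T : ℝ} {u : ℝ → E n → ℝ} (h : ContL2 T u)
    (hm : ∀ t ∈ Icc (0 : ℝ) T, MemLp (u t) 2 volume) :
    ContinuousOn (fun t => toR (u t)) (Icc 0 T) := by
  intro t ht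
  rw [ContinuousWithinAt, tendsto_iff_norm_sub_tendsto_zero]
  have := (ENNReal.tendsto_toReal ENNReal.zero_ne_top).comp (h t ht)
  refine this.congr' ?_
  filter_upwards [self_mem_nhdsWithin] with r hr
  rw [← toR_sub (hm r hr) (hm t ht), norm_toR ((hm r hr).sub (hm t ht))]
  rfl

theorem ContL2.bddCont {T : ℝ} (hT : 0 ≤ T) {u : ℝ → E n → ℝ} (h : ContL2 T u)
    (hm : ∀ t ∈ Icc (0 : ℝ) T, MemLp (u t) 2 volume) :
    BddCont (fun t => toR (u (clamp T t))) :=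
  BddCont.of_continuousOn hT (h.continuousOn hm)

/-- A weak time derivative which is continuous in `L²` is a derivative in `L²`. -/
theorem c1Path_of_weak {T : ℝ} {X Y : ℝ → RC n} (hX : BddCont X) (hY : BddCont Y)
    (h : ∀ φ : E n → ℝ, ContDiff ℝ ∞ φ → HasCompactSupport φ → ∀ t ∈ Icc (0 : ℝ) T,
      HasDerivWithinAt (fun r => ∫ x, X r x * φ x) (∫ x, Y t x * φ x) (Icc 0 T) t) :
    C1Path T X Y := by
  -- The difference of the two sides is orthogonal to every test function, by the scalar fundamental
  -- theorem of calculus, and so vanishes. Differentiability in norm follows from continuity of Y.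
  have key : ∀ t ∈ Icc 0 T, X t = X 0 + ∫ σ in (0 : ℝ)..t, Y σ := by
    intro t ht
    rw [← sub_eq_zero]
    set D := X t - (X 0 + ∫ σ in (0 : ℝ)..t, Y σ) with hD
    have hi : ∀ φ : E n → ℝ, ContDiff ℝ ∞ φ → HasCompactSupport φ → ∫ x, φ x • D x = 0 := by
      intro φ hφ hc
      have hm : MemLp φ 2 volume := hφ.continuous.memLp_of_hasCompactSupport hc
      have e1 : ∀ f : RC n, ∫ x, f x * φ x = inner ℝ (toR φ) f := fun f => (inner_toR hm f).symm
      have hder := h φ hφ hc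
      simp only [e1] at hder
      have ftc : ∫ σ in (0 : ℝ)..t, inner ℝ (toR φ) (Y σ) = inner ℝ (toR φ) (X t)
          - inner ℝ (toR φ) (X 0) := by
        have c1 : Continuous fun σ => inner ℝ (toR φ) (X σ) := continuous_const.inner hX.cont
        have c2 : Continuous fun σ => inner ℝ (toR φ) (Y σ) := continuous_const.inner hY.cont
        refine intervalIntegral.integral_eq_sub_of_hasDeriv_right c1.continuousOn
          (fun x hx => ?_) (c2.intervalIntegrable 0 t)
        rw [min_eq_left ht.1, max_eq_right ht.1] at hx
        have hx' : x ∈ Icc 0 T := ⟨hx.1.le, hx.2.le.trans ht.2⟩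
        exact ((hder x hx').hasDerivAt (Icc_mem_nhds hx.1 (hx.2.trans_le ht.2))).hasDerivWithinAt
      have e2 : ∫ σ in (0 : ℝ)..t, inner ℝ (toR φ) (Y σ)
          = inner ℝ (toR φ) (∫ σ in (0 : ℝ)..t, Y σ) :=
        (innerSL ℝ (toR φ)).intervalIntegral_comp_comm (hY.cont.intervalIntegrable 0 t)
      have : inner ℝ (toR φ) D = 0 := by
        rw [hD, inner_sub_right, inner_add_right, ← e2, ftc]
        ring
      rw [← this, ← e1]
      simp only [smul_eq_mul, mul_comm]
    have := ae_eq_zero_of_integral_contDiff_smul_eq_zero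
      ((Lp.memLp D).locallyIntegrable one_le_two) hi
    exact Lp.ext (EventuallyEq.trans this (Lp.coeFn_zero _ _ _).symm)
  refine ⟨hX, hY, fun t ht => ?_⟩
  have hd : HasDerivAt (fun t => X 0 + ∫ σ in (0 : ℝ)..t, Y σ) (Y t) t :=
    (intervalIntegral.integral_hasDerivAt_right (hY.cont.intervalIntegrable 0 t)
      (hY.cont.stronglyMeasurableAtFilter _ _) hY.cont.continuousAt).const_add _
  refine hd.hasDerivWithinAt.congr_of_eventuallyEq ?_ (key t ⟨ht.1, ht.2.le⟩)
  filter_upwards [Icc_mem_nhdsGE ht.2] with r hr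
  exact key r ⟨ht.1.trans hr.1, hr.2⟩

end Paths

/-! ### Bounded Fourier multipliers and frequency cut-offs. -/

section Multipliers

variable {n : ℕ}

/-- A bounded measurable multiplier. -/
structure BddMult (a : E n → ℂ) : Prop where
  meas : Measurable a
  bdd : ∃ B, ∀ ξ, ‖a ξ‖ ≤ B

theorem BddMult.memLp {a : E n → ℂ} (ha : BddMult a) (f : HC n) :
    MemLp (fun ξ => a ξ * f ξ) 2 volume := by
  obtain ⟨B, hB⟩ := ha.bdd
  refine (Lp.memLp f).of_le_mul (c := B) (ha.meas.aestronglyMeasurable.mul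
    (Lp.memLp f).aestronglyMeasurable) (ae_of_all _ fun ξ => ?_)
  rw [norm_mul]
  exact mul_le_mul_of_nonneg_right (hB ξ) (norm_nonneg _)

/-- The multiplication operator with a bounded measurable symbol. -/
noncomputable def BddMult.op {a : E n → ℂ} (ha : BddMult a) : HC n →L[ℝ] HC n :=
  LinearMap.mkContinuous
    { toFun := fun f => toL2 fun ξ => a ξ * f ξ
      map_add' := fun f g => by
        apply Lp.ext
        filter_upwards [toL2_coe (ha.memLp (f + g)), Lp.coeFn_add f g, toL2_coe (ha.memLp f),
          toL2_coe (ha.memLp g), Lp.coeFn_add (toL2 fun ξ => a ξ * f ξ)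
          (toL2 fun ξ => a ξ * g ξ)] with ξ h1 h2 h3 h4 h5
        rw [h1, h2, h5, Pi.add_apply, Pi.add_apply, h3, h4, mul_add]
      map_smul' := fun r f => by
        apply Lp.ext
        filter_upwards [toL2_coe (ha.memLp (r • f)), Lp.coeFn_smul r f, toL2_coe (ha.memLp f),
          Lp.coeFn_smul r (toL2 fun ξ => a ξ * f ξ)] with ξ h1 h2 h3 h5
        rw [h1, h2, RingHom.id_apply, h5, Pi.smul_apply, Pi.smul_apply, h3, mul_smul_comm] }
    (max 0 (Classical.choose ha.bdd)) fun f => by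
    refine (Lp.norm_le_mul_norm_of_ae_le_mul (g := f) ?_)
    filter_upwards [toL2_coe (ha.memLp f)] with ξ h1
    simp only [LinearMap.coe_mk, AddHom.coe_mk]
    rw [h1, norm_mul]
    gcongr
    exact (Classical.choose_spec ha.bdd ξ).trans (le_max_right _ _)

theorem BddMult.op_coe {a : E n → ℂ} (ha : BddMult a) (f : HC n) :
    ha.op f =ᵐ[volume] fun ξ => a ξ * f ξ := toL2_coe (ha.memLp f)

theorem BddMult.op_symm {a : E n → ℂ} (ha : BddMult a) (hr : ∀ ξ, (a ξ).im = 0) (f h : HC n) :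
    (inner ℝ (ha.op f) h : ℝ) = inner ℝ f (ha.op h) := by
  rw [inner_HC, inner_HC]
  refine integral_congr_ae ?_
  filter_upwards [ha.op_coe f, ha.op_coe h] with ξ h1 h2
  rw [h1, h2]
  simp only [Complex.inner, map_mul, Complex.mul_re, Complex.conj_re, Complex.conj_im, hr,
    Complex.mul_im]
  ring

theorem conj_symI_mul {κ : ℕ} (I : Fin κ → Fin n) (ξ : E n) :
    starRingEnd ℂ (symI I ξ) * symI I ξ = ((‖symI I ξ‖ ^ 2 : ℝ) : ℂ) := by
  rw [mul_comm, Complex.mul_conj, Complex.normSq_eq_norm_sq]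

theorem bddMult_symI {κ : ℕ} (I : Fin κ → Fin n) :
    BddMult fun ξ => starRingEnd ℂ (symI I ξ) / (rad ξ : ℂ) ^ κ where
  meas := (Complex.continuous_conj.comp (continuous_symI I)).measurable.div
    ((Complex.continuous_ofReal.comp continuous_rad).pow κ).measurable
  bdd := ⟨1, fun ξ => by
    rw [norm_div, norm_pow, Complex.norm_real, Real.norm_of_nonneg (rad_nonneg ξ)]
    refine div_le_one_of_le₀ ?_ (pow_nonneg (rad_nonneg ξ) κ)
    simpa using norm_symI_le I ξ⟩

/-- |∇|^κ u is recovered from the components of ∇^κu by products of Riesz transforms, as ∑|symI|² =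
rad^{2κ}. Continuity and differentiability in time thus pass from the components to `radL2` through
bounded operators. -/
theorem HasSymbol.radL2_eq_sum {a m κ : ℕ} {u : E n → ℝ} {q : E n → ℂ} (h : HasSymbol a m u q)
    (h1 : a ≤ κ) (h2 : κ ≤ m) :
    radL2 κ q = ∑ I : Fin κ → Fin n, (bddMult_symI I).op (ft (wgrad κ u I)) := by
  classical
  apply Lp.ext
  have key : ∀ S : Finset (Fin κ → Fin n),
      (∑ I ∈ S, (bddMult_symI I).op (ft (wgrad κ u I)) : HC n)
        =ᵐ[volume] fun ξ => ((∑ I ∈ S, ‖symI I ξ‖ ^ 2 : ℝ) : ℂ) / (rad ξ : ℂ) ^ κ * q ξ := by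
    intro S
    induction S using Finset.induction_on with
    | empty =>
      filter_upwards [Lp.coeFn_zero ℂ 2 (volume : Measure (E n))] with x hx
      simp
    | insert I S hI ih =>
      rw [Finset.sum_insert hI]
      filter_upwards [ih, Lp.coeFn_add ((bddMult_symI I).op (ft (wgrad κ u I)))
        (∑ I ∈ S, (bddMult_symI I).op (ft (wgrad κ u I))),
        (bddMult_symI I).op_coe (ft (wgrad κ u I)), h.ft_eq κ h1 h2 I] with ξ e1 e2 e3 e4
      rw [e2, Pi.add_apply, e1, e3, e4, Finset.sum_insert hI, Complex.ofReal_add,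
        ← conj_symI_mul]
      ring
  filter_upwards [h.radL2_coe h1 h2, key Finset.univ] with ξ e1 e2
  rw [e1, e2, sum_norm_symI_sq]
  by_cases h0 : rad ξ ^ κ = 0
  · have : (rad ξ : ℂ) ^ κ = 0 := by exact_mod_cast h0
    simp [this]
  · have : (rad ξ : ℂ) ^ κ ≠ 0 := by exact_mod_cast h0
    push_cast
    field_simp

/-- The sharp frequency cut-off. -/
noncomputable def cutoff (R : ℕ) (ξ : E n) : ℂ := if rad ξ ≤ R then 1 else 0

theorem bddMult_cutoff_pow (R κ : ℕ) : BddMult fun ξ : E n => cutoff R ξ * (rad ξ : ℂ) ^ κ where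
  meas := (Measurable.ite (continuous_rad.measurable measurableSet_Iic) measurable_const
    measurable_const).mul ((Complex.continuous_ofReal.comp continuous_rad).pow κ).measurable
  bdd := ⟨(R : ℝ) ^ κ, fun ξ => by
    unfold cutoff
    split_ifs with h
    · rw [one_mul, norm_pow, Complex.norm_real, Real.norm_of_nonneg (rad_nonneg ξ)]
      exact pow_le_pow_left₀ (rad_nonneg ξ) h κ
    · simp⟩

/-- The operator with symbol `(2 π |ξ|)^κ`, cut off to frequencies at most `R`. -/
noncomputable def cutOp (R κ : ℕ) : HC n →L[ℝ] HC n := (bddMult_cutoff_pow R κ).op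

theorem cutOp_coe (R κ : ℕ) (f : HC n) :
    cutOp R κ f =ᵐ[volume] fun ξ => cutoff R ξ * (rad ξ : ℂ) ^ κ * f ξ :=
  (bddMult_cutoff_pow R κ).op_coe f

theorem cutOp_symm (R κ : ℕ) (f h : HC n) :
    (inner ℝ (cutOp R κ f) h : ℝ) = inner ℝ f (cutOp R κ h) := by
  refine (bddMult_cutoff_pow R κ).op_symm (fun ξ => ?_) f h
  unfold cutoff
  rw [← Complex.ofReal_pow]
  split_ifs <;> simp [-Complex.ofReal_pow]

theorem cutoff_mul_self (R : ℕ) (ξ : E n) : cutoff R ξ * cutoff R ξ = cutoff R ξ := by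
  unfold cutoff
  split_ifs <;> simp

theorem cutOp_cutOp (R κ l : ℕ) (f : HC n) : cutOp R κ (cutOp R l f) = cutOp R (κ + l) f := by
  apply Lp.ext
  filter_upwards [cutOp_coe R κ (cutOp R l f), cutOp_coe R l f, cutOp_coe R (κ + l) f]
    with ξ h1 h2 h3
  rw [h1, h2, h3, pow_add]
  linear_combination ((rad ξ : ℂ) ^ κ * (rad ξ : ℂ) ^ l * f ξ) * cutoff_mul_self R ξ

/-- Only the total power of |ξ| matters, so derivatives can be moved freely between the truncated
operator and the function. -/
theorem cutOp_eq {R κ κ' l l' : ℕ} (e : κ + l = κ' + l') {q : E n → ℂ} {f h : HC n}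
    (hf : f =ᵐ[volume] fun ξ => (rad ξ : ℂ) ^ l * q ξ)
    (hh : h =ᵐ[volume] fun ξ => (rad ξ : ℂ) ^ l' * q ξ) : cutOp R κ f = cutOp R κ' h := by
  apply Lp.ext
  have e' : ∀ ξ : E n, (rad ξ : ℂ) ^ κ * (rad ξ : ℂ) ^ l = (rad ξ : ℂ) ^ κ' * (rad ξ : ℂ) ^ l' :=
    fun ξ => by rw [← pow_add, ← pow_add, e]
  filter_upwards [cutOp_coe R κ f, cutOp_coe R κ' h, hf, hh] with ξ h1 h2 h3 h4
  rw [h1, h2, h3, h4]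
  linear_combination (cutoff R ξ * q ξ) * e' ξ

theorem norm_cutOp_zero_le (R : ℕ) (f : HC n) : ‖cutOp R 0 f‖ ≤ ‖f‖ := by
  refine Lp.norm_le_norm_of_ae_le ?_
  filter_upwards [cutOp_coe R 0 f] with ξ h
  rw [h, pow_zero, mul_one, norm_mul]
  unfold cutoff
  split_ifs <;> simp

/-- With κ = 0 the operator is the projection onto frequencies at most R; each frequency is
eventually included, and dominated convergence applies. -/
theorem tendsto_cutOp_zero (f : HC n) :
    Tendsto (fun R : ℕ => cutOp R 0 f) atTop (𝓝 f) := by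
  rw [tendsto_iff_norm_sub_tendsto_zero]
  have hi : Integrable (fun ξ => ‖f ξ‖ ^ 2) volume :=
    (memLp_two_iff_integrable_sq_norm (Lp.memLp f).aestronglyMeasurable).1 (Lp.memLp f)
  have e : ∀ R : ℕ, ‖cutOp R 0 f - f‖ ^ 2 = ∫ ξ, ‖cutoff R ξ * f ξ - f ξ‖ ^ 2 := by
    intro R
    rw [← real_inner_self_eq_norm_sq, inner_HC]
    refine integral_congr_ae ?_
    filter_upwards [Lp.coeFn_sub (cutOp R 0 f) f, cutOp_coe R 0 f] with ξ h1 h2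
    rw [real_inner_self_eq_norm_sq, h1, Pi.sub_apply, h2, pow_zero, mul_one]
  have lim : Tendsto (fun R : ℕ => ∫ ξ, ‖cutoff R ξ * f ξ - f ξ‖ ^ 2) atTop (𝓝 (∫ _ξ : E n, 0)) := by
    refine tendsto_integral_of_dominated_convergence (fun ξ => ‖f ξ‖ ^ 2) (fun R => ?_) hi
      (fun R => ae_of_all _ fun ξ => ?_) (ae_of_all _ fun ξ => ?_)
    · have := (Lp.memLp (cutOp R 0 f - f)).aestronglyMeasurable.norm.pow 2
      refine this.congr ?_
      filter_upwards [Lp.coeFn_sub (cutOp R 0 f) f, cutOp_coe R 0 f] with ξ h1 h2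
      rw [Pi.pow_apply, h1, Pi.sub_apply, h2, pow_zero, mul_one]
    · unfold cutoff
      split_ifs <;> simp
    · refine tendsto_const_nhds.congr' ?_
      filter_upwards [eventually_ge_atTop ⌈rad ξ⌉₊] with R hR
      have : rad ξ ≤ R := (Nat.le_ceil _).trans (by exact_mod_cast hR)
      simp [cutoff, this]
  simp only [← e, integral_zero] at lim
  have := lim.sqrt
  simpa [Real.sqrt_sq (norm_nonneg _)] using this

end Multipliers


/-! ### Paths attached to a solution. -/

section SolutionPaths

variable {n : ℕ}

theorem C1Path.sum {K ι : Type*} [NormedAddCommGroup K] [NormedSpace ℝ K] {T : ℝ} (S : Finset ι)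
    {p p' : ι → ℝ → K} (h : ∀ i, C1Path T (p i) (p' i)) :
    C1Path T (fun t => ∑ i ∈ S, p i t) (fun t => ∑ i ∈ S, p' i t) := by
  classical
  induction S using Finset.induction_on with
  | empty =>
    have hz : BddCont fun _ : ℝ => (0 : K) := ⟨continuous_const, 0, fun _ => by simp⟩
    simp only [Finset.sum_empty]
    exact ⟨hz, hz, fun t _ => hasDerivWithinAt_const _ _ _⟩
  | insert i S hi ih =>
    simp only [Finset.sum_insert hi]
    exact (h i).add ih

theorem BddCont.sum {K ι : Type*} [NormedAddCommGroup K] [NormedSpace ℝ K] (S : Finset ι)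
    {p : ι → ℝ → K} (h : ∀ i, BddCont (p i)) : BddCont (fun t => ∑ i ∈ S, p i t) := by
  classical
  induction S using Finset.induction_on with
  | empty =>
    simp only [Finset.sum_empty]
    exact ⟨continuous_const, 0, fun _ => by simp⟩
  | insert i S hi ih =>
    simp only [Finset.sum_insert hi]
    exact (h i).add ih

theorem BddCont.memInt {K : Type*} [NormedAddCommGroup K] [InnerProductSpace ℝ K] [CompleteSpace K]
    {h : ℝ → ℝ} (hh : IntegrableOn h (Ioi 0) volume) {p : ℝ → K} (hp : BddCont p) :
    BddCont (memInt h p) := by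
  obtain ⟨B, hB0, hB⟩ := hp.exists_nonneg
  refine ⟨continuous_memInt hh hp, ∫ s in Ioi (0 : ℝ), ‖h s‖ * (2 * B), fun t => ?_⟩
  refine norm_integral_le_of_norm_le (hh.norm.mul_const _) (ae_of_all _ fun s => ?_)
  rw [norm_smul]
  exact mul_le_mul_of_nonneg_left (hist_norm_le hB0 hB t s) (norm_nonneg _)

theorem c1Path_toR {T : ℝ} (hT : 0 ≤ T) {u y : ℝ → E n → ℝ} (hu : ContL2 T u) (hy : ContL2 T y)
    (hum : ∀ t ∈ Icc (0 : ℝ) T, MemLp (u t) 2 volume)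
    (hym : ∀ t ∈ Icc (0 : ℝ) T, MemLp (y t) 2 volume)
    (h : ∀ φ : E n → ℝ, ContDiff ℝ ∞ φ → HasCompactSupport φ → ∀ t ∈ Icc (0 : ℝ) T,
      HasDerivWithinAt (fun r => ∫ x, u r x * φ x) (∫ x, y t x * φ x) (Icc 0 T) t) :
    C1Path T (fun t => toR (u (clamp T t))) (fun t => toR (y (clamp T t))) := by
  refine c1Path_of_weak (hu.bddCont hT hum) (hy.bddCont hT hym) fun φ hφ hc t ht => ?_
  have e : ∀ {z : ℝ → E n → ℝ}, (∀ t ∈ Icc (0 : ℝ) T, MemLp (z t) 2 volume) → ∀ r ∈ Icc 0 T,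
      ∫ x, toR (z (clamp T r)) x * φ x = ∫ x, z r x * φ x := by
    intro z hz r hr
    rw [clamp_of_mem hr]
    refine integral_congr_ae ?_
    filter_upwards [toR_coe (hz r hr)] with x hx
    rw [hx]
  rw [e hym t ht]
  exact (h φ hφ hc t ht).congr (fun r hr => e hum r hr) (e hum t ht)

theorem bddCont_radL2 {T : ℝ} (hT : 0 ≤ T) {a m l : ℕ} {u : ℝ → E n → ℝ} {q : ℝ → E n → ℂ}
    (hq : ∀ t ∈ Icc 0 T, HasSymbol a m (u t) (q t)) (h1 : a ≤ l) (h2 : l ≤ m)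
    (hc : ∀ I : Fin l → Fin n, ContL2 T (fun t => wgrad l (u t) I)) :
    BddCont (fun t => radL2 l (q (clamp T t))) := by
  have hm : ∀ I : Fin l → Fin n, ∀ t ∈ Icc 0 T, MemLp (wgrad l (u t) I) 2 volume :=
    fun I t ht => (hq t ht).memLp l h1 h2 I
  have e : (fun t => radL2 l (q (clamp T t))) = fun t => ∑ I : Fin l → Fin n,
      (bddMult_symI I).op (ftL (toR (wgrad l (u (clamp T t)) I))) := by
    ext1 t
    rw [(hq _ (clamp_mem hT t)).radL2_eq_sum h1 h2]
    exact Finset.sum_congr rfl fun I _ => by rw [ftL_toR (hm I _ (clamp_mem hT t))]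
  rw [e]
  exact BddCont.sum _ fun I => (((hc I).bddCont hT (hm I)).clm ftL).clm _

theorem wlap_eq_sum (u : E n → ℝ) : wlap u = ∑ j, wgrad 2 u fun _ => j := by
  ext x
  simp only [wlap, Finset.sum_apply]
  rfl

theorem HasSymbol.memLp_wlap_self {a m : ℕ} (ha : a ≤ 2) (hm : 2 ≤ m) {u : E n → ℝ}
    {q : E n → ℂ} (h : HasSymbol a m u q) : MemLp (wlap u) 2 volume :=
  (h.memLp_wlap (κ := 0) (by omega) (by omega) Fin.elim0).1

theorem wlap_sub {a m : ℕ} (hm : 2 ≤ m) {u v : E n → ℝ} {q r : E n → ℂ}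
    (hu : HasSymbol a m u q) (hv : HasSymbol a m v r) :
    wlap (u - v) =ᵐ[volume] wlap u - wlap v := by
  have : ∀ j : Fin n, wgrad 2 (u - v) (fun _ => j) =ᵐ[volume]
      wgrad 2 u (fun _ => j) - wgrad 2 v fun _ => j := fun j => wgrad_sub hu.diff hv.diff hm _
  filter_upwards [ae_all_iff.2 this] with x hx
  simp only [wlap_eq_sum, Finset.sum_apply, Pi.sub_apply, hx, Finset.sum_sub_distrib]

theorem bddCont_toR_wlap {T : ℝ} (hT : 0 ≤ T) {a m : ℕ} (ha : a ≤ 2) (hm : 2 ≤ m)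
    {u : ℝ → E n → ℝ} {q : ℝ → E n → ℂ} (hq : ∀ t ∈ Icc 0 T, HasSymbol a m (u t) (q t))
    (hc : ∀ I : Fin 2 → Fin n, ContL2 T (fun t => wgrad 2 (u t) I)) :
    BddCont (fun t => toR (wlap (u (clamp T t)))) := by
  have hM : ∀ I : Fin 2 → Fin n, ∀ t ∈ Icc 0 T, MemLp (wgrad 2 (u t) I) 2 volume :=
    fun I t ht => (hq t ht).memLp 2 ha hm I
  have e : (fun t => toR (wlap (u (clamp T t))))
      = fun t => ∑ j, toR (wgrad 2 (u (clamp T t)) fun _ => j) := by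
    ext1 t
    rw [wlap_eq_sum, toR_sum _ fun j => hM (fun _ => j) _ (clamp_mem hT t)]
  rw [e]
  exact BddCont.sum _ fun j => (hc fun _ => j).bddCont hT (hM _)

variable {T τ b c k : ℝ} {g : ℝ → ℝ} {s : ℕ} {ψ₀ ψ₁ ψ₂ : E n → ℝ} {ψ v w : ℝ → E n → ℝ}
  {q : ℝ → E n → ℂ}

/-- Since ψ may fail to be in L², only its gradient is a path there. The equation ψ_t = v is tested
with -∂_iφ, which differentiates ∂_iψ weakly in time. -/
theorem IsSolution.c1Path_grad (hT : 0 ≤ T) (h : IsSolution (s + 1) τ b c k g T ψ₀ ψ₁ ψ₂ ψ v w)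
    (hq : ∀ t ∈ Icc 0 T, HasSymbol 1 (s + 1) (ψ t) (q t)) :
    C1Path T (fun t => radL2 1 (q (clamp T t))) (fun t => radL2 1 (ft (v (clamp T t)))) := by
  have hv : ∀ t ∈ Icc 0 T, HasSymbol 0 (s + 1) (v t) (ft (v t)) := fun t ht =>
    (h.cont_v.1 t ht).hasSymbol
  have e1 : (fun t => radL2 1 (q (clamp T t))) = fun t => ∑ I : Fin 1 → Fin n,
      (bddMult_symI I).op (ftL (toR (wgrad 1 (ψ (clamp T t)) I))) := by
    ext1 t
    have ht := clamp_mem hT t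
    rw [(hq _ ht).radL2_eq_sum le_rfl (by omega)]
    exact Finset.sum_congr rfl fun I _ => by
      rw [ftL_toR ((hq _ ht).memLp 1 le_rfl (by omega) I)]
  have e2 : (fun t => radL2 1 (ft (v (clamp T t)))) = fun t => ∑ I : Fin 1 → Fin n,
      (bddMult_symI I).op (ftL (toR (wgrad 1 (v (clamp T t)) I))) := by
    ext1 t
    have ht := clamp_mem hT t
    rw [(hv _ ht).radL2_eq_sum (by omega) (by omega)]
    exact Finset.sum_congr rfl fun I _ => by
      rw [ftL_toR ((hv _ ht).memLp 1 (by omega) (by omega) I)]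
  rw [e1, e2]
  refine C1Path.sum _ fun I => C1Path.clm (C1Path.clm ?_ ftL) _
  refine c1Path_toR (u := fun t => wgrad 1 (ψ t) I) (y := fun t => wgrad 1 (v t) I) hT
    (h.cont_ψ.2 1 le_rfl (by omega) I) (h.cont_v.2 1 (by omega) I)
    (fun t ht => (hq t ht).memLp 1 le_rfl (by omega) I)
    (fun t ht => (hv t ht).memLp 1 (by omega) (by omega) I) fun φ hφ hc t ht => ?_
  have ip : ∀ {u : E n → ℝ} {a : ℕ} {p : E n → ℂ}, HasSymbol a (s + 1) u p →
      ∫ x, wgrad 1 u I x * φ x = -∫ x, u x * fderiv ℝ φ x (EuclideanSpace.single (I 0) 1) := by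
    intro u a p hu
    have := (hu.diff 0 (by omega) Fin.elim0 (I 0)).hasWeakPartial.2.2 φ hφ hc
    exact (neg_eq_iff_eq_neg.2 this).symm
  have hd := (h.eq_ψ _ (contDiff_fderiv_single hφ (I 0))
    (hasCompactSupport_fderiv_single hc (I 0)) t ht).fun_neg
  rw [ip (hv t ht)]
  exact hd.congr (fun r hr => ip (hq r hr)) (ip (hq t ht))

theorem IsSolution.c1Path_v (hT : 0 ≤ T) (h : IsSolution (s + 1) τ b c k g T ψ₀ ψ₁ ψ₂ ψ v w) :
    C1Path T (fun t => toR (v (clamp T t))) (fun t => toR (w (clamp T t))) :=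
  c1Path_toR hT (h.cont_v.2 0 (by omega) Fin.elim0) (h.cont_w.2 0 (by omega) Fin.elim0)
    (fun t ht => (h.cont_v.1 t ht).memLp) (fun t ht => (h.cont_w.1 t ht).memLp) h.eq_v

theorem toR_wlap_history (hs : 1 ≤ s) (hq : ∀ t ∈ Icc 0 T, HasSymbol 1 (s + 1) (ψ t) (q t))
    {t r : ℝ} (ht : t ∈ Icc 0 T) (hr : 0 < r) :
    MemLp (wlap (history ψ t r)) 2 volume ∧
      toR (wlap (history ψ t r)) = hist (fun t => toR (wlap (ψ (clamp T t)))) t r := by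
  have hm : ∀ t ∈ Icc 0 T, MemLp (wlap (ψ t)) 2 volume := fun t ht =>
    (hq t ht).memLp_wlap_self (by omega) (by omega)
  unfold hist history
  beta_reduce
  split_ifs with h
  · have ht' : t - r ∈ Icc 0 T := ⟨by linarith, by linarith [ht.2]⟩
    have e := wlap_sub (by omega) (hq t ht) (hq (t - r) ht')
    have hM := (memLp_congr_ae e).2 ((hm t ht).sub (hm _ ht'))
    refine ⟨hM, ?_⟩
    rw [clamp_of_mem ht, clamp_of_mem ht', toR_congr hM e, toR_sub (hm t ht) (hm _ ht')]
  · rw [clamp_of_mem ht]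
    exact ⟨hm t ht, rfl⟩

theorem IsSolution.contSobolev_nonlin (hn : 0 < n) (hs : (n : ℝ) < 2 * s)
    (h : IsSolution (s + 1) τ b c k g T ψ₀ ψ₁ ψ₂ ψ v w) :
    ContSobolev T s (fun t => nonlin k (ψ t) (v t) (w t)) :=
  JMGT.contSobolev_nonlin hn hs h.cont_ψ h.cont_v h.cont_w

/-- All terms on the right are continuous in L², so the weak equation for w holds as an equation in
L². -/
theorem IsSolution.c1Path_w (hT : 0 ≤ T) (hτ : 0 < τ) (hn : 0 < n) (hs : (n : ℝ) < 2 * s)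
    (hs1 : 1 ≤ s) (hg : MemoryKernel c g) (h : IsSolution (s + 1) τ b c k g T ψ₀ ψ₁ ψ₂ ψ v w)
    (hq : ∀ t ∈ Icc 0 T, HasSymbol 1 (s + 1) (ψ t) (q t)) :
    C1Path T (fun t => toR (w (clamp T t))) (fun t => τ⁻¹ • (-toR (w (clamp T t))
      + cgSq c g • toR (wlap (ψ (clamp T t))) + b • toR (wlap (v (clamp T t)))
      + memInt g (fun t => toR (wlap (ψ (clamp T t)))) t
      + toR (nonlin k (ψ (clamp T t)) (v (clamp T t)) (w (clamp T t))))) := by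
  have hv : ∀ t ∈ Icc 0 T, HasSymbol 0 (s + 1) (v t) (ft (v t)) := fun t ht =>
    (h.cont_v.1 t ht).hasSymbol
  have hf := h.contSobolev_nonlin hn hs
  have hwm : ∀ t ∈ Icc 0 T, MemLp (w t) 2 volume := fun t ht => (h.cont_w.1 t ht).memLp
  have hW : BddCont (fun t => toR (w (clamp T t))) :=
    ContL2.bddCont hT (h.cont_w.2 0 (by omega) Fin.elim0) hwm
  have hF : BddCont (fun t => toR (nonlin k (ψ (clamp T t)) (v (clamp T t)) (w (clamp T t)))) :=
    ContL2.bddCont (u := fun t => nonlin k (ψ t) (v t) (w t)) hT (hf.2 0 (by omega) Fin.elim0)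
      (fun t ht => (hf.1 t ht).memLp)
  have hP : BddCont (fun t => toR (wlap (ψ (clamp T t)))) :=
    bddCont_toR_wlap hT (by omega) (by omega) hq (h.cont_ψ.2 2 (by omega) (by omega))
  have hQ : BddCont (fun t => toR (wlap (v (clamp T t)))) :=
    bddCont_toR_wlap hT (by omega) (by omega) hv (h.cont_v.2 2 (by omega))
  have hM : BddCont (JMGT.memInt g (fun t => toR (wlap (ψ (clamp T t))))) := hP.memInt hg.integrable
  refine c1Path_of_weak hW ?_ fun φ hφ hc t ht => ?_
  · refine BddCont.const_smul ?_ _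
    have hneg := hW.const_smul (-1)
    simp only [neg_one_smul] at hneg
    exact (((hneg.add (hP.const_smul _)).add (hQ.const_smul _)).add hM).add hF
  · have hm : MemLp φ 2 volume := hφ.continuous.memLp_of_hasCompactSupport hc
    have e : ∀ {z : E n → ℝ}, MemLp z 2 volume → ∫ x, z x * φ x = inner ℝ (toR φ) (toR z) := by
      intro z hz
      rw [inner_toR hm]
      refine integral_congr_ae ?_
      filter_upwards [toR_coe hz] with x hx
      rw [hx]
    have hd := (h.eq_w φ hφ hc t ht).const_mul τ⁻¹
    simp only [inv_mul_cancel_left₀ hτ.ne'] at hd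
    -- Pairing with φ is a bounded functional, so it commutes with the L²-valued memory integral.
    have emem : ∫ r in Ioi (0 : ℝ), g r * ∫ x, wlap (history ψ t r) x * φ x
        = inner ℝ (toR φ) (memInt g (fun t => toR (wlap (ψ (clamp T t)))) t) := by
      have := (innerSL ℝ (toR φ)).integral_comp_comm (integrable_memInt hg.integrable hP t)
      simp only [innerSL_apply_apply] at this
      rw [memInt, ← this]
      refine setIntegral_congr_fun measurableSet_Ioi fun r hr => ?_
      obtain ⟨h1, h2⟩ := toR_wlap_history hs1 hq ht hr
      rw [e h1, h2, inner_smul_right]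
    rw [e (hwm t ht), e ((hq t ht).memLp_wlap_self (by omega) (by omega)),
      e ((hv t ht).memLp_wlap_self (by omega) (by omega)), emem, e (hf.1 t ht).memLp] at hd
    have e2 : ∀ r ∈ Icc 0 T, ∫ x, toR (w (clamp T r)) x * φ x = ∫ x, w r x * φ x := by
      intro r hr
      rw [clamp_of_mem hr, e (hwm r hr), inner_toR hm]
    refine (hd.congr e2 (e2 t ht)).congr_deriv ?_
    rw [← inner_toR hm, inner_smul_right, clamp_of_mem ht]
    simp only [inner_add_right, inner_neg_right, inner_smul_right]

end SolutionPaths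


/-! ### The frequency-side energies and removal of the cut-off. -/

section SpecPaths

/-- The paths of the frequency side: `p, p₁` for the displacement, `v, v₁, v₂` for the velocity,
`w, w₁` for the acceleration and `f, f₁` for the source, the index being the number of additional
derivatives. -/
structure SpecPaths (K : Type*) where
  (p p₁ v v₁ v₂ w w₁ f f₁ : ℝ → K)

variable {K : Type*} [NormedAddCommGroup K] [InnerProductSpace ℝ K]

/-- All paths are bounded and continuous. -/
structure SpecPaths.Bdd (S : SpecPaths K) : Prop where
  p : BddCont S.p
  p₁ : BddCont S.p₁
  v : BddCont S.v
  v₁ : BddCont S.v₁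
  v₂ : BddCont S.v₂
  w : BddCont S.w
  w₁ : BddCont S.w₁
  f : BddCont S.f
  f₁ : BddCont S.f₁

/-- The image of the paths under an operator. -/
def SpecPaths.map (X : K →L[ℝ] K) (S : SpecPaths K) : SpecPaths K where
  p t := X (S.p t)
  p₁ t := X (S.p₁ t)
  v t := X (S.v t)
  v₁ t := X (S.v₁ t)
  v₂ t := X (S.v₂ t)
  w t := X (S.w t)
  w₁ t := X (S.w₁ t)
  f t := X (S.f t)
  f₁ t := X (S.f₁ t)

theorem SpecPaths.Bdd.map {S : SpecPaths K} (hS : S.Bdd) (X : K →L[ℝ] K) : (S.map X).Bdd :=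
  ⟨hS.p.clm X, hS.p₁.clm X, hS.v.clm X, hS.v₁.clm X, hS.v₂.clm X, hS.w.clm X, hS.w₁.clm X,
    hS.f.clm X, hS.f₁.clm X⟩

/-- The energy in terms of the frequency side. -/
noncomputable def SpecPaths.energy (τ : ℝ) (h : ℝ → ℝ) (S : SpecPaths K) (t : ℝ) : ℝ :=
  ‖S.p t + τ • S.v₁ t‖ ^ 2 + ‖S.v t + τ • S.w t‖ ^ 2 + ‖S.v₁ t‖ ^ 2 + memNormSq h S.p t
    + ‖S.w t‖ ^ 2 + ‖S.p₁ t + τ • S.v₂ t‖ ^ 2 + ‖S.v₁ t + τ • S.w₁ t‖ ^ 2 + ‖S.v₂ t‖ ^ 2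
    + memNormSq h S.p₁ t

/-- The dissipation in terms of the frequency side. -/
noncomputable def SpecPaths.dissipation (τ : ℝ) (h : ℝ → ℝ) (S : SpecPaths K) (t : ℝ) : ℝ :=
  ‖S.v₁ t‖ ^ 2 + memNormSq h S.p t + ‖S.p₁ t + τ • S.v₂ t‖ ^ 2 + ‖S.v₁ t + τ • S.w₁ t‖ ^ 2
    + ‖S.v₂ t‖ ^ 2 + memNormSq h S.p₁ t + ‖S.w t‖ ^ 2

/-- The pairings with the source in terms of the frequency side. -/
noncomputable def SpecPaths.pairings (τ : ℝ) (S : SpecPaths K) (t : ℝ) : ℝ :=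
  |inner ℝ (S.f t) (S.v t + τ • S.w t)| + |inner ℝ (S.f₁ t) (S.v₁ t + τ • S.w₁ t)|
    + |inner ℝ (S.f t) (S.w t)| + |inner ℝ (S.f₁ t) (S.p t + τ • S.v₁ t)|
    + |inner ℝ (S.f₁ t) (τ • S.v₁ t)|

variable {τ : ℝ} {h : ℝ → ℝ} {S : SpecPaths K}

theorem SpecPaths.continuous_energy (hh : AntitoneKernel h) (hS : S.Bdd) :
    Continuous (S.energy τ h) := by
  have := hS.p.cont
  have := hS.p₁.cont
  have := hS.v.cont
  have := hS.v₁.cont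
  have := hS.v₂.cont
  have := hS.w.cont
  have := hS.w₁.cont
  have := continuous_memNormSq hh.integrable hS.p
  have := continuous_memNormSq hh.integrable hS.p₁
  unfold SpecPaths.energy
  fun_prop

theorem SpecPaths.continuous_dissipation (hh : AntitoneKernel h) (hS : S.Bdd) :
    Continuous (S.dissipation τ h) := by
  have := hS.p.cont
  have := hS.p₁.cont
  have := hS.v₁.cont
  have := hS.v₂.cont
  have := hS.w.cont
  have := hS.w₁.cont
  have := continuous_memNormSq hh.integrable hS.p
  have := continuous_memNormSq hh.integrable hS.p₁
  unfold SpecPaths.dissipation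
  fun_prop

theorem SpecPaths.continuous_pairings (hS : S.Bdd) : Continuous (S.pairings τ) := by
  have := hS.p.cont
  have := hS.v.cont
  have := hS.v₁.cont
  have := hS.w.cont
  have := hS.w₁.cont
  have := hS.f.cont
  have := hS.f₁.cont
  unfold SpecPaths.pairings
  fun_prop

theorem SpecPaths.dissipation_nonneg (hh : AntitoneKernel h) (t : ℝ) : 0 ≤ S.dissipation τ h t := by
  have := memNormSq_nonneg hh S.p t
  have := memNormSq_nonneg hh S.p₁ t
  unfold SpecPaths.dissipation
  positivity

theorem SpecPaths.pairings_nonneg (t : ℝ) : 0 ≤ S.pairings τ t := by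
  unfold SpecPaths.pairings
  positivity

theorem memNormSq_clm_le (hh : AntitoneKernel h) {Z : ℝ → K} (hZ : BddCont Z) {X : K →L[ℝ] K}
    (hX : ∀ z, ‖X z‖ ≤ ‖z‖) (t : ℝ) : memNormSq h (fun t => X (Z t)) t ≤ memNormSq h Z t := by
  refine setIntegral_mono_on (integrable_memNormSq hh.integrable (hZ.clm X) t)
    (integrable_memNormSq hh.integrable hZ t) measurableSet_Ioi fun s hs => ?_
  have e : hist (fun t => X (Z t)) t s = X (hist Z t s) :=
    hist_map X.toLinearMap.toAddMonoidHom Z t s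
  rw [e]
  exact mul_le_mul_of_nonneg_left (pow_le_pow_left₀ (norm_nonneg _) (hX _) 2) (hh.nonneg s hs)

/-- Linear maps commute with forming the history, and contractivity supplies the majorant h‖η‖² for
dominated convergence. -/
theorem tendsto_memNormSq_clm (hh : AntitoneKernel h) {Z : ℝ → K} (hZ : BddCont Z)
    {X : ℕ → K →L[ℝ] K} (hX : ∀ R z, ‖X R z‖ ≤ ‖z‖)
    (hlim : ∀ z, Tendsto (fun R => X R z) atTop (𝓝 z)) (t : ℝ) :
    Tendsto (fun R => memNormSq h (fun t => X R (Z t)) t) atTop (𝓝 (memNormSq h Z t)) := by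
  have e : ∀ R s, hist (fun t => X R (Z t)) t s = X R (hist Z t s) := fun R s =>
    hist_map (X R).toLinearMap.toAddMonoidHom Z t s
  refine tendsto_integral_of_dominated_convergence (fun s => h s * ‖hist Z t s‖ ^ 2)
    (fun R => (integrable_memNormSq hh.integrable (hZ.clm (X R)) t).aestronglyMeasurable)
    (integrable_memNormSq hh.integrable hZ t) (fun R => ?_) (ae_of_all _ fun s => ?_)
  · filter_upwards [ae_restrict_mem measurableSet_Ioi] with s hs
    have := hh.nonneg s hs
    rw [e, Real.norm_of_nonneg (by positivity)]
    gcongr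
    exact hX R _
  · simp only [e]
    exact ((hlim _).norm.pow 2).const_mul _

theorem SpecPaths.dissipation_map_le (hh : AntitoneKernel h) (hS : S.Bdd) {X : K →L[ℝ] K}
    (hX : ∀ z, ‖X z‖ ≤ ‖z‖) (t : ℝ) : (S.map X).dissipation τ h t ≤ S.dissipation τ h t := by
  unfold SpecPaths.dissipation SpecPaths.map
  have h1 := memNormSq_clm_le hh hS.p hX t
  have h2 := memNormSq_clm_le hh hS.p₁ hX t
  simp only [← map_smul, ← map_add]
  gcongr <;> exact hX _

theorem SpecPaths.pairings_map_le {X : K →L[ℝ] K} (hX : ∀ z, ‖X z‖ ≤ ‖z‖) (t : ℝ) :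
    (S.map X).pairings τ t ≤ ‖S.f t‖ * ‖S.v t + τ • S.w t‖ + ‖S.f₁ t‖ * ‖S.v₁ t + τ • S.w₁ t‖
      + ‖S.f t‖ * ‖S.w t‖ + ‖S.f₁ t‖ * ‖S.p t + τ • S.v₁ t‖ + ‖S.f₁ t‖ * ‖τ • S.v₁ t‖ := by
  have key : ∀ a b : K, |inner ℝ (X a) (X b)| ≤ ‖a‖ * ‖b‖ := fun a b =>
    (abs_real_inner_le_norm _ _).trans
      (mul_le_mul (hX a) (hX b) (norm_nonneg _) (norm_nonneg _))
  unfold SpecPaths.pairings SpecPaths.map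
  simp only [← map_smul, ← map_add]
  gcongr <;> exact key _ _

/-- An estimate which is uniform for a sequence of contractions converging strongly to the identity
holds in the limit. -/
theorem SpecPaths.estimate_of_map (hh : AntitoneKernel h) (hS : S.Bdd) {X : ℕ → K →L[ℝ] K}
    (hX : ∀ R z, ‖X R z‖ ≤ ‖z‖) (hlim : ∀ z, Tendsto (fun R => X R z) atTop (𝓝 z)) {C t : ℝ}
    (hest : ∀ R, (S.map (X R)).energy τ h t + ∫ σ in (0 : ℝ)..t, (S.map (X R)).dissipation τ h σ
      ≤ C * ((S.map (X R)).energy τ h 0 + ∫ σ in (0 : ℝ)..t, (S.map (X R)).pairings τ σ)) :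
    S.energy τ h t + ∫ σ in (0 : ℝ)..t, S.dissipation τ h σ
      ≤ C * (S.energy τ h 0 + ∫ σ in (0 : ℝ)..t, S.pairings τ σ) := by
  have lp : ∀ t, Tendsto (fun R => memNormSq h (S.map (X R)).p t) atTop (𝓝 (memNormSq h S.p t)) :=
    tendsto_memNormSq_clm hh hS.p hX hlim
  have lp₁ : ∀ t, Tendsto (fun R => memNormSq h (S.map (X R)).p₁ t) atTop
      (𝓝 (memNormSq h S.p₁ t)) := tendsto_memNormSq_clm hh hS.p₁ hX hlim
  have limE : ∀ t, Tendsto (fun R => (S.map (X R)).energy τ h t) atTop (𝓝 (S.energy τ h t)) := by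
    intro t
    have n1 := ((hlim (S.p t)).add ((hlim (S.v₁ t)).const_smul τ)).norm.pow 2
    have n2 := ((hlim (S.v t)).add ((hlim (S.w t)).const_smul τ)).norm.pow 2
    have n3 := (hlim (S.v₁ t)).norm.pow 2
    have n5 := (hlim (S.w t)).norm.pow 2
    have n6 := ((hlim (S.p₁ t)).add ((hlim (S.v₂ t)).const_smul τ)).norm.pow 2
    have n7 := ((hlim (S.v₁ t)).add ((hlim (S.w₁ t)).const_smul τ)).norm.pow 2
    have n8 := (hlim (S.v₂ t)).norm.pow 2
    exact (((((((n1.add n2).add n3).add (lp t)).add n5).add n6).add n7).add n8).add (lp₁ t)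
  have limD : ∀ t, Tendsto (fun R => (S.map (X R)).dissipation τ h t) atTop
      (𝓝 (S.dissipation τ h t)) := by
    intro t
    have n3 := (hlim (S.v₁ t)).norm.pow 2
    have n5 := (hlim (S.w t)).norm.pow 2
    have n6 := ((hlim (S.p₁ t)).add ((hlim (S.v₂ t)).const_smul τ)).norm.pow 2
    have n7 := ((hlim (S.v₁ t)).add ((hlim (S.w₁ t)).const_smul τ)).norm.pow 2
    have n8 := (hlim (S.v₂ t)).norm.pow 2
    exact (((((n3.add (lp t)).add n6).add n7).add n8).add (lp₁ t)).add n5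
  have limP : ∀ t, Tendsto (fun R => (S.map (X R)).pairings τ t) atTop
      (𝓝 (S.pairings τ t)) := by
    intro t
    have n1 := (hlim (S.p t)).add ((hlim (S.v₁ t)).const_smul τ)
    have n2 := (hlim (S.v t)).add ((hlim (S.w t)).const_smul τ)
    have n7 := (hlim (S.v₁ t)).add ((hlim (S.w₁ t)).const_smul τ)
    have f := hlim (S.f t)
    have f₁ := hlim (S.f₁ t)
    exact (((((f.inner n2).abs.add (f₁.inner n7).abs).add (f.inner (hlim (S.w t))).abs).add
      (f₁.inner n1).abs).add (f₁.inner ((hlim (S.v₁ t)).const_smul τ)).abs)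
  have intD : Tendsto (fun R => ∫ σ in (0 : ℝ)..t, (S.map (X R)).dissipation τ h σ) atTop
      (𝓝 (∫ σ in (0 : ℝ)..t, S.dissipation τ h σ)) := by
    refine intervalIntegral.tendsto_integral_filter_of_dominated_convergence (S.dissipation τ h)
      (Eventually.of_forall fun R =>
        (SpecPaths.continuous_dissipation hh (hS.map (X R))).aestronglyMeasurable)
      (Eventually.of_forall fun R => ae_of_all _ fun σ _ => ?_)
      ((SpecPaths.continuous_dissipation hh hS).intervalIntegrable 0 t)
      (ae_of_all _ fun σ _ => limD σ)
    rw [Real.norm_of_nonneg (SpecPaths.dissipation_nonneg hh σ)]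
    exact SpecPaths.dissipation_map_le hh hS (hX R) σ
  have intP : Tendsto (fun R => ∫ σ in (0 : ℝ)..t, (S.map (X R)).pairings τ σ) atTop
      (𝓝 (∫ σ in (0 : ℝ)..t, S.pairings τ σ)) := by
    refine intervalIntegral.tendsto_integral_filter_of_dominated_convergence
      (fun t => ‖S.f t‖ * ‖S.v t + τ • S.w t‖ + ‖S.f₁ t‖ * ‖S.v₁ t + τ • S.w₁ t‖
      + ‖S.f t‖ * ‖S.w t‖ + ‖S.f₁ t‖ * ‖S.p t + τ • S.v₁ t‖ + ‖S.f₁ t‖ * ‖τ • S.v₁ t‖)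
      (Eventually.of_forall fun R =>
        (SpecPaths.continuous_pairings (hS.map (X R))).aestronglyMeasurable)
      (Eventually.of_forall fun R => ae_of_all _ fun σ _ => ?_)
      (Continuous.intervalIntegrable ?_ 0 t)
      (ae_of_all _ fun σ _ => limP σ)
    · rw [Real.norm_of_nonneg (SpecPaths.pairings_nonneg σ)]
      exact SpecPaths.pairings_map_le (hX R) σ
    · have := hS.p.cont
      have := hS.v.cont
      have := hS.v₁.cont
      have := hS.w.cont
      have := hS.w₁.cont
      have := hS.f.cont
      have := hS.f₁.cont
      fun_prop
  exact le_of_tendsto_of_tendsto' ((limE t).add intD) (((limE 0).add intP).const_mul C) hest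

end SpecPaths


/-! ### Truncated solutions solve the abstract system. -/

section SolutionEstimate

variable {n : ℕ} {T τ b c k : ℝ} {g : ℝ → ℝ} {s κ : ℕ} {ψ₀ ψ₁ ψ₂ : E n → ℝ}
  {ψ v w : ℝ → E n → ℝ} {q : ℝ → E n → ℂ}

theorem radL2_add {κ : ℕ} {q r : E n → ℂ} (hq : MemLp (fun ξ => (rad ξ : ℂ) ^ κ * q ξ) 2 volume)
    (hr : MemLp (fun ξ => (rad ξ : ℂ) ^ κ * r ξ) 2 volume) :
    radL2 κ (q + r) = radL2 κ q + radL2 κ r := by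
  have e : (fun ξ => (rad ξ : ℂ) ^ κ * (q + r) ξ)
      = (fun ξ => (rad ξ : ℂ) ^ κ * q ξ) + fun ξ => (rad ξ : ℂ) ^ κ * r ξ := by
    ext ξ; simp [mul_add]
  apply Lp.ext
  have h := toL2_coe (hq.add hr)
  rw [← e] at h
  filter_upwards [h, toL2_coe hq, toL2_coe hr, Lp.coeFn_add (radL2 κ q) (radL2 κ r)]
    with ξ h1 h2 h3 h4
  rw [h4, Pi.add_apply]
  simp only [radL2] at *
  rw [h1, h2, h3, Pi.add_apply, mul_add]

theorem radL2_smul {κ : ℕ} {q : E n → ℂ} (hq : MemLp (fun ξ => (rad ξ : ℂ) ^ κ * q ξ) 2 volume)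
    (a : ℝ) : radL2 κ (a • q) = a • radL2 κ q := by
  have e : (fun ξ => (rad ξ : ℂ) ^ κ * (a • q) ξ)
      = a • fun ξ => (rad ξ : ℂ) ^ κ * q ξ := by
    ext ξ; simp [mul_left_comm]
  apply Lp.ext
  have h := toL2_coe (hq.const_smul a)
  rw [← e] at h
  filter_upwards [h, toL2_coe hq, Lp.coeFn_smul a (radL2 κ q)] with ξ h1 h2 h4
  rw [h4, Pi.smul_apply]
  simp only [radL2] at *
  rw [h1, h2, Pi.smul_apply, mul_smul_comm]

theorem HasSymbol.radL2_add_smul {a m a' m' κ : ℕ} {u v : E n → ℝ} {q r : E n → ℂ}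
    (hu : HasSymbol a m u q) (hv : HasSymbol a' m' v r) (h1 : a ≤ κ) (h2 : κ ≤ m) (h1' : a' ≤ κ)
    (h2' : κ ≤ m') (τ : ℝ) : radL2 κ (q + τ • r) = radL2 κ q + τ • radL2 κ r := by
  rw [radL2_add (hu.memLp_rad h1 h2) ((hv.smul τ).memLp_rad h1' h2'),
    radL2_smul (hv.memLp_rad h1' h2')]

/-- The frequency side of the derivatives of order `κ` of a solution. -/
noncomputable def specPaths (T k : ℝ) (κ : ℕ) (ψ v w : ℝ → E n → ℝ) (q : ℝ → E n → ℂ) :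
    SpecPaths (HC n) where
  p t := radL2 (κ + 1) (q (clamp T t))
  p₁ t := radL2 (κ + 2) (q (clamp T t))
  v t := radL2 κ (ft (v (clamp T t)))
  v₁ t := radL2 (κ + 1) (ft (v (clamp T t)))
  v₂ t := radL2 (κ + 2) (ft (v (clamp T t)))
  w t := radL2 κ (ft (w (clamp T t)))
  w₁ t := radL2 (κ + 1) (ft (w (clamp T t)))
  f t := radL2 κ (ft (nonlin k (ψ (clamp T t)) (v (clamp T t)) (w (clamp T t))))
  f₁ t := radL2 (κ + 1) (ft (nonlin k (ψ (clamp T t)) (v (clamp T t)) (w (clamp T t))))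

theorem IsSolution.bdd_specPaths (hT : 0 ≤ T) (hn : 0 < n) (hs : (n : ℝ) < 2 * s)
    (h : IsSolution (s + 1) τ b c k g T ψ₀ ψ₁ ψ₂ ψ v w)
    (hq : ∀ t ∈ Icc 0 T, HasSymbol 1 (s + 1) (ψ t) (q t)) (hκ : κ + 1 ≤ s) :
    (specPaths T k κ ψ v w q).Bdd := by
  have hv : ∀ t ∈ Icc 0 T, HasSymbol 0 (s + 1) (v t) (ft (v t)) := fun t ht =>
    (h.cont_v.1 t ht).hasSymbol
  have hw : ∀ t ∈ Icc 0 T, HasSymbol 0 s (w t) (ft (w t)) := fun t ht =>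
    (h.cont_w.1 t ht).hasSymbol
  have hF := h.contSobolev_nonlin hn hs
  have hf : ∀ t ∈ Icc 0 T, HasSymbol 0 s (nonlin k (ψ t) (v t) (w t))
      (ft (nonlin k (ψ t) (v t) (w t))) := fun t ht => (hF.1 t ht).hasSymbol
  have hwc : ContSobolev T s w := h.cont_w
  exact ⟨bddCont_radL2 (q := q) hT hq (by omega) (by omega) (h.cont_ψ.2 _ (by omega) (by omega)),
    bddCont_radL2 (q := q) hT hq (by omega) (by omega) (h.cont_ψ.2 _ (by omega) (by omega)),
    bddCont_radL2 (q := fun t => ft (v t)) hT hv (by omega) (by omega) (h.cont_v.2 _ (by omega)),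
    bddCont_radL2 (q := fun t => ft (v t)) hT hv (by omega) (by omega) (h.cont_v.2 _ (by omega)),
    bddCont_radL2 (q := fun t => ft (v t)) hT hv (by omega) (by omega) (h.cont_v.2 _ (by omega)),
    bddCont_radL2 (q := fun t => ft (w t)) hT hw (by omega) (by omega) (hwc.2 _ (by omega)),
    bddCont_radL2 (q := fun t => ft (w t)) hT hw (by omega) (by omega) (hwc.2 _ (by omega)),
    bddCont_radL2 (q := fun t => ft (nonlin k (ψ t) (v t) (w t))) hT hf (by omega) (by omega) (hF.2 _ (by omega)),
    bddCont_radL2 (q := fun t => ft (nonlin k (ψ t) (v t) (w t))) hT hf (by omega) (by omega) (hF.2 _ (by omega))⟩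

/-- The Laplacian has symbol -rad². This minus sign gives the signs of the elliptic terms in the
abstract equation. -/
theorem cutOp_wlap {a m : ℕ} (R κ : ℕ) (ha : a ≤ 1) (hm : 2 ≤ m) {u : E n → ℝ} {q : E n → ℂ}
    {f : HC n} {l l' : ℕ} (h : HasSymbol a m u q)
    (hf : f =ᵐ[volume] fun ξ => (rad ξ : ℂ) ^ l * q ξ) (e : κ + 2 = l' + l) :
    cutOp R κ (ftL (toR (wlap u))) = -cutOp R l' f := by
  obtain ⟨h1, h2⟩ := h.memLp_wlap (κ := 0) (by omega) (by omega) Fin.elim0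
  have e1 : (-(ft (wlap u)) : HC n) =ᵐ[volume] fun ξ => (rad ξ : ℂ) ^ 2 * q ξ := by
    filter_upwards [h2, Lp.coeFn_neg (ft (wlap u))] with ξ e1 e2
    rw [e2, Pi.neg_apply]
    refine (congrArg _ e1).trans ?_
    simp [symI]
  have := cutOp_eq (R := R) e e1 hf
  rw [map_neg] at this
  have e2 : ftL (toR (wlap u)) = ft (wlap u) := ftL_toR h1
  rw [e2, ← this, neg_neg]

/-- The frequency cut-offs of the derivatives of a solution solve the abstract system. -/
theorem IsSolution.abstractSolution (hT : 0 ≤ T) (hτ : 0 < τ) (hn : 0 < n) (hs : (n : ℝ) < 2 * s)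
    (hs1 : 1 ≤ s) (hg : MemoryKernel c g) (h : IsSolution (s + 1) τ b c k g T ψ₀ ψ₁ ψ₂ ψ v w)
    (hq : ∀ t ∈ Icc 0 T, HasSymbol 1 (s + 1) (ψ t) (q t)) (R κ : ℕ) :
    ∃ w', AbstractSolution T τ b c g (cutOp R 1)
      (fun t => cutOp R κ (radL2 1 (q (clamp T t)))) (fun t => cutOp R κ (ft (v (clamp T t))))
      (fun t => cutOp R κ (ft (w (clamp T t)))) w'
      (fun t => cutOp R κ (ft (nonlin k (ψ (clamp T t)) (v (clamp T t)) (w (clamp T t))))) := by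
  have hv : ∀ t ∈ Icc 0 T, HasSymbol 0 (s + 1) (v t) (ft (v t)) := fun t ht =>
    (h.cont_v.1 t ht).hasSymbol
  have hF := h.contSobolev_nonlin hn hs
  have e0 : ∀ {m : ℕ} {u : ℝ → E n → ℝ}, (∀ t ∈ Icc 0 T, MemSobolev m (u t)) →
      ∀ t, ftL (toR (u (clamp T t))) = ft (u (clamp T t)) := fun hu t =>
    ftL_toR (hu _ (clamp_mem hT t)).memLp
  have ev : ∀ t, ftL (toR (v (clamp T t))) = ft (v (clamp T t)) := e0 (u := v) h.cont_v.1
  have ew : ∀ t, ftL (toR (w (clamp T t))) = ft (w (clamp T t)) := e0 (u := w) h.cont_w.1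
  have ef : ∀ t, ftL (toR (nonlin k (ψ (clamp T t)) (v (clamp T t)) (w (clamp T t))))
      = ft (nonlin k (ψ (clamp T t)) (v (clamp T t)) (w (clamp T t))) := e0 (u := fun t => nonlin k (ψ t) (v t) (w t)) hF.1
  have cv : ∀ t, ft (v (clamp T t)) =ᵐ[volume] fun ξ => (rad ξ : ℂ) ^ 0 * ft (v (clamp T t)) ξ :=
    fun t => ae_of_all _ fun ξ => by simp
  obtain ⟨w', hw', pw⟩ : ∃ w', w' = _ ∧ C1Path T _ w' :=
    ⟨_, rfl, ((h.c1Path_w hT hτ hn hs hs1 hg hq).clm ftL).clm (cutOp R κ)⟩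
  simp only [ew] at pw
  have symm : ∀ x y : HC n, (inner ℝ (cutOp R 1 x) y : ℝ) = inner ℝ x (cutOp R 1 y) :=
    cutOp_symm R 1
  refine ⟨w', symm, ?_, ?_, pw, ?_, fun t _ => ?_⟩
  · have := (h.c1Path_grad hT hq).clm (cutOp R κ)
    have e : ∀ t, cutOp R κ (radL2 1 (ft (v (clamp T t))))
        = cutOp R 1 (cutOp R κ (ft (v (clamp T t)))) := by
      intro t
      rw [cutOp_cutOp]
      exact cutOp_eq (by omega) ((hv _ (clamp_mem hT t)).radL2_coe (by omega) (by omega)) (cv t)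
    simpa only [e] using this
  · have := ((h.c1Path_v hT).clm ftL).clm (cutOp R κ)
    simpa only [ev, ew] using this
  · have := ((ContL2.bddCont (u := fun t => nonlin k (ψ t) (v t) (w t)) hT
      (hF.2 0 (by omega) Fin.elim0) (fun t ht => (hF.1 t ht).memLp)).clm ftL).clm (cutOp R κ)
    simpa only [ef] using this
  · have hP : BddCont (fun t => toR (wlap (ψ (clamp T t)))) :=
      bddCont_toR_wlap hT (by omega) (by omega) hq (h.cont_ψ.2 2 (by omega) (by omega))
    have lap1 : ∀ t, cutOp R κ (ftL (toR (wlap (ψ (clamp T t)))))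
        = (-cutOp R 1) (cutOp R κ (radL2 1 (q (clamp T t)))) := by
      intro t
      have hqt := hq _ (clamp_mem hT t)
      rw [_root_.neg_apply, cutOp_cutOp]
      exact cutOp_wlap R κ (by omega) (by omega) hqt (hqt.radL2_coe le_rfl (by omega)) (by omega)
    have lap2 : cutOp R κ (ftL (toR (wlap (v (clamp T t)))))
        = -cutOp R 1 (cutOp R 1 (cutOp R κ (ft (v (clamp T t))))) := by
      rw [cutOp_cutOp, cutOp_cutOp]
      exact cutOp_wlap R κ (by omega) (by omega) (hv _ (clamp_mem hT t)) (cv t) (by omega)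
    have pD : BddCont (fun t => cutOp R κ (radL2 1 (q (clamp T t)))) :=
      (h.c1Path_grad hT hq).left.clm _
    -- The memory integral of Δη is pushed through the cut-off, one factor of G is extracted, and
    -- the remaining integral is that of the history of p = Gψ.
    have emem : cutOp R κ (ftL (memInt g (fun t => toR (wlap (ψ (clamp T t)))) t))
        = -cutOp R 1 (memInt g (fun t => cutOp R κ (radL2 1 (q (clamp T t)))) t) := by
      have e1 := memInt_map hg.integrable hP ((cutOp R κ).comp ftL) t
      have e2 := memInt_map hg.integrable pD (-cutOp R 1) t
      simp only [ContinuousLinearMap.comp_apply, lap1] at e1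
      rw [← e1, e2]
      rfl
    rw [hw']
    simp only [map_smul, map_add, map_neg, smul_inv_smul₀ hτ.ne', ew, ef, emem, lap1, lap2]
    simp only [_root_.neg_apply, smul_neg, sub_eq_add_neg]

end SolutionEstimate


/-! ### Translating the estimate back to the original energies. -/

section SolutionEnergies

variable {n : ℕ} {T τ b c k : ℝ} {g : ℝ → ℝ} {s κ : ℕ} {ψ₀ ψ₁ ψ₂ : E n → ℝ}
  {ψ v w : ℝ → E n → ℝ} {q : ℝ → E n → ℂ}

/-- The estimate of a solution on the frequency side. -/
theorem IsSolution.specPaths_estimate (hT : 0 ≤ T) (hτ : 0 < τ) (hn : 0 < n)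
    (hs : (n : ℝ) < 2 * s) (hg : MemoryKernel c g)
    (h : IsSolution (s + 1) τ b c k g T ψ₀ ψ₁ ψ₂ ψ v w)
    (hq : ∀ t ∈ Icc 0 T, HasSymbol 1 (s + 1) (ψ t) (q t)) (hκ : κ + 1 ≤ s) {C : ℝ}
    (hC : ∀ (G : HC n →L[ℝ] HC n) (p v w w' f : ℝ → HC n),
      AbstractSolution T τ b c g G p v w w' f →
      ∀ t ∈ Icc 0 T, absEnergy τ g G p v w t + ∫ σ in (0 : ℝ)..t, absDissipation τ g G p v w σ
        ≤ C * (absEnergy τ g G p v w 0 + ∫ σ in (0 : ℝ)..t, absPairings τ G p v w f σ))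
    {t : ℝ} (ht : t ∈ Icc 0 T) :
    (specPaths T k κ ψ v w q).energy τ (fun s => -deriv g s) t
        + ∫ σ in (0 : ℝ)..t, (specPaths T k κ ψ v w q).dissipation τ (fun s => -deriv g s) σ
      ≤ C * ((specPaths T k κ ψ v w q).energy τ (fun s => -deriv g s) 0
        + ∫ σ in (0 : ℝ)..t, (specPaths T k κ ψ v w q).pairings τ σ) := by
  have hF := h.contSobolev_nonlin hn hs
  refine SpecPaths.estimate_of_map hg.antitoneKernel_neg_deriv (h.bdd_specPaths hT hn hs hq hκ)
    (X := fun R => cutOp R 0) norm_cutOp_zero_le tendsto_cutOp_zero fun R => ?_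
  obtain ⟨w', hw'⟩ := h.abstractSolution hT hτ hn hs (by omega) hg hq R κ
  have key := hC _ _ _ _ _ _ hw' t ht
  -- The powers of G in the abstract energy are converted into the projection applied to `radL2` of
  -- the corresponding order. The offset 1 arises because p already contains one derivative of ψ.
  have ep : ∀ t l, l + κ ≤ s → cutOp R l (cutOp R κ (radL2 1 (q (clamp T t))))
      = cutOp R 0 (radL2 (κ + l + 1) (q (clamp T t))) := by
    intro t l hl
    have hqt := hq _ (clamp_mem hT t)
    rw [cutOp_cutOp]
    exact cutOp_eq (by omega) (hqt.radL2_coe le_rfl (by omega))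
      (hqt.radL2_coe (by omega) (by omega))
  have es : ∀ {m : ℕ} {u : E n → ℝ}, MemSobolev m u → ∀ l, l + κ ≤ m →
      cutOp R l (cutOp R κ (ft u)) = cutOp R 0 (radL2 (κ + l) (ft u)) := by
    intro m u hu l hl
    rw [cutOp_cutOp]
    exact cutOp_eq (l := 0) (q := ft u) (by omega) (ae_of_all _ fun ξ => by simp)
      (hu.hasSymbol.radL2_coe (by omega) (by omega))
  have c0 : ∀ f : HC n, cutOp R 0 (cutOp R κ f) = cutOp R κ f := fun f => by
    rw [cutOp_cutOp, zero_add]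
  have ep0 : ∀ t, cutOp R κ (radL2 1 (q (clamp T t)))
      = cutOp R 0 (radL2 (κ + 1) (q (clamp T t))) := fun t => by
    rw [← c0, ep t 0 (by omega)]
  have es0 : ∀ {m : ℕ} {u : E n → ℝ}, MemSobolev m u → κ ≤ m →
      cutOp R κ (ft u) = cutOp R 0 (radL2 κ (ft u)) := fun {m u} hu hm => by
    rw [← c0, es hu 0 (by omega)]; rfl
  have v0 := fun t => es0 (h.cont_v.1 _ (clamp_mem hT t)) (by omega)
  have v1 := fun t => es (h.cont_v.1 _ (clamp_mem hT t)) 1 (by omega)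
  have v2 : ∀ t, cutOp R 1 (cutOp R 1 (cutOp R κ (ft (v (clamp T t)))))
      = cutOp R 0 (radL2 (κ + 2) (ft (v (clamp T t)))) := fun t => by
    rw [cutOp_cutOp R 1 1]
    exact es (h.cont_v.1 _ (clamp_mem hT t)) 2 (by omega)
  have w0 := fun t => es0 (m := s) (h.cont_w.1 _ (clamp_mem hT t)) (by omega)
  have w1 := fun t => es (m := s) (h.cont_w.1 _ (clamp_mem hT t)) 1 (by omega)
  have f0 := fun t => es0 (hF.1 _ (clamp_mem hT t)) (by omega)
  have f1 := fun t => es (hF.1 _ (clamp_mem hT t)) 1 (by omega)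
  have p1 : ∀ t, cutOp R 1 (cutOp R κ (radL2 1 (q (clamp T t))))
      = cutOp R 0 (radL2 (κ + 2) (q (clamp T t))) := fun t => ep t 1 (by omega)
  simp only [absEnergy, absDissipation, absPairings, map_add, map_smul, v2] at key
  simp only [v1, w1, f1, p1] at key
  simp only [ep0, v0, w0, f0] at key
  exact key

/-- The history of ψ and the abstract history of its frequency path have the same two branches, and
in each of them the symbol is linear in ψ. Only times in [0, T] occur, so clamping has no effect. -/
theorem history_radL2 {l : ℕ} (hl : 1 ≤ l) (hls : l ≤ s + 1)
    (hq : ∀ t ∈ Icc 0 T, HasSymbol 1 (s + 1) (ψ t) (q t)) {t r : ℝ} (ht : t ∈ Icc 0 T)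
    (hr : 0 < r) : ∃ p, HasSymbol 1 (s + 1) (history ψ t r) p ∧
      radL2 l p = hist (fun t => radL2 l (q (clamp T t))) t r := by
  unfold hist history
  beta_reduce
  split_ifs with h
  · have ht' : t - r ∈ Icc 0 T := ⟨by linarith, by linarith [ht.2]⟩
    refine ⟨_, (hq t ht).sub (hq _ ht'), ?_⟩
    rw [clamp_of_mem ht, clamp_of_mem ht', sub_eq_add_neg, ← neg_one_smul ℝ,
      (hq t ht).radL2_add_smul (hq _ ht') hl hls hl hls, neg_one_smul, ← sub_eq_add_neg]
  · rw [clamp_of_mem ht]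
    exact ⟨_, hq t ht, rfl⟩

theorem memSq_gradSq_history (hκ : κ ≤ s) (hq : ∀ t ∈ Icc 0 T, HasSymbol 1 (s + 1) (ψ t) (q t))
    {t : ℝ} (ht : t ∈ Icc 0 T) :
    memSq g (fun r => gradSq (κ + 1) (history ψ t r))
      = memNormSq (fun s => -deriv g s) (fun t => radL2 (κ + 1) (q (clamp T t))) t := by
  refine setIntegral_congr_fun measurableSet_Ioi fun r hr => ?_
  obtain ⟨p, hp, e⟩ := history_radL2 (l := κ + 1) (by omega) (by omega) hq ht hr
  beta_reduce
  rw [hp.gradSq_eq (by omega) (by omega), e]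

theorem memSq_lapGradSq_history (hκ : κ + 1 ≤ s)
    (hq : ∀ t ∈ Icc 0 T, HasSymbol 1 (s + 1) (ψ t) (q t)) {t : ℝ} (ht : t ∈ Icc 0 T) :
    memSq g (fun r => lapGradSq κ (history ψ t r))
      = memNormSq (fun s => -deriv g s) (fun t => radL2 (κ + 2) (q (clamp T t))) t := by
  refine setIntegral_congr_fun measurableSet_Ioi fun r hr => ?_
  obtain ⟨p, hp, e⟩ := history_radL2 (l := κ + 2) (by omega) (by omega) hq ht hr
  beta_reduce
  rw [hp.lapGradSq_eq (by omega) (by omega), e]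

theorem IsSolution.energy_eq (h : IsSolution (s + 1) τ b c k g T ψ₀ ψ₁ ψ₂ ψ v w)
    (hq : ∀ t ∈ Icc 0 T, HasSymbol 1 (s + 1) (ψ t) (q t)) (hκ : κ + 1 ≤ s) {t : ℝ}
    (ht : t ∈ Icc 0 T) :
    energy τ g κ (ψ t) (v t) (w t) (history ψ t)
      = (specPaths T k κ ψ v w q).energy τ (fun s => -deriv g s) t := by
  have hv := (h.cont_v.1 t ht).hasSymbol
  have hw : HasSymbol 0 s (w t) (ft (w t)) := MemSobolev.hasSymbol (h.cont_w.1 t ht)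
  have hψv := (hq t ht).add ((hv.mono zero_le_one le_rfl).smul τ)
  have hvw := (hv.mono le_rfl (Nat.le_succ s)).add (hw.smul τ)
  unfold energy SpecPaths.energy
  rw [memSq_gradSq_history (by omega) hq ht, memSq_lapGradSq_history hκ hq ht,
    hψv.gradSq_eq (by omega) (by omega), hvw.gradSq_eq (by omega) (by omega),
    hv.gradSq_eq (by omega) (by omega), hw.gradSq_eq (by omega) (by omega),
    hψv.lapGradSq_eq (by omega) (by omega), hvw.gradSq_eq (by omega) (by omega),
    hv.lapGradSq_eq (by omega) (by omega),
    (hq t ht).radL2_add_smul hv (by omega) (by omega) (by omega) (by omega),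
    (hq t ht).radL2_add_smul hv (by omega) (by omega) (by omega) (by omega),
    hv.radL2_add_smul hw (by omega) (by omega) (by omega) (by omega),
    hv.radL2_add_smul hw (by omega) (by omega) (by omega) (by omega)]
  simp only [specPaths, clamp_of_mem ht]

theorem IsSolution.dissipation_eq (h : IsSolution (s + 1) τ b c k g T ψ₀ ψ₁ ψ₂ ψ v w)
    (hq : ∀ t ∈ Icc 0 T, HasSymbol 1 (s + 1) (ψ t) (q t)) (hκ : κ + 1 ≤ s) {t : ℝ}
    (ht : t ∈ Icc 0 T) :
    dissipation τ g κ (ψ t) (v t) (w t) (history ψ t)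
      = (specPaths T k κ ψ v w q).dissipation τ (fun s => -deriv g s) t := by
  have hv := (h.cont_v.1 t ht).hasSymbol
  have hw : HasSymbol 0 s (w t) (ft (w t)) := MemSobolev.hasSymbol (h.cont_w.1 t ht)
  have hψv := (hq t ht).add ((hv.mono zero_le_one le_rfl).smul τ)
  have hvw := (hv.mono le_rfl (Nat.le_succ s)).add (hw.smul τ)
  unfold dissipation SpecPaths.dissipation
  rw [memSq_gradSq_history (by omega) hq ht, memSq_lapGradSq_history hκ hq ht,
    hv.gradSq_eq (by omega) (by omega), hw.gradSq_eq (by omega) (by omega),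
    hψv.lapGradSq_eq (by omega) (by omega), hvw.gradSq_eq (by omega) (by omega),
    hv.lapGradSq_eq (by omega) (by omega),
    (hq t ht).radL2_add_smul hv (by omega) (by omega) (by omega) (by omega),
    hv.radL2_add_smul hw (by omega) (by omega) (by omega) (by omega)]
  simp only [specPaths, clamp_of_mem ht]

theorem IsSolution.nonlinearPairings_eq (hn : 0 < n) (hs : (n : ℝ) < 2 * s)
    (h : IsSolution (s + 1) τ b c k g T ψ₀ ψ₁ ψ₂ ψ v w)
    (hq : ∀ t ∈ Icc 0 T, HasSymbol 1 (s + 1) (ψ t) (q t)) (hκ : κ + 1 ≤ s) {t : ℝ}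
    (ht : t ∈ Icc 0 T) :
    nonlinearPairings τ k κ (ψ t) (v t) (w t) = (specPaths T k κ ψ v w q).pairings τ t := by
  have hv := (h.cont_v.1 t ht).hasSymbol
  have hw : HasSymbol 0 s (w t) (ft (w t)) := MemSobolev.hasSymbol (h.cont_w.1 t ht)
  have hf := ((h.contSobolev_nonlin hn hs).1 t ht).hasSymbol
  have hψv := (hq t ht).add ((hv.mono zero_le_one le_rfl).smul τ)
  have hvw := (hv.mono le_rfl (Nat.le_succ s)).add (hw.smul τ)
  unfold nonlinearPairings SpecPaths.pairings
  rw [hf.pair0_eq hvw (by omega) (by omega) (by omega),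
    hf.pair1_eq hvw (by omega) (by omega) (by omega),
    hf.pair0_eq hw (by omega) (by omega) (by omega),
    hf.pair1_eq hψv (by omega) (by omega) (by omega),
    hf.pair1_smul_eq τ hv (by omega) (by omega) (by omega),
    (hq t ht).radL2_add_smul hv (by omega) (by omega) (by omega) (by omega),
    hv.radL2_add_smul hw (by omega) (by omega) (by omega) (by omega),
    hv.radL2_add_smul hw (by omega) (by omega) (by omega) (by omega)]
  simp only [specPaths, clamp_of_mem ht]

theorem gradSq_congr {u u' : E n → ℝ} (h : u =ᵐ[volume] u') (κ : ℕ) : gradSq κ u = gradSq κ u' :=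
  Finset.sum_congr rfl fun I _ => integral_congr_ae
    ((wgrad_congr h κ I).mono fun x hx => by beta_reduce; rw [hx])

theorem lapGradSq_congr {u u' : E n → ℝ} (h : u =ᵐ[volume] u') (κ : ℕ) :
    lapGradSq κ u = lapGradSq κ u' := by
  refine Finset.sum_congr rfl fun I _ => integral_congr_ae ?_
  have : ∀ j : Fin n, wpartial j (wpartial j (wgrad κ u I)) =ᵐ[volume]
      wpartial j (wpartial j (wgrad κ u' I)) := fun j =>
    wpartial_congr (wpartial_congr (wgrad_congr h κ I))
  filter_upwards [ae_all_iff.2 this] with x hx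
  simp only [wlap, hx]

/-- At time 0 every positive age falls in the branch s > t, where the history is ψ(0). The data
agree only almost everywhere, which the energies do not see. -/
theorem IsSolution.energy_init (h : IsSolution (s + 1) τ b c k g T ψ₀ ψ₁ ψ₂ ψ v w) :
    energy τ g κ (ψ 0) (v 0) (w 0) (history ψ 0) = energy τ g κ ψ₀ ψ₁ ψ₂ (fun _ => ψ₀) := by
  have e1 : ψ 0 + τ • v 0 =ᵐ[volume] ψ₀ + τ • ψ₁ := h.init_ψ.add (h.init_v.const_smul τ)
  have e2 : v 0 + τ • w 0 =ᵐ[volume] ψ₁ + τ • ψ₂ := h.init_v.add (h.init_w.const_smul τ)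
  have eh : ∀ r ∈ Ioi (0 : ℝ), history ψ 0 r = ψ 0 := fun r hr => by
    unfold history
    rw [if_neg (not_le.2 hr)]
  have m1 : memSq g (fun r => gradSq (κ + 1) (history ψ 0 r))
      = memSq g (fun _ => gradSq (κ + 1) ψ₀) :=
    setIntegral_congr_fun measurableSet_Ioi fun r hr => by
      beta_reduce
      rw [eh r hr, gradSq_congr h.init_ψ]
  have m2 : memSq g (fun r => lapGradSq κ (history ψ 0 r)) = memSq g (fun _ => lapGradSq κ ψ₀) :=
    setIntegral_congr_fun measurableSet_Ioi fun r hr => by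
      beta_reduce
      rw [eh r hr, lapGradSq_congr h.init_ψ]
  unfold energy
  rw [m1, m2, gradSq_congr e1, gradSq_congr e2, gradSq_congr h.init_v, gradSq_congr h.init_w,
    lapGradSq_congr e1, gradSq_congr e2, lapGradSq_congr h.init_v]

end SolutionEnergies

end JMGT

/-! ### Conclusion: supremum in time and well-definedness. -/

theorem mainTheorem7 (n m : ℕ) (hn : 3 ≤ n) (hm : (n : ℝ) / 2 + 1 < (m : ℝ))
    (τ b c k : ℝ) (hτ : 0 < τ) (hc : 0 < c) (g : ℝ → ℝ) (hg : JMGT.MemoryKernel c g)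
    (hb : τ * c ^ 2 < b) (hcg : τ * JMGT.cgSq c g < τ * c ^ 2)
    (κ : ℕ) (hκ : κ + 2 ≤ m) :
    ∃ C : ℝ, 0 < C ∧
      ∀ (T : ℝ), 0 < T → ∀ (ψ₀ ψ₁ ψ₂ : JMGT.E n → ℝ) (ψ v w : ℝ → JMGT.E n → ℝ),
        JMGT.IsSolution m τ b c k g T ψ₀ ψ₁ ψ₂ ψ v w →
        (∀ σ ∈ Set.Icc (0 : ℝ) T,
          JMGT.MemSobolev (κ + 1) (JMGT.nonlin k (ψ σ) (v σ) (w σ))) ∧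
        ∀ t ∈ Set.Icc (0 : ℝ) T,
          BddAbove ((fun σ => JMGT.energy τ g κ (ψ σ) (v σ) (w σ) (JMGT.history ψ σ)) ''
            Set.Icc 0 t) ∧
          IntervalIntegrable
            (fun σ => JMGT.dissipation τ g κ (ψ σ) (v σ) (w σ) (JMGT.history ψ σ))
            MeasureTheory.volume 0 t ∧
          IntervalIntegrable (fun σ => JMGT.nonlinearPairings τ k κ (ψ σ) (v σ) (w σ))
            MeasureTheory.volume 0 t ∧
          sSup ((fun σ => JMGT.energy τ g κ (ψ σ) (v σ) (w σ) (JMGT.history ψ σ)) ''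
              Set.Icc 0 t)
            + ∫ σ in (0 : ℝ)..t,
                JMGT.dissipation τ g κ (ψ σ) (v σ) (w σ) (JMGT.history ψ σ)
            ≤ C * (JMGT.energy τ g κ ψ₀ ψ₁ ψ₂ (fun _ => ψ₀)
                + ∫ σ in (0 : ℝ)..t, JMGT.nonlinearPairings τ k κ (ψ σ) (v σ) (w σ)) := by
  obtain ⟨s, rfl⟩ : ∃ s, m = s + 1 := ⟨m - 1, by omega⟩
  have hs : (n : ℝ) < 2 * s := by push_cast at hm; linarith
  have hn0 : 0 < n := by omega
  have hκs : κ + 1 ≤ s := by omega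
  obtain ⟨C, hC0, hC⟩ := JMGT.abstract_estimate hg hτ hb
  -- The factor 2 arises because the supremum of the energy and the integral of the dissipation are
  -- bounded separately, each by the same right-hand side.
  refine ⟨2 * C, by positivity, fun T hT ψ₀ ψ₁ ψ₂ ψ v w h =>
    ⟨fun σ hσ => ((h.contSobolev_nonlin hn0 hs).1 σ hσ).mono hκs, fun t ht => ?_⟩⟩
  choose! q hq using fun t (ht : t ∈ Icc 0 T) => (h.cont_ψ.1 t ht).exists_hasSymbol (by omega)
  set S := JMGT.specPaths T k κ ψ v w q with hS
  have hB : S.Bdd := h.bdd_specPaths hT.le hn0 hs hq hκs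
  have hh := hg.antitoneKernel_neg_deriv
  have cE := JMGT.SpecPaths.continuous_energy (τ := τ) hh hB
  have cD := JMGT.SpecPaths.continuous_dissipation (τ := τ) hh hB
  have cP := JMGT.SpecPaths.continuous_pairings (τ := τ) hB
  have sub : Icc 0 t ⊆ Icc 0 T := Icc_subset_Icc_right ht.2
  have usub : uIcc 0 t ⊆ Icc 0 T := by rwa [uIcc_of_le ht.1]
  have eE : EqOn (fun σ => JMGT.energy τ g κ (ψ σ) (v σ) (w σ) (JMGT.history ψ σ))
      (S.energy τ fun s => -deriv g s) (Icc 0 T) := fun σ hσ => h.energy_eq hq hκs hσ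
  have eD : EqOn (fun σ => JMGT.dissipation τ g κ (ψ σ) (v σ) (w σ) (JMGT.history ψ σ))
      (S.dissipation τ fun s => -deriv g s) (Icc 0 T) := fun σ hσ => h.dissipation_eq hq hκs hσ
  have eP : EqOn (fun σ => JMGT.nonlinearPairings τ k κ (ψ σ) (v σ) (w σ))
      (S.pairings τ) (Icc 0 T) := fun σ hσ => h.nonlinearPairings_eq hn0 hs hq hκs hσ
  have est : ∀ σ ∈ Icc 0 T, S.energy τ (fun s => -deriv g s) σ
      + ∫ ρ in (0 : ℝ)..σ, S.dissipation τ (fun s => -deriv g s) ρ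
      ≤ C * (S.energy τ (fun s => -deriv g s) 0 + ∫ ρ in (0 : ℝ)..σ, S.pairings τ ρ) :=
    fun σ hσ => h.specPaths_estimate hT.le hτ hn0 hs hg hq hκs (fun G => hC T G) hσ
  have e0 : JMGT.energy τ g κ ψ₀ ψ₁ ψ₂ (fun _ => ψ₀) = S.energy τ (fun s => -deriv g s) 0 := by
    rw [← h.energy_init]
    exact eE ⟨le_rfl, hT.le⟩
  have iD : ∫ σ in (0 : ℝ)..t, JMGT.dissipation τ g κ (ψ σ) (v σ) (w σ) (JMGT.history ψ σ)
      = ∫ σ in (0 : ℝ)..t, S.dissipation τ (fun s => -deriv g s) σ :=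
    intervalIntegral.integral_congr fun σ hσ => eD (usub hσ)
  have iP : ∫ σ in (0 : ℝ)..t, JMGT.nonlinearPairings τ k κ (ψ σ) (v σ) (w σ)
      = ∫ σ in (0 : ℝ)..t, S.pairings τ σ :=
    intervalIntegral.integral_congr fun σ hσ => eP (usub hσ)
  have image : (fun σ => JMGT.energy τ g κ (ψ σ) (v σ) (w σ) (JMGT.history ψ σ)) '' Icc 0 t
      = (S.energy τ fun s => -deriv g s) '' Icc 0 t := (eE.mono sub).image_eq
  refine ⟨?_, ?_, ?_, ?_⟩
  · rw [image]
    exact (isCompact_Icc.image cE).bddAbove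
  · refine (cD.intervalIntegrable 0 t).congr fun σ hσ => (eD (usub ?_)).symm
    exact uIoc_subset_uIcc hσ
  · refine (cP.intervalIntegrable 0 t).congr fun σ hσ => (eP (usub ?_)).symm
    exact uIoc_subset_uIcc hσ
  · rw [image, e0, iD, iP]
    -- The pairings enter with absolute values, so their time integral is monotone and the bound at
    -- σ can be replaced by the bound at t.
    have mono : ∀ σ ∈ Icc 0 t, ∫ ρ in (0 : ℝ)..σ, S.pairings τ ρ ≤ ∫ ρ in (0 : ℝ)..t, S.pairings τ ρ :=
      fun σ hσ => intervalIntegral.integral_mono_interval le_rfl hσ.1 hσ.2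
        (ae_of_all _ fun ρ => JMGT.SpecPaths.pairings_nonneg ρ) (cP.intervalIntegrable 0 t)
    have nonnegD : ∀ σ, 0 ≤ σ → 0 ≤ ∫ ρ in (0 : ℝ)..σ, S.dissipation τ (fun s => -deriv g s) ρ :=
      fun σ hσ => intervalIntegral.integral_nonneg hσ fun ρ _ =>
        JMGT.SpecPaths.dissipation_nonneg hh ρ
    have nonnegE : 0 ≤ S.energy τ (fun s => -deriv g s) t := by
      have := JMGT.memNormSq_nonneg hh S.p t
      have := JMGT.memNormSq_nonneg hh S.p₁ t
      unfold JMGT.SpecPaths.energy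
      positivity
    have hsup : sSup ((S.energy τ fun s => -deriv g s) '' Icc 0 t)
        ≤ C * (S.energy τ (fun s => -deriv g s) 0 + ∫ ρ in (0 : ℝ)..t, S.pairings τ ρ) := by
      refine csSup_le ((nonempty_Icc.2 ht.1).image _) ?_
      rintro _ ⟨σ, hσ, rfl⟩
      have h1 := est σ (sub hσ)
      have h2 := nonnegD σ hσ.1
      have h3 := mul_le_mul_of_nonneg_left (mono σ hσ) hC0.le
      linarith
    have := est t ht
    linarith
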